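/- Let $M$ be an $(n+m)$-dimensional smooth Riemannian manifold with Levi-Civita connection $\nabla^M$, let $\Sigma$ be an $n$-dimensional smooth manifold, and let $F:\Sigma\times[0,T)\to M$ be a smooth mean curvature flow: each $F_t=F(\cdot,t)$ is an immersion and $\frac{\partial F}{\partial t}=H$, where $H$ is the mean curvature vector (the trace of the second fundamental form) of $F_t$. Equip $\Sigma$ at time $t$ with the metric induced by $F_t$, and let $\nabla^\Sigma$ and $\Delta$ be its Levi-Civita connection and its Laplacian on functions. Let $\Omega$ be a smooth $n$-form on $M$. Fix $t\in[0,T)$ and $p\in\Sigma$. Let $\{e_1,\dots,e_n\}$ be a smooth time-dependent frame of $T\Sigma$, defined for $(x,s)\in\Sigma\times[0,T)$ near $(p,t)$ and orthonormal for the metric induced by $F_s$, and let $\{e_{n+1},\dots,e_{n+m}\}$ be an orthonormal basis of the normal space of $F_t$ at $p$. Tangent vectors of $\Sigma$ are identified with their images under $dF_t$. Latin indices run over $1,\dots,n$ and Greek indices over $n+1,\dots,n+m$. Put $h_{\alpha ik}=\langle\nabla^M_{e_i}e_k,e_\alpha\rangle$, and $R_{\alpha kki}=\langle R(e_k,e_i)e_k,e_\alpha\rangle$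 with $R(X,Y)=\nabla^M_X\nabla^M_Y-\nabla^M_Y\nabla^M_X-\nabla^M_{[X,Y]}$. Let $\Omega_{\cdots\alpha\cdots}$ (with $\alpha$ in the $i$-th place) denote $\Omega(e_1,\dots,e_n)$ with $e_i$ replaced by $e_\alpha$, and let $\Omega_{\cdots\alpha\cdots\beta\cdots}$ (with $\alpha$ in the $i$-th and $\beta$ in the $j$-th place) denote $\Omega(e_1,\dots,e_n)$ with $e_i$ replaced by $e_\alpha$ and $e_j$ by $e_\beta$. Regard $\Omega$ as a section of the pullback bundle $F_t^*\Lambda^nT^*M$ over $\Sigma$ with the connection induced by $\nabla^M$, and put $\nabla^2_{e_k,e_k}\Omega=\nabla^M_{e_k}(\nabla^M_{e_k}\Omega)-\nabla^M_{\nabla^\Sigma_{e_k}e_k}\Omega$ (this is simply $\nabla^M_{e_k}\nabla^M_{e_k}\Omega$ if the frame satisfies $\nabla^\Sigma_{e_k}e_k=0$ at $p$). Then the function $*\Omega=\Omega(e_1,\dots,e_n)$ is differentiable in time at $(p,t)$ (from the right if $t=0$), and at $(p,t)$ $$\begin{aligned} \frac{d}{dt}{*\Omega}={}&\Delta{*\Omega}+{*\Omega}\sum_{\alpha,i,k}h_{\alpha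 ik}^2 -2\sum_{\alpha,\beta,k}\ \sum_{i<j}\Omega_{\cdots\alpha\cdots\beta\cdots}\,h_{\alpha ik}h_{\beta jk} -\sum_{\alpha,k}\sum_i\Omega_{\cdots\alpha\cdots}\,R_{\alpha kki}\\ &+(\nabla^M_H\Omega)(e_1,\dots,e_n)-\sum_k(\nabla^2_{e_k,e_k}\Omega)(e_1,\dots,e_n) -2\sum_{\alpha,k}\sum_i(\nabla^M_{e_k}\Omega)(e_1,\dots,\underset{i}{e_\alpha},\dots,e_n)\,h_{\alpha ik}. \end{aligned}$$ -/

import Mathlib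

open Set Bundle
open scoped Manifold ContDiff Topology

noncomputable section

namespace MCF

/-! ### Linear algebra with respect to a bilinear form on `ℝᵏ` -/

section Algebra

variable {k : ℕ}

/-- The coordinate vector `∂ᵢ`. -/
def basisVec (i : Fin k) : EuclideanSpace ℝ (Fin k) := EuclideanSpace.single i (1 : ℝ)

/-- The matrix `bᵢⱼ = b(∂ᵢ, ∂ⱼ)`. -/
def gram (b : EuclideanSpace ℝ (Fin k) → EuclideanSpace ℝ (Fin k) → ℝ) :
    Matrix (Fin k) (Fin k) ℝ :=
  Matrix.of fun i j => b (basisVec i) (basisVec j)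

/-- Raising an index: `bⁱʲ ℓ(∂ⱼ) ∂ᵢ`, the vector that represents the linear form `ℓ` with respect
to the inner product `b`. -/
def sharp (b : EuclideanSpace ℝ (Fin k) → EuclideanSpace ℝ (Fin k) → ℝ)
    (l : EuclideanSpace ℝ (Fin k) → ℝ) : EuclideanSpace ℝ (Fin k) :=
  ∑ i, ∑ j, ((gram b)⁻¹ i j * l (basisVec j)) • basisVec i

/-- The trace `bⁱʲ B(∂ᵢ, ∂ⱼ)` of a bilinear map `B` with respect to the inner product `b`. -/
def metricTrace {V : Type*} [AddCommGroup V] [Module ℝ V]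
    (b : EuclideanSpace ℝ (Fin k) → EuclideanSpace ℝ (Fin k) → ℝ)
    (B : EuclideanSpace ℝ (Fin k) → EuclideanSpace ℝ (Fin k) → V) : V :=
  ∑ i, ∑ j, (gram b)⁻¹ i j • B (basisVec i) (basisVec j)

/-- Christoffel symbols of a metric `G` on an open subset of `ℝᵏ`, as the vector
`Γ(u, v) = Γᶜₐᵦ uᵃ vᵇ ∂ᶜ` at the point `z`:
`G(Γ(u, v), w) = (1/2) (D_u G(v, w) + D_v G(u, w) - D_w G(u, v))`. -/
def christoffel
    (G : EuclideanSpace ℝ (Fin k) → EuclideanSpace ℝ (Fin k) → EuclideanSpace ℝ (Fin k) → ℝ)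
    (z u v : EuclideanSpace ℝ (Fin k)) : EuclideanSpace ℝ (Fin k) :=
  sharp (G z) fun w =>
    (1 / 2 : ℝ) * (fderiv ℝ (fun y => G y v w) z u + fderiv ℝ (fun y => G y u w) z v
      - fderiv ℝ (fun y => G y u v) z w)

end Algebra

/-! ### The Levi-Civita connection and the curvature, in the preferred charts

In Mathlib a vector of `T_x M` *is* its coordinate vector in the preferred chart at `x`. -/

section Connection

variable {k : ℕ} {M : Type*} [TopologicalSpace M] [ChartedSpace (EuclideanSpace ℝ (Fin k)) M]
  [IsManifold (𝓡 k) ∞ M]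

/-- The vector of `T_x M` whose coordinate vector in the chart at `q` is `v`. -/
def ofCoord (q x : M) (v : EuclideanSpace ℝ (Fin k)) : TangentSpace (𝓡 k) x :=
  tangentCoordChange (𝓡 k) q x x v

/-- The coordinate vector of `v ∈ T_x M` in the chart at `q`. -/
def toCoord (q x : M) (v : TangentSpace (𝓡 k) x) : EuclideanSpace ℝ (Fin k) :=
  tangentCoordChange (𝓡 k) x q x v

/-- A metric `b` on `M` written in the chart at `q`. -/
def metricInChart (b : ∀ x : M, TangentSpace (𝓡 k) x → TangentSpace (𝓡 k) x → ℝ) (q : M)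
    (z u v : EuclideanSpace ℝ (Fin k)) : ℝ :=
  b ((extChartAt (𝓡 k) q).symm z) (ofCoord q ((extChartAt (𝓡 k) q).symm z) u)
    (ofCoord q ((extChartAt (𝓡 k) q).symm z) v)

/-- Christoffel symbols of the metric `b` in the chart at `q`, evaluated at `q`. -/
def christoffelAt (b : ∀ x : M, TangentSpace (𝓡 k) x → TangentSpace (𝓡 k) x → ℝ) (q : M)
    (u v : TangentSpace (𝓡 k) q) : TangentSpace (𝓡 k) q :=
  christoffel (metricInChart b q) (extChartAt (𝓡 k) q q) u v

/-- The curvature `R(u, v)w = ∇_u ∇_v w - ∇_v ∇_u w - ∇_[u, v] w` of the Levi-Civita connection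
of `b` at `q`:
`D_u Γ(v, w) - D_v Γ(u, w) + Γ(u, Γ(v, w)) - Γ(v, Γ(u, w))` in the chart at `q`. -/
def curvature (b : ∀ x : M, TangentSpace (𝓡 k) x → TangentSpace (𝓡 k) x → ℝ) (q : M)
    (u v w : TangentSpace (𝓡 k) q) : TangentSpace (𝓡 k) q :=
  let Γ := christoffel (metricInChart b q)
  let z₀ := extChartAt (𝓡 k) q q
  fderiv ℝ (fun z => Γ z v w) z₀ u - fderiv ℝ (fun z => Γ z u w) z₀ v
    + Γ z₀ u (Γ z₀ v w) - Γ z₀ v (Γ z₀ u w)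

/-- The curvature tensor `R(x, y, z, w) = b(R(z, w)y, x)`; for constant sectional curvature `κ` it is
`κ (b(x, z) b(y, w) - b(x, w) b(y, z))`. -/
def curvature4 (b : ∀ x : M, TangentSpace (𝓡 k) x → TangentSpace (𝓡 k) x → ℝ) (q : M)
    (x y z w : TangentSpace (𝓡 k) q) : ℝ :=
  b q (curvature b q z w y) x

/-- The Riemannian metric `g`, as a function `(x, u, v) ↦ g_x(u, v)`. -/
def metricFun (g : ContMDiffRiemannianMetric (𝓡 k) ∞ (EuclideanSpace ℝ (Fin k))
      (fun x : M => TangentSpace (𝓡 k) x)) (x : M) (u v : TangentSpace (𝓡 k) x) : ℝ :=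
  g.inner x u v

/-- The Laplace-Beltrami operator `Δφ = bⁱʲ (∂ᵢ ∂ⱼ φ - Γᵏᵢⱼ ∂ₖ φ)` of the metric `b`. -/
def laplacian (b : ∀ x : M, TangentSpace (𝓡 k) x → TangentSpace (𝓡 k) x → ℝ) (φ : M → ℝ)
    (x : M) : ℝ :=
  metricTrace (b x) fun u v =>
    fderiv ℝ (fun z => fderiv ℝ (φ ∘ (extChartAt (𝓡 k) x).symm) z v) (extChartAt (𝓡 k) x x) u
      - fderiv ℝ (φ ∘ (extChartAt (𝓡 k) x).symm) (extChartAt (𝓡 k) x x) (christoffelAt b x u v)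

/-- A field `Ω` of alternating `n`-forms is smooth if its components in the charts are. -/
def IsSmoothForm {n : ℕ} (Ω : ∀ q : M, TangentSpace (𝓡 k) q [⋀^Fin n]→L[ℝ] ℝ) : Prop :=
  ∀ q : M, ∀ v : Fin n → EuclideanSpace ℝ (Fin k),
    ContDiffOn ℝ ∞
      (fun z => Ω ((extChartAt (𝓡 k) q).symm z)
        fun i => ofCoord q ((extChartAt (𝓡 k) q).symm z) (v i))
      (extChartAt (𝓡 k) q).target

variable {n : ℕ} {S : Type*} [TopologicalSpace S] [ChartedSpace (EuclideanSpace ℝ (Fin n)) S]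
  [IsManifold (𝓡 n) ∞ S]

/-- The derivative `D_u φ` at `x`, in the direction `u ∈ T_x S`, of a function `φ` with values in a
normed space. -/
def dirDeriv {V : Type*} [NormedAddCommGroup V] [NormedSpace ℝ V] (φ : S → V) (x : S)
    (u : TangentSpace (𝓡 n) x) : V :=
  mfderiv (𝓡 n) 𝓘(ℝ, V) φ x u

/-- The covariant derivative `∇_u V`, at `x` and in the direction `u ∈ T_x S`, of a vector field `V`
along the map `f : S → M`, for the Levi-Civita connection of `b` on `M`. -/
def covAlong (b : ∀ x : M, TangentSpace (𝓡 k) x → TangentSpace (𝓡 k) x → ℝ) (f : S → M)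
    (V : ∀ x : S, TangentSpace (𝓡 k) (f x)) (x : S) (u : TangentSpace (𝓡 n) x) :
    TangentSpace (𝓡 k) (f x) :=
  dirDeriv (fun x' => toCoord (f x) (f x') (V x')) x u
    + christoffel (metricInChart b (f x)) (extChartAt (𝓡 k) (f x) (f x))
        (mfderiv (𝓡 n) (𝓡 k) f x u) (V x)

/-- The covariant derivative `∇_u τ`, at `x` and in the direction `u ∈ T_x S`, of a field
`τ x : (T_{f x} M)^l → ℝ` of covariant `l`-tensors along the map `f : S → M`:
`(∇_u τ)(v₁, …, v_l) = D_u (τ(v₁, …, v_l)) - ∑ᵢ τ(v₁, …, Γ(df u, vᵢ), …, v_l)`, where on the right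
the `vᵢ` are extended with constant components in the chart at `f x`. For `f = id` this is the
covariant derivative of tensors on `M`. -/
def covTensorAlong (b : ∀ x : M, TangentSpace (𝓡 k) x → TangentSpace (𝓡 k) x → ℝ) (f : S → M)
    {l : ℕ} (τ : ∀ x : S, (Fin l → TangentSpace (𝓡 k) (f x)) → ℝ) (x : S)
    (u : TangentSpace (𝓡 n) x) (v : Fin l → TangentSpace (𝓡 k) (f x)) : ℝ :=
  dirDeriv (fun x' => τ x' fun i => ofCoord (f x) (f x') (v i)) x u
    - ∑ i, τ x (Function.update v i
        (christoffelAt b (f x) (mfderiv (𝓡 n) (𝓡 k) f x u) (v i)))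

end Connection

/-! ### Submanifold geometry and the mean curvature flow -/

section Flow

variable {k n : ℕ} {M : Type*} [TopologicalSpace M] [ChartedSpace (EuclideanSpace ℝ (Fin k)) M]
  [IsManifold (𝓡 k) ∞ M]
  {S : Type*} [TopologicalSpace S] [ChartedSpace (EuclideanSpace ℝ (Fin n)) S]
  [IsManifold (𝓡 n) ∞ S]

/-- The metric on `S` induced by `f : S → M`. -/
def inducedMetric (b : ∀ x : M, TangentSpace (𝓡 k) x → TangentSpace (𝓡 k) x → ℝ) (f : S → M)
    (x : S) (u v : TangentSpace (𝓡 n) x) : ℝ :=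
  b (f x) (mfderiv (𝓡 n) (𝓡 k) f x u) (mfderiv (𝓡 n) (𝓡 k) f x v)

/-- The component of `w ∈ T_{f x} M` normal to the image of `df`. -/
def normalPart (b : ∀ x : M, TangentSpace (𝓡 k) x → TangentSpace (𝓡 k) x → ℝ) (f : S → M)
    (x : S) (w : TangentSpace (𝓡 k) (f x)) : TangentSpace (𝓡 k) (f x) :=
  w - mfderiv (𝓡 n) (𝓡 k) f x
    (sharp (inducedMetric (n := n) b f x) fun u => b (f x) w (mfderiv (𝓡 n) (𝓡 k) f x u))

/-- The second fundamental form `(∇_u df(v))^⊥` of the immersion `f`, where `v` is extended near `x`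
with constant components in the chart at `x`. -/
def secondFundamentalForm (b : ∀ x : M, TangentSpace (𝓡 k) x → TangentSpace (𝓡 k) x → ℝ)
    (f : S → M) (x : S) (u v : TangentSpace (𝓡 n) x) : TangentSpace (𝓡 k) (f x) :=
  normalPart (n := n) b f x
    (covAlong (n := n) b f (fun x' => mfderiv (𝓡 n) (𝓡 k) f x' (ofCoord x x' v)) x u)

/-- The mean curvature vector, the trace of the second fundamental form. -/
def meanCurvature (b : ∀ x : M, TangentSpace (𝓡 k) x → TangentSpace (𝓡 k) x → ℝ)
    (f : S → M) (x : S) : TangentSpace (𝓡 k) (f x) :=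
  metricTrace (k := n) (V := EuclideanSpace ℝ (Fin k)) (inducedMetric b f x)
    (secondFundamentalForm b f x)

/-- `F : [0, T) × S → M` is a smooth family of immersions that moves by its mean curvature vector,
`∂F/∂t = H`. -/
structure IsMeanCurvatureFlow
    (b : ∀ x : M, TangentSpace (𝓡 k) x → TangentSpace (𝓡 k) x → ℝ) (T : ℝ) (F : ℝ → S → M) :
    Prop where
  smooth : ContMDiffOn (𝓘(ℝ, ℝ).prod (𝓡 n)) (𝓡 k) ∞ (fun z : ℝ × S => F z.1 z.2)
    (Ico 0 T ×ˢ univ)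
  immersion : ∀ t ∈ Ico 0 T, ∀ x : S, Function.Injective (mfderiv (𝓡 n) (𝓡 k) (F t) x)
  evolution : ∀ t ∈ Ico 0 T, ∀ x : S,
    mfderivWithin 𝓘(ℝ, ℝ) (𝓡 k) (fun s => F s x) (Ico 0 T) t (1 : ℝ) = meanCurvature (n := n) b (F t) x

/-- `e s x = (e₁, …, eₙ)` is a smooth family of frames of `T_x S`, for `(s, x)` in the part of a
neighbourhood of `(t, p)` where the flow is defined, orthonormal for the metric induced by `F s`. -/
def IsOrthonormalTangentFrameNear
    (b : ∀ x : M, TangentSpace (𝓡 k) x → TangentSpace (𝓡 k) x → ℝ) (T : ℝ) (F : ℝ → S → M)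
    (t : ℝ) (p : S) (e : ℝ → ∀ x : S, Fin n → TangentSpace (𝓡 n) x) : Prop :=
  ∃ W : Set (ℝ × S), IsOpen W ∧ (t, p) ∈ W ∧
    (∀ i, ContMDiffOn (𝓘(ℝ, ℝ).prod (𝓡 n)) ((𝓡 n).prod 𝓘(ℝ, EuclideanSpace ℝ (Fin n))) ∞
      (fun z : ℝ × S => TotalSpace.mk' (EuclideanSpace ℝ (Fin n))
        (E := fun x : S => TangentSpace (𝓡 n) x) z.2 (e z.1 z.2 i))
      (W ∩ Ico 0 T ×ˢ univ)) ∧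
    ∀ z ∈ W ∩ Ico 0 T ×ˢ univ, ∀ i j,
      inducedMetric b (F z.1) z.2 (e z.1 z.2 i) (e z.1 z.2 j) = if i = j then 1 else 0

/-- `ν` is an orthonormal system of vectors of `T_{f x} M` normal to the image of `df`. -/
def IsOrthonormalNormalFrame {m : ℕ}
    (b : ∀ x : M, TangentSpace (𝓡 k) x → TangentSpace (𝓡 k) x → ℝ) (f : S → M) (x : S)
    (ν : Fin m → TangentSpace (𝓡 k) (f x)) : Prop :=
  (∀ α β, b (f x) (ν α) (ν β) = if α = β then 1 else 0) ∧
    ∀ α, ∀ u : TangentSpace (𝓡 n) x, b (f x) (ν α) (mfderiv (𝓡 n) (𝓡 k) f x u) = 0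

/-- The function `*Ω = Ω(e₁, …, eₙ)` on `S`, for the immersion `f` and the tangent frame `e`. -/
def starForm (Ω : ∀ q : M, TangentSpace (𝓡 k) q [⋀^Fin n]→L[ℝ] ℝ) (f : S → M)
    (e : ∀ x : S, Fin n → TangentSpace (𝓡 n) x) (x : S) : ℝ :=
  Ω (f x) fun i => mfderiv (𝓡 n) (𝓡 k) f x (e x i)

end Flow

end MCF

end

open Set Bundle
open scoped Manifold ContDiff Topology

noncomputable section

set_option linter.unusedSectionVars false
set_option maxSynthPendingDepth 3

/-! Write Eᵢ = dF(eᵢ), let II be the second fundamental form, and compare the time derivative of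
Ω(E₁, …, Eₙ) with its Laplacian. Throughout, ∇II is taken with the ambient connection on the values
of II and is not projected to the normal space.

Time: mixed derivatives commute, so ∇_t Eᵢ = ∇_{eᵢ}H + dF(∂ₜeᵢ). The product rule gives (∇_HΩ)(E)
plus the sum over i of Ω with ∇_t Eᵢ in slot i. Alternation removes the components along Eⱼ, j ≠ i,
and |Eᵢ| = 1 removes the component along Eᵢ. Only the normal part of ∇_{eᵢ}H = ∑ₖ (∇_{eᵢ}II)(eₖ, eₖ)
survives (`cov_meanCurvature`).

Space: ∇_{eₖ}Eᵢ = II(eₖ, eᵢ) + ∑ⱼ cᵢⱼEⱼ with c antisymmetric. The frame is arbitrary, so c need not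
vanish at p, but its contributions cancel. The Hessian of *Ω on (eₖ, eₖ) is the sum of ∇²Ω, twice
the terms with one II in (∇_{eₖ}Ω), the terms with II in two slots, and the terms with
(∇_{eₖ}II)(eₖ, eᵢ) in slot i (`IsIsometricNear.second_derivative`, `fderiv_fderiv_form_frame`).

In the last group, the component along Eᵢ is -|II(eₖ, eᵢ)|², by differentiating ⟨II, dF⟩ = 0
(`metric_covSff_tangent`). It produces -*Ω|h|². The normal component is that of (∇_{eᵢ}II)(eₖ, eₖ) +
R(eₖ, eᵢ)eₖ by `codazzi`. Subtracting the Laplacian from the time derivative cancels the ∇II terms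
and leaves the formula (`evolution_form`).

This computation is made for a map between normed spaces with a metric and connections. It is
carried to the manifolds by writing everything in the two fixed charts at p and F(p, t). The
geometric definitions use a different preferred chart at each point, and the bridge is the
transformation law of the Christoffel symbols (`chr_transition`), itself the Gauss formula applied
to a transition map. -/

namespace MCF

/-! ### Alternating forms evaluated on frames -/

section Alternating

variable {ι V X : Type*} [Fintype ι] [DecidableEq ι] [NormedAddCommGroup V] [NormedSpace ℝ V]
  [NormedAddCommGroup X] [NormedSpace ℝ X]

/-- The derivation action `∑ᵢ τ(v₁, …, γ vᵢ, …, vₗ)` of an endomorphism `γ` on an alternating form. -/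
def derivAct (τ : V [⋀^ι]→L[ℝ] ℝ) (γ : V →L[ℝ] V) : V [⋀^ι]→L[ℝ] ℝ :=
  τ.fderivCompContinuousLinearMap (ContinuousLinearMap.id ℝ V) γ

theorem derivAct_apply (τ : V [⋀^ι]→L[ℝ] ℝ) (γ : V →L[ℝ] V) (v : ι → V) :
    derivAct τ γ v = ∑ i, τ (Function.update v i (γ (v i))) := by
  simp only [derivAct, ContinuousAlternatingMap.fderivCompContinuousLinearMap_apply]
  refine Finset.sum_congr rfl fun i _ => congrArg τ ?_
  ext j
  by_cases h : j = i
  · subst h; simp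
  · simp [h]

theorem map_update_sum (τ : V [⋀^ι]→L[ℝ] ℝ) (v : ι → V) (i : ι) {κ : Type*} (s : Finset κ)
    (w : κ → V) :
    τ (Function.update v i (∑ a ∈ s, w a)) = ∑ a ∈ s, τ (Function.update v i (w a)) :=
  map_sum (τ.toContinuousMultilinearMap.toMultilinearMap.toLinearMap v i) w s

theorem map_update_frame_ne (τ : V [⋀^ι]→L[ℝ] ℝ) (v : ι → V) {i j : ι} (h : j ≠ i) :
    τ (Function.update v i (v j)) = 0 :=
  τ.map_eq_zero_of_eq _ (i := i) (j := j) (by simp [h]) h.symm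

theorem map_update_frame_sum (τ : V [⋀^ι]→L[ℝ] ℝ) (v : ι → V) (i : ι) (c : ι → ℝ) :
    τ (Function.update v i (∑ j, c j • v j)) = c i * τ v := by
  rw [map_update_sum, Finset.sum_eq_single i]
  · simp
  · intro j _ hj
    simp [map_update_frame_ne τ v hj]
  · simp

/-- The two argument tuples differ by the transposition of the slots `i` and `j`. -/
theorem map_update_update_swap (τ : V [⋀^ι]→L[ℝ] ℝ) (v : ι → V) {i j : ι} (h : i ≠ j) (a : V) :
    τ (Function.update (Function.update v i a) j (v i)) = -τ (Function.update v j a) := by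
  have := τ.toAlternatingMap.map_swap (Function.update v j a) h
  rw [← ContinuousAlternatingMap.coe_toAlternatingMap, ← this]
  congr 1
  ext l
  simp only [Function.comp_apply]
  by_cases hj : l = j
  · subst hj; simp [h]
  · by_cases hi : l = i
    · subst hi; simp [h]
    · simp [Equiv.swap_apply_of_ne_of_ne hi hj, hi, hj]

/-- Every `l` other than `i` and `j` repeats a frame vector. The term `l = j` restores slot `j`, and
`l = i` is a transposition, whence the minus sign. -/
theorem map_update_update_frame_sum (τ : V [⋀^ι]→L[ℝ] ℝ) (v : ι → V) {i j : ι} (h : i ≠ j)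
    (a : V) (c : ι → ℝ) :
    τ (Function.update (Function.update v i a) j (∑ l, c l • v l))
      = c j * τ (Function.update v i a) - c i * τ (Function.update v j a) := by
  rw [map_update_sum, ← Finset.sum_erase_add _ _ (Finset.mem_univ j),
    ← Finset.sum_erase_add (Finset.univ.erase j) _ (Finset.mem_erase.2 ⟨h, Finset.mem_univ i⟩),
    Finset.sum_eq_zero]
  · have hj : Function.update (Function.update v i a) j (v j) = Function.update v i a := by
      rw [Function.update_comm h, Function.update_eq_self]
    simp only [ContinuousAlternatingMap.map_update_smul, map_update_update_swap τ v h a, hj,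
      smul_eq_mul]
    ring
  · intro l hl
    simp only [Finset.mem_erase, Finset.mem_univ, and_true] at hl
    rw [ContinuousAlternatingMap.map_update_smul,
      τ.map_eq_zero_of_eq _ (i := j) (j := l) (by simp [hl.1, hl.2]) (Ne.symm hl.2), smul_zero]

/-- A tangential perturbation of the entries by a matrix with vanishing diagonal does not
contribute. -/
theorem sum_map_update_add_frame (τ : V [⋀^ι]→L[ℝ] ℝ) (v a : ι → V) (c : ι → ι → ℝ)
    (hc : ∀ i, c i i = 0) :
    ∑ i, τ (Function.update v i (a i + ∑ j, c i j • v j)) = ∑ i, τ (Function.update v i (a i)) := by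
  refine Finset.sum_congr rfl fun i _ => ?_
  rw [ContinuousAlternatingMap.map_update_add, map_update_frame_sum, hc, zero_mul, add_zero]

/-- The contributions of `γ` cancel between `derivAct` and the updated slots. The same derivative
`D` therefore serves for every `γ`, and any connection can be inserted into the ordinary product
rule afterwards. -/
theorem hasFDerivWithinAt_form_apply {τ : X → V [⋀^ι]→L[ℝ] ℝ} {τ' : X →L[ℝ] V [⋀^ι]→L[ℝ] ℝ}
    {Y : ι → X → V} {Y' : ι → X →L[ℝ] V} {s : Set X} {x : X}
    (hτ : HasFDerivWithinAt τ τ' s x) (hY : ∀ i, HasFDerivWithinAt (Y i) (Y' i) s x) :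
    ∃ D : X →L[ℝ] ℝ, HasFDerivWithinAt (fun x => τ x (Y · x)) D s x ∧
      ∀ (u : X) (γ : V →L[ℝ] V), D u = (τ' u - derivAct (τ x) γ) (Y · x)
        + ∑ i, τ x (Function.update (Y · x) i (Y' i u + γ (Y i x))) := by
  refine ⟨_, hτ.continuousAlternatingMap_apply hY, fun u γ => ?_⟩
  simp only [ContinuousAlternatingMap.map_update_add, Finset.sum_add_distrib,
    ContinuousAlternatingMap.sub_apply, derivAct_apply]
  simp

/-- The product rule for `τ(Y₁, …, Yₗ)`, with respect to covariant derivatives. -/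
theorem fderiv_form_apply {τ : X → V [⋀^ι]→L[ℝ] ℝ} {Y : ι → X → V} {x : X}
    (hτ : DifferentiableAt ℝ τ x) (hY : ∀ i, DifferentiableAt ℝ (Y i) x) (u : X) (γ : V →L[ℝ] V) :
    fderiv ℝ (fun x => τ x (Y · x)) x u = (fderiv ℝ τ x u - derivAct (τ x) γ) (Y · x)
        + ∑ i, τ x (Function.update (Y · x) i (fderiv ℝ (Y i) x u + γ (Y i x))) := by
  obtain ⟨D, hD, h⟩ := hasFDerivWithinAt_form_apply hτ.hasFDerivAt.hasFDerivWithinAt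
    (s := univ) (fun i => (hY i).hasFDerivAt.hasFDerivWithinAt)
  rw [(hD.hasFDerivAt Filter.univ_mem).fderiv, h u γ]

theorem hasDerivWithinAt_form_apply {τ : ℝ → V [⋀^ι]→L[ℝ] ℝ} {τ' : V [⋀^ι]→L[ℝ] ℝ}
    {Y : ι → ℝ → V} {Y' : ι → V} {s : Set ℝ} {t : ℝ}
    (hτ : HasDerivWithinAt τ τ' s t) (hY : ∀ i, HasDerivWithinAt (Y i) (Y' i) s t)
    (γ : V →L[ℝ] V) :
    HasDerivWithinAt (fun x => τ x (Y · x)) ((τ' - derivAct (τ t) γ) (Y · t)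
        + ∑ i, τ t (Function.update (Y · t) i (Y' i + γ (Y i t)))) s t := by
  obtain ⟨D, hD, h⟩ := hasFDerivWithinAt_form_apply hτ.hasFDerivWithinAt
    (fun i => (hY i).hasFDerivWithinAt)
  convert hD.hasDerivWithinAt using 1
  rw [h 1 γ]
  simp

/-- A family of alternating forms on a finite dimensional space depends smoothly on a parameter if
its components do. -/
theorem exists_clm_reconstruct (ι V : Type*) [Fintype ι] [NormedAddCommGroup V] [NormedSpace ℝ V]
    [FiniteDimensional ℝ V] :
    ∃ (N : ℕ) (b : Fin N → ι → V) (L : (Fin N → ℝ) →L[ℝ] V [⋀^ι]→L[ℝ] ℝ),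
      ∀ τ : V [⋀^ι]→L[ℝ] ℝ, L (fun a => τ (b a)) = τ := by
  classical
  let B := Module.finBasis ℝ V
  let e := Fintype.equivFin (ι → Fin (Module.finrank ℝ V))
  let ev : (V [⋀^ι]→L[ℝ] ℝ) →ₗ[ℝ] (Fin (Fintype.card (ι → Fin (Module.finrank ℝ V))) → ℝ) :=
    { toFun := fun τ a => τ (fun i => B (e.symm a i))
      map_add' := fun _ _ => rfl
      map_smul' := fun _ _ => rfl }
  have hev : LinearMap.ker ev = ⊥ := by
    rw [LinearMap.ker_eq_bot]
    intro τ σ h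
    have h2 : τ.toAlternatingMap.toMultilinearMap = σ.toAlternatingMap.toMultilinearMap := by
      refine Module.Basis.ext_multilinear (fun _ => B) fun s => ?_
      have := congrFun h (e s)
      simpa [ev] using this
    ext v
    exact congrArg (fun T => T v) h2
  -- Evaluation on all tuples of basis vectors is injective, so it has a linear left inverse, which
  -- is continuous because its source is finite dimensional.
  obtain ⟨L, hL⟩ := LinearMap.exists_leftInverse_of_injective ev hev
  exact ⟨_, fun a i => B (e.symm a i), LinearMap.toContinuousLinearMap L,
    fun τ => congrArg (fun T => T τ) hL⟩

theorem contDiffOn_form [FiniteDimensional ℝ V] {τ : X → V [⋀^ι]→L[ℝ] ℝ} {s : Set X} {n : ℕ∞ω}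
    (h : ∀ v, ContDiffOn ℝ n (fun x => τ x v) s) : ContDiffOn ℝ n τ s := by
  obtain ⟨N, b, L, hL⟩ := exists_clm_reconstruct ι V
  have : τ = fun x => L (fun a => τ x (b a)) := by ext1 x; rw [hL]
  rw [this]
  exact L.contDiff.comp_contDiffOn (contDiffOn_pi.2 fun a => h _)

theorem differentiableAt_form [FiniteDimensional ℝ V] {τ : X → V [⋀^ι]→L[ℝ] ℝ} {x : X}
    (h : ∀ v, DifferentiableAt ℝ (fun x => τ x v) x) : DifferentiableAt ℝ τ x := by
  obtain ⟨N, b, L, hL⟩ := exists_clm_reconstruct ι V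
  have : τ = fun x => L (fun a => τ x (b a)) := by ext1 x; rw [hL]
  rw [this]
  exact L.differentiableAt.comp x (differentiableAt_pi.2 fun a => h _)

theorem differentiableAt_derivAct [FiniteDimensional ℝ V] {τ : X → V [⋀^ι]→L[ℝ] ℝ}
    {γ : X → V →L[ℝ] V} {x : X} (hτ : DifferentiableAt ℝ τ x) (hγ : DifferentiableAt ℝ γ x) :
    DifferentiableAt ℝ (fun x => derivAct (τ x) (γ x)) x := by
  refine differentiableAt_form fun v => ?_
  simp only [derivAct_apply]
  refine DifferentiableAt.fun_sum fun i _ => hτ.continuousAlternatingMap_apply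
    (g := fun j x => Function.update v i (γ x (v i)) j) fun j => ?_
  by_cases h : j = i
  · subst h
    simpa using hγ.clm_apply (differentiableAt_const _)
  · simp [h]

end Alternating

/-! ### The Gauss and Codazzi equations for a map between normed spaces -/

section Gauss

variable {X V : Type*} [NormedAddCommGroup X] [NormedSpace ℝ X] [NormedAddCommGroup V]
  [NormedSpace ℝ V] {W : Type*} [NormedAddCommGroup W] [NormedSpace ℝ W]

/-- Pull back both arguments of a bilinear map. -/
def pull (B : V →L[ℝ] V →L[ℝ] W) (A : X →L[ℝ] V) : X →L[ℝ] X →L[ℝ] W :=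
  ((B.comp A).flip.comp A).flip

@[simp] theorem pull_apply (B : V →L[ℝ] V →L[ℝ] W) (A : X →L[ℝ] V) (u v : X) :
    pull B A u v = B (A u) (A v) := rfl

theorem contDiffAt_pull {Y : Type*} [NormedAddCommGroup Y] [NormedSpace ℝ Y]
    {B : Y → V →L[ℝ] V →L[ℝ] W} {A : Y → X →L[ℝ] V} {y : Y} {n : ℕ∞ω} (hB : ContDiffAt ℝ n B y)
    (hA : ContDiffAt ℝ n A y) : ContDiffAt ℝ n (fun y => pull (B y) (A y)) y := by
  have a := (ContinuousLinearMap.flipₗᵢ ℝ X V W).contDiff.contDiffAt.comp y (hB.clm_comp hA)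
  exact (ContinuousLinearMap.flipₗᵢ ℝ X X W).contDiff.contDiffAt.comp y (a.clm_comp hA)

/-- The second fundamental form of `f`, for the connections `Γ` on the target and `Γ'` on the
source. -/
def sff (Γ : V → V →L[ℝ] V →L[ℝ] V) (f : X → V) (Γ' : X → X →L[ℝ] X →L[ℝ] X) (x : X) :
    X →L[ℝ] X →L[ℝ] V :=
  fderiv ℝ (fderiv ℝ f) x + pull (Γ (f x)) (fderiv ℝ f x)
    - (ContinuousLinearMap.compL ℝ X X V (fderiv ℝ f x)).comp (Γ' x)

theorem sff_apply (Γ : V → V →L[ℝ] V →L[ℝ] V) (f : X → V) (Γ' : X → X →L[ℝ] X →L[ℝ] X) (x u v : X) :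
    sff Γ f Γ' x u v = fderiv ℝ (fderiv ℝ f) x u v + Γ (f x) (fderiv ℝ f x u) (fderiv ℝ f x v)
      - fderiv ℝ f x (Γ' x u v) := rfl

/-- The covariant derivative of the second fundamental form. -/
def covSff (Γ : V → V →L[ℝ] V →L[ℝ] V) (f : X → V) (Γ' : X → X →L[ℝ] X →L[ℝ] X) (x w u v : X) : V :=
  fderiv ℝ (sff Γ f Γ') x w u v + Γ (f x) (fderiv ℝ f x w) (sff Γ f Γ' x u v)
    - sff Γ f Γ' x (Γ' x w u) v - sff Γ f Γ' x u (Γ' x w v)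

/-- The curvature of the connection `Γ`. -/
def curv (Γ : V → V →L[ℝ] V →L[ℝ] V) (z u v w : V) : V :=
  fderiv ℝ Γ z u v w - fderiv ℝ Γ z v u w + Γ z u (Γ z v w) - Γ z v (Γ z u w)

/-- A map `f` near `x₀` between spaces with metric connections: the second fundamental form takes
normal values. -/
structure IsIsometricNear (G : V → V →L[ℝ] V →L[ℝ] ℝ) (Γ : V → V →L[ℝ] V →L[ℝ] V) (f : X → V)
    (Γ' : X → X →L[ℝ] X →L[ℝ] X) (x₀ : X) : Prop where
  contDiff_f : ContDiffAt ℝ ∞ f x₀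
  contDiff_G : ContDiffAt ℝ ∞ G (f x₀)
  contDiff_Γ : ContDiffAt ℝ ∞ Γ (f x₀)
  contDiff_Γ' : ContDiffAt ℝ ∞ Γ' x₀
  G_symm : ∀ᶠ z in 𝓝 (f x₀), ∀ u v, G z u v = G z v u
  Γ_symm : ∀ᶠ z in 𝓝 (f x₀), ∀ u v, Γ z u v = Γ z v u
  Γ'_symm : ∀ᶠ x in 𝓝 x₀, ∀ u v, Γ' x u v = Γ' x v u
  compat : ∀ᶠ z in 𝓝 (f x₀), ∀ u v w,
    fderiv ℝ G z u v w = G z (Γ z u v) w + G z v (Γ z u w)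
  gauss : ∀ᶠ x in 𝓝 x₀, ∀ u v w, G (f x) (sff Γ f Γ' x u v) (fderiv ℝ f x w) = 0

variable {G : V → V →L[ℝ] V →L[ℝ] ℝ} {Γ : V → V →L[ℝ] V →L[ℝ] V} {f : X → V}
    {Γ' : X → X →L[ℝ] X →L[ℝ] X} {x₀ : X}

theorem natCast_le_infty (n : ℕ) : (n : ℕ∞ω) ≤ ∞ := by exact_mod_cast le_top

theorem ContDiffAt.eventually_contDiffAt {Y Z : Type*} [NormedAddCommGroup Y] [NormedSpace ℝ Y]
    [NormedAddCommGroup Z] [NormedSpace ℝ Z] {φ : Y → Z} {y : Y} (h : ContDiffAt ℝ ∞ φ y) (n : ℕ) :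
    ∀ᶠ x in 𝓝 y, ContDiffAt ℝ n φ x :=
  (h.of_le (natCast_le_infty n)).eventually (by simp)

theorem ContDiffAt.fderiv_infty {Y Z : Type*} [NormedAddCommGroup Y] [NormedSpace ℝ Y]
    [NormedAddCommGroup Z] [NormedSpace ℝ Z] {φ : Y → Z} {y : Y} (h : ContDiffAt ℝ ∞ φ y) :
    ContDiffAt ℝ ∞ (fderiv ℝ φ) y :=
  h.fderiv_right (by simp)

theorem ContDiffAt.differentiableAt_infty {Y Z : Type*} [NormedAddCommGroup Y] [NormedSpace ℝ Y]
    [NormedAddCommGroup Z] [NormedSpace ℝ Z] {φ : Y → Z} {y : Y} (h : ContDiffAt ℝ ∞ φ y) :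
    DifferentiableAt ℝ φ y :=
  h.differentiableAt (by simp)

theorem ContDiffAt.eventually_differentiableAt {Y Z : Type*} [NormedAddCommGroup Y]
    [NormedSpace ℝ Y] [NormedAddCommGroup Z] [NormedSpace ℝ Z] {φ : Y → Z} {y : Y}
    (h : ContDiffAt ℝ ∞ φ y) : ∀ᶠ x in 𝓝 y, DifferentiableAt ℝ φ x :=
  (ContDiffAt.eventually_contDiffAt h 1).mono fun _ hx => hx.differentiableAt (by simp)

theorem ContDiffAt.two_of_infty {Y Z : Type*} [NormedAddCommGroup Y] [NormedSpace ℝ Y]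
    [NormedAddCommGroup Z] [NormedSpace ℝ Z] {φ : Y → Z} {y : Y} (h : ContDiffAt ℝ ∞ φ y) :
    ContDiffAt ℝ 2 φ y := by
  exact h.of_le (natCast_le_infty 2)

theorem contDiffAt_sff (hf : ContDiffAt ℝ ∞ f x₀) (hΓ : ContDiffAt ℝ ∞ Γ (f x₀))
    (hΓ' : ContDiffAt ℝ ∞ Γ' x₀) : ContDiffAt ℝ ∞ (sff Γ f Γ') x₀ := by
  have h1 := ContDiffAt.fderiv_infty hf
  have h2 := ContDiffAt.fderiv_infty h1
  have h3 : ContDiffAt ℝ ∞ (fun x => Γ (f x)) x₀ := hΓ.comp x₀ hf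
  have h4 : ContDiffAt ℝ ∞ (fun x => pull (Γ (f x)) (fderiv ℝ f x)) x₀ :=
    contDiffAt_pull h3 h1
  have h5 : ContDiffAt ℝ ∞
      (fun x => (ContinuousLinearMap.compL ℝ X X V (fderiv ℝ f x)).comp (Γ' x)) x₀ :=
    ((ContinuousLinearMap.compL ℝ X X V).contDiff.contDiffAt.comp x₀ h1).clm_comp hΓ'
  exact (h2.add h4).sub h5

theorem fderiv_fderiv_symm (h : ContDiffAt ℝ 2 f x₀) (u v : X) :
    fderiv ℝ (fderiv ℝ f) x₀ u v = fderiv ℝ (fderiv ℝ f) x₀ v u :=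
  (h.isSymmSndFDerivAt (by simp)) u v

theorem fderiv_clm_apply_const {φ : X → X →L[ℝ] V} (h : DifferentiableAt ℝ φ x₀) (u v : X) :
    fderiv ℝ (fun x => φ x v) x₀ u = fderiv ℝ φ x₀ u v := by
  rw [fderiv_clm_apply h (differentiableAt_const v)]
  simp

/-- The third derivative is symmetric in the first two arguments. -/
theorem fderiv_fderiv_fderiv_symm (h : ContDiffAt ℝ ∞ f x₀) (u v w : X) :
    fderiv ℝ (fderiv ℝ (fderiv ℝ f)) x₀ u v w = fderiv ℝ (fderiv ℝ (fderiv ℝ f)) x₀ v u w :=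
  congrArg (fun T => T w) (fderiv_fderiv_symm
    (ContDiffAt.two_of_infty (ContDiffAt.fderiv_infty h)) u v)

/-- The covariant derivative of a tangential field splits into a normal and a tangential part. -/
theorem cov_tangent {a : X → X} (hf : DifferentiableAt ℝ (fderiv ℝ f) x₀)
    (ha : DifferentiableAt ℝ a x₀) (u : X) :
    fderiv ℝ (fun x => fderiv ℝ f x (a x)) x₀ u + Γ (f x₀) (fderiv ℝ f x₀ u) (fderiv ℝ f x₀ (a x₀))
      = sff Γ f Γ' x₀ u (a x₀) + fderiv ℝ f x₀ (fderiv ℝ a x₀ u + Γ' x₀ u (a x₀)) := by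
  rw [fderiv_clm_apply hf ha, sff_apply]
  simp only [add_apply, ContinuousLinearMap.comp_apply,
    ContinuousLinearMap.flip_apply, map_add]
  abel

/-- The covariant product rule for the metric along `f`. -/
theorem fderiv_metric_apply (hf : DifferentiableAt ℝ f x₀) (hG : DifferentiableAt ℝ G (f x₀))
    (hc : ∀ u v w, fderiv ℝ G (f x₀) u v w = G (f x₀) (Γ (f x₀) u v) w + G (f x₀) v (Γ (f x₀) u w))
    {Y Z : X → V} (hY : DifferentiableAt ℝ Y x₀) (hZ : DifferentiableAt ℝ Z x₀) (u : X) :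
    fderiv ℝ (fun x => G (f x) (Y x) (Z x)) x₀ u
      = G (f x₀) (fderiv ℝ Y x₀ u + Γ (f x₀) (fderiv ℝ f x₀ u) (Y x₀)) (Z x₀)
        + G (f x₀) (Y x₀) (fderiv ℝ Z x₀ u + Γ (f x₀) (fderiv ℝ f x₀ u) (Z x₀)) := by
  have h1 : DifferentiableAt ℝ (fun x => G (f x)) x₀ := hG.comp x₀ hf
  have h2 : fderiv ℝ (fun x => G (f x)) x₀ u = fderiv ℝ G (f x₀) (fderiv ℝ f x₀ u) := by
    rw [show (fun x => G (f x)) = G ∘ f from rfl, fderiv_comp (g := G) x₀ hG hf]; rfl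
  rw [fderiv_clm_apply (h1.clm_apply hY) hZ, fderiv_clm_apply h1 hY]
  simp only [add_apply, ContinuousLinearMap.comp_apply,
    ContinuousLinearMap.flip_apply, map_add, h2, hc]
  ring

theorem sff_symm (hf : ContDiffAt ℝ 2 f x₀) (hΓ : ∀ u v, Γ (f x₀) u v = Γ (f x₀) v u)
    (hΓ' : ∀ u v, Γ' x₀ u v = Γ' x₀ v u) (u v : X) :
    sff Γ f Γ' x₀ u v = sff Γ f Γ' x₀ v u := by
  rw [sff_apply, sff_apply, fderiv_fderiv_symm hf u v, hΓ, hΓ']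

/-- The covariant derivative of `II(a, b)` for moving vector fields `a`, `b`. -/
theorem cov_sff_apply (hs : DifferentiableAt ℝ (sff Γ f Γ') x₀) {a b : X → X}
    (ha : DifferentiableAt ℝ a x₀) (hb : DifferentiableAt ℝ b x₀) (w : X) :
    fderiv ℝ (fun x => sff Γ f Γ' x (a x) (b x)) x₀ w
        + Γ (f x₀) (fderiv ℝ f x₀ w) (sff Γ f Γ' x₀ (a x₀) (b x₀))
      = covSff Γ f Γ' x₀ w (a x₀) (b x₀)
        + sff Γ f Γ' x₀ (fderiv ℝ a x₀ w + Γ' x₀ w (a x₀)) (b x₀)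
        + sff Γ f Γ' x₀ (a x₀) (fderiv ℝ b x₀ w + Γ' x₀ w (b x₀)) := by
  rw [fderiv_clm_apply (hs.clm_apply ha) hb, fderiv_clm_apply hs ha]
  simp only [add_apply, ContinuousLinearMap.comp_apply,
    ContinuousLinearMap.flip_apply, map_add, covSff]
  abel

namespace IsIsometricNear

theorem eventually_sff_symm (h : IsIsometricNear G Γ f Γ' x₀) :
    ∀ᶠ x in 𝓝 x₀, ∀ u v, sff Γ f Γ' x u v = sff Γ f Γ' x v u := by
  filter_upwards [ContDiffAt.eventually_contDiffAt h.contDiff_f 2,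
    h.contDiff_f.continuousAt.eventually h.Γ_symm, h.Γ'_symm] with x h1 h2 h3
  exact sff_symm h1 h2 h3

theorem differentiableAt_sff (h : IsIsometricNear G Γ f Γ' x₀) :
    DifferentiableAt ℝ (sff Γ f Γ') x₀ :=
  ContDiffAt.differentiableAt_infty (contDiffAt_sff h.contDiff_f h.contDiff_Γ h.contDiff_Γ')

/-- The symmetry of II holds on a neighbourhood, hence can be differentiated. The two correction
terms with `Γ'` are exchanged by the symmetry at `x₀`. -/
theorem covSff_symm (h : IsIsometricNear G Γ f Γ' x₀) (w u v : X) :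
    covSff Γ f Γ' x₀ w u v = covSff Γ f Γ' x₀ w v u := by
  have hd := h.differentiableAt_sff
  have hs := h.eventually_sff_symm
  have h1 : fderiv ℝ (sff Γ f Γ') x₀ w u v = fderiv ℝ (sff Γ f Γ') x₀ w v u := by
    have e1 : fderiv ℝ (fun x => sff Γ f Γ' x u v) x₀ w = fderiv ℝ (sff Γ f Γ') x₀ w u v := by
      rw [fderiv_clm_apply (hd.clm_apply (differentiableAt_const u)) (differentiableAt_const v),
        fderiv_clm_apply hd (differentiableAt_const u)]
      simp
    have e2 : fderiv ℝ (fun x => sff Γ f Γ' x v u) x₀ w = fderiv ℝ (sff Γ f Γ') x₀ w v u := by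
      rw [fderiv_clm_apply (hd.clm_apply (differentiableAt_const v)) (differentiableAt_const u),
        fderiv_clm_apply hd (differentiableAt_const v)]
      simp
    rw [← e1, ← e2]
    have : (fun x => sff Γ f Γ' x u v) =ᶠ[𝓝 x₀] fun x => sff Γ f Γ' x v u := by
      filter_upwards [hs] with x hx using hx u v
    rw [this.fderiv_eq]
  have hs0 := hs.self_of_nhds
  simp only [covSff, h1, hs0 u v, hs0 u (Γ' x₀ w v), hs0 (Γ' x₀ w u) v]
  abel

/-- The tangential part of the derivative of the second fundamental form (Weingarten). -/
theorem metric_covSff_tangent (h : IsIsometricNear G Γ f Γ' x₀) (y u v w : X) :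
    G (f x₀) (covSff Γ f Γ' x₀ y u v) (fderiv ℝ f x₀ w)
      = -G (f x₀) (sff Γ f Γ' x₀ u v) (sff Γ f Γ' x₀ y w) := by
  have hd := h.differentiableAt_sff
  have hf := ContDiffAt.differentiableAt_infty h.contDiff_f
  have hf1 := ContDiffAt.differentiableAt_infty (ContDiffAt.fderiv_infty h.contDiff_f)
  have hG := ContDiffAt.differentiableAt_infty h.contDiff_G
  -- The orthogonality ⟨II(u, v), df w⟩ = 0 holds near `x₀` and is differentiated along `y`. By the
  -- Gauss condition all terms that pair II with df vanish.
  have hz : fderiv ℝ (fun x => G (f x) (sff Γ f Γ' x u v) (fderiv ℝ f x w)) x₀ y = 0 := by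
    have : (fun x => G (f x) (sff Γ f Γ' x u v) (fderiv ℝ f x w)) =ᶠ[𝓝 x₀] fun _ => 0 := by
      filter_upwards [h.gauss] with x hx using hx u v w
    rw [this.fderiv_eq]
    simp
  rw [fderiv_metric_apply hf hG h.compat.self_of_nhds
    ((hd.clm_apply (differentiableAt_const u)).clm_apply (differentiableAt_const v))
    (hf1.clm_apply (differentiableAt_const w)),
    cov_sff_apply hd (differentiableAt_const u) (differentiableAt_const v),
    cov_tangent (Γ' := Γ') hf1 (differentiableAt_const w)] at hz
  have hg := h.gauss.self_of_nhds
  simp only [map_add, add_apply, hg, add_zero] at hz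
  linarith

/-- Exchanging the first two arguments of ∇II leaves no third derivative of `f`, by symmetry. What
remains is the curvature of the target plus a vector tangent to the image, and the latter is
invisible to a normal `ν`. -/
theorem codazzi (h : IsIsometricNear G Γ f Γ' x₀) (w u v : X) {ν : V}
    (hν : ∀ y, G (f x₀) (fderiv ℝ f x₀ y) ν = 0) :
    G (f x₀) (covSff Γ f Γ' x₀ w u v) ν = G (f x₀) (covSff Γ f Γ' x₀ u w v) ν
      + G (f x₀) (curv Γ (f x₀) (fderiv ℝ f x₀ w) (fderiv ℝ f x₀ u) (fderiv ℝ f x₀ v)) ν := by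
  have hf := ContDiffAt.differentiableAt_infty h.contDiff_f
  have hf1' := ContDiffAt.fderiv_infty h.contDiff_f
  have hf1 := ContDiffAt.differentiableAt_infty hf1'
  have hf2 := ContDiffAt.differentiableAt_infty (ContDiffAt.fderiv_infty hf1')
  have hΓ := ContDiffAt.differentiableAt_infty h.contDiff_Γ
  have hΓ' := ContDiffAt.differentiableAt_infty h.contDiff_Γ'
  have hΓf : DifferentiableAt ℝ (fun x => Γ (f x)) x₀ := hΓ.comp x₀ hf
  have hc : ∀ u : X, fderiv ℝ (fun x => Γ (f x)) x₀ u = fderiv ℝ Γ (f x₀) (fderiv ℝ f x₀ u) := by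
    intro u
    rw [show (fun x => Γ (f x)) = Γ ∘ f from rfl, fderiv_comp x₀ hΓ hf]; rfl
  have hd := h.differentiableAt_sff
  have key : ∀ w u v : X, fderiv ℝ (sff Γ f Γ') x₀ w u v
      = fderiv ℝ (fderiv ℝ (fderiv ℝ f)) x₀ w u v
        + (fderiv ℝ Γ (f x₀) (fderiv ℝ f x₀ w) (fderiv ℝ f x₀ u) (fderiv ℝ f x₀ v)
        + Γ (f x₀) (fderiv ℝ (fderiv ℝ f) x₀ w u) (fderiv ℝ f x₀ v)
        + Γ (f x₀) (fderiv ℝ f x₀ u) (fderiv ℝ (fderiv ℝ f) x₀ w v))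
        - (fderiv ℝ (fderiv ℝ f) x₀ w (Γ' x₀ u v)
          + fderiv ℝ f x₀ (fderiv ℝ Γ' x₀ w u v)) := by
    intro w u v
    have e1 : fderiv ℝ (fun x => sff Γ f Γ' x u v) x₀ w = fderiv ℝ (sff Γ f Γ') x₀ w u v := by
      rw [fderiv_clm_apply (hd.clm_apply (differentiableAt_const u)) (differentiableAt_const v),
        fderiv_clm_apply hd (differentiableAt_const u)]
      simp
    have a1 := (hf2.clm_apply (differentiableAt_const u)).clm_apply (differentiableAt_const v)
    have a3u := hf1.clm_apply (differentiableAt_const u)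
    have a3v := hf1.clm_apply (differentiableAt_const v)
    have a2' := hΓf.clm_apply a3u
    have a2 := a2'.clm_apply a3v
    have a4' := hΓ'.clm_apply (differentiableAt_const u)
    have a4 := a4'.clm_apply (differentiableAt_const v)
    have a5 := hf1.clm_apply a4
    rw [← e1]
    simp only [sff_apply]
    rw [fderiv_fun_sub (a1.fun_add a2) a5, fderiv_fun_add a1 a2, fderiv_clm_apply a2' a3v,
      fderiv_clm_apply hΓf a3u, fderiv_clm_apply hf1 a4, fderiv_clm_apply a4'
      (differentiableAt_const v), fderiv_clm_apply hΓ' (differentiableAt_const u),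
      fderiv_clm_apply (hf2.clm_apply (differentiableAt_const u)) (differentiableAt_const v),
      fderiv_clm_apply hf2 (differentiableAt_const u), fderiv_clm_apply hf1
      (differentiableAt_const u), fderiv_clm_apply hf1 (differentiableAt_const v)]
    simp [hc]
    abel
  have s3 := fderiv_fderiv_fderiv_symm h.contDiff_f w u v
  have s2 := fun a b => fderiv_fderiv_symm (ContDiffAt.two_of_infty h.contDiff_f) a b
  have sΓ' := h.Γ'_symm.self_of_nhds
  -- The tangential remainder is df applied to the curvature of `Γ'` on `u`, `w`, `v`.
  have hdiff : covSff Γ f Γ' x₀ w u v = covSff Γ f Γ' x₀ u w v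
      + curv Γ (f x₀) (fderiv ℝ f x₀ w) (fderiv ℝ f x₀ u) (fderiv ℝ f x₀ v)
      + fderiv ℝ f x₀ (fderiv ℝ Γ' x₀ u w v - fderiv ℝ Γ' x₀ w u v
        + Γ' x₀ u (Γ' x₀ w v) - Γ' x₀ w (Γ' x₀ u v)) := by
    simp only [covSff, curv, key w u v, key u w v, sff_apply, s3, s2 w u, sΓ' w u, map_add, map_sub]
    abel
  rw [hdiff]
  simp [hν]

end IsIsometricNear

end Gauss

/-! ### Orthonormal frames along a map and the Laplacian of `Ω(e₁, …, eₙ)` -/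

section Frame

variable {ι X V : Type*} [Fintype ι] [DecidableEq ι] [NormedAddCommGroup X] [NormedSpace ℝ X]
  [NormedAddCommGroup V] [NormedSpace ℝ V]
  {G : V → V →L[ℝ] V →L[ℝ] ℝ} {Γ : V → V →L[ℝ] V →L[ℝ] V} {f : X → V}
  {Γ' : X → X →L[ℝ] X →L[ℝ] X} {x₀ x : X} {e : ι → X → X}

/-- The covariant derivative `∇_w σ` of a form on the target. -/
def covForm (Γ : V → V →L[ℝ] V →L[ℝ] V) (σ : V → V [⋀^ι]→L[ℝ] ℝ) (z w : V) : V [⋀^ι]→L[ℝ] ℝ :=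
  fderiv ℝ σ z w - derivAct (σ z) (Γ z w)

/-- The covariant derivative `∇_u a` of a vector field on the source. -/
def covField (Γ' : X → X →L[ℝ] X →L[ℝ] X) (a : X → X) (x u : X) : X :=
  fderiv ℝ a x u + Γ' x u (a x)

/-- `e` is a smooth frame on the source near `x₀`, orthonormal for the induced metric. -/
structure IsFrameNear (G : V → V →L[ℝ] V →L[ℝ] ℝ) (f : X → V) (e : ι → X → X) (x₀ : X) :
    Prop where
  contDiff : ∀ i, ContDiffAt ℝ ∞ (e i) x₀
  orthonormal : ∀ᶠ x in 𝓝 x₀, ∀ i j,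
    G (f x) (fderiv ℝ f x (e i x)) (fderiv ℝ f x (e j x)) = if i = j then 1 else 0
  span : ∀ᶠ x in 𝓝 x₀, ∀ u, u = ∑ j, G (f x) (fderiv ℝ f x u) (fderiv ℝ f x (e j x)) • e j x

/-- The properties of an isometric immersion and an orthonormal frame used for first order
computations at the point `x`. -/
structure IsRegularAt (G : V → V →L[ℝ] V →L[ℝ] ℝ) (Γ : V → V →L[ℝ] V →L[ℝ] V) (f : X → V)
    (Γ' : X → X →L[ℝ] X →L[ℝ] X) (e : ι → X → X) (x : X) : Prop where
  diff_f : DifferentiableAt ℝ f x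
  diff_df : DifferentiableAt ℝ (fderiv ℝ f) x
  diff_G : DifferentiableAt ℝ G (f x)
  diff_e : ∀ i, DifferentiableAt ℝ (e i) x
  G_symm : ∀ u v, G (f x) u v = G (f x) v u
  compat : ∀ u v w,
    fderiv ℝ G (f x) u v w = G (f x) (Γ (f x) u v) w + G (f x) v (Γ (f x) u w)
  gauss : ∀ u v w, G (f x) (sff Γ f Γ' x u v) (fderiv ℝ f x w) = 0
  orthonormal : ∀ᶠ x in 𝓝 x, ∀ i j,
    G (f x) (fderiv ℝ f x (e i x)) (fderiv ℝ f x (e j x)) = if i = j then 1 else 0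
  span : ∀ u, u = ∑ j, G (f x) (fderiv ℝ f x u) (fderiv ℝ f x (e j x)) • e j x

/-- The first-order formulas will be differentiated once more, so they are needed on a whole
neighbourhood of the base point. -/
theorem IsIsometricNear.eventually_isRegularAt (h : IsIsometricNear G Γ f Γ' x₀)
    (he : IsFrameNear G f e x₀) : ∀ᶠ x in 𝓝 x₀, IsRegularAt G Γ f Γ' e x := by
  have hc := h.contDiff_f.continuousAt
  filter_upwards [ContDiffAt.eventually_differentiableAt h.contDiff_f,
    ContDiffAt.eventually_differentiableAt (ContDiffAt.fderiv_infty h.contDiff_f),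
    hc.eventually (ContDiffAt.eventually_differentiableAt h.contDiff_G),
    Filter.eventually_all.2 fun i => ContDiffAt.eventually_differentiableAt (he.contDiff i),
    hc.eventually h.G_symm, hc.eventually h.compat, h.gauss, he.orthonormal.eventually_nhds,
    he.span] with x h1 h2 h3 h4 h5 h6 h7 h8 h9
  exact ⟨h1, h2, h3, h4, h5, h6, h7, h8, h9⟩

/-- The connection coefficients `⟨∇_u eᵢ, eⱼ⟩`. -/
def connCoeff (G : V → V →L[ℝ] V →L[ℝ] ℝ) (f : X → V) (Γ' : X → X →L[ℝ] X →L[ℝ] X) (e : ι → X → X)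
    (x u : X) (i j : ι) : ℝ :=
  G (f x) (fderiv ℝ f x (covField Γ' (e i) x u)) (fderiv ℝ f x (e j x))

namespace IsRegularAt

theorem covField_eq (h : IsRegularAt G Γ f Γ' e x) (u : X) (i : ι) :
    covField Γ' (e i) x u = ∑ j, connCoeff G f Γ' e x u i j • e j x :=
  h.span _

/-- The products ⟨Eᵢ, Eⱼ⟩ are locally constant. In their derivative the normal part of each ∇_u Eᵢ
pairs to zero with the frame. -/
theorem connCoeff_antisymm (h : IsRegularAt G Γ f Γ' e x) (u : X) (i j : ι) :
    connCoeff G f Γ' e x u i j = -connCoeff G f Γ' e x u j i := by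
  have hz : fderiv ℝ (fun x => G (f x) (fderiv ℝ f x (e i x)) (fderiv ℝ f x (e j x))) x u = 0 := by
    have : (fun x => G (f x) (fderiv ℝ f x (e i x)) (fderiv ℝ f x (e j x)))
        =ᶠ[𝓝 x] fun _ => if i = j then 1 else 0 := by
      filter_upwards [h.orthonormal] with y hy using hy i j
    rw [this.fderiv_eq]
    simp
  rw [fderiv_metric_apply h.diff_f h.diff_G h.compat (h.diff_df.clm_apply (h.diff_e i))
    (h.diff_df.clm_apply (h.diff_e j)), cov_tangent (Γ' := Γ') h.diff_df (h.diff_e i),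
    cov_tangent (Γ' := Γ') h.diff_df (h.diff_e j)] at hz
  simp only [map_add, add_apply, h.gauss] at hz
  rw [h.G_symm _ (sff Γ f Γ' x u (e j x)), h.gauss, h.G_symm (fderiv ℝ f x (e i x)),
    h.G_symm (fderiv ℝ f x (e i x))] at hz
  simp only [connCoeff, covField, map_add, add_apply]
  linarith

theorem connCoeff_self (h : IsRegularAt G Γ f Γ' e x) (u : X) (i : ι) :
    connCoeff G f Γ' e x u i i = 0 := by
  have := h.connCoeff_antisymm u i i
  linarith

/-- `∇_u Eᵢ = II(u, eᵢ) + ∑ⱼ cᵢⱼ(u) Eⱼ`. -/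
theorem cov_frame (h : IsRegularAt G Γ f Γ' e x) (u : X) (i : ι) :
    fderiv ℝ (fun x => fderiv ℝ f x (e i x)) x u + Γ (f x) (fderiv ℝ f x u) (fderiv ℝ f x (e i x))
      = sff Γ f Γ' x u (e i x) + ∑ j, connCoeff G f Γ' e x u i j • fderiv ℝ f x (e j x) := by
  rw [cov_tangent (Γ' := Γ') h.diff_df (h.diff_e i)]
  congr 1
  have := congrArg (fderiv ℝ f x) (h.covField_eq u i)
  rw [map_sum] at this
  simpa [covField] using this

/-- A bilinear map traced against the covariant derivative of an orthonormal frame vanishes. -/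
theorem sum_sff_covField (h : IsRegularAt G Γ f Γ' e x) (hs : ∀ u v, sff Γ f Γ' x u v
    = sff Γ f Γ' x v u) (u : X) : ∑ k, sff Γ f Γ' x (covField Γ' (e k) x u) (e k x) = 0 := by
  have h1 : ∑ k, sff Γ f Γ' x (covField Γ' (e k) x u) (e k x)
      = ∑ k, ∑ j, connCoeff G f Γ' e x u k j • sff Γ f Γ' x (e j x) (e k x) := by
    refine Finset.sum_congr rfl fun k _ => ?_
    conv_lhs => rw [h.covField_eq u k]
    simp [map_sum]
  -- Interchanging `k` and `j` pairs antisymmetric coefficients with a symmetric form, so the double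
  -- sum equals its own negative.
  have h2 : ∑ k, ∑ j, connCoeff G f Γ' e x u k j • sff Γ f Γ' x (e j x) (e k x)
      = -∑ k, ∑ j, connCoeff G f Γ' e x u k j • sff Γ f Γ' x (e j x) (e k x) := by
    conv_lhs => rw [Finset.sum_comm]
    rw [← Finset.sum_neg_distrib]
    refine Finset.sum_congr rfl fun k _ => ?_
    rw [← Finset.sum_neg_distrib]
    refine Finset.sum_congr rfl fun j _ => ?_
    rw [h.connCoeff_antisymm u j k, hs (e k x), neg_smul]
  rw [h1]
  have h3 := eq_neg_iff_add_eq_zero.1 h2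
  rw [← two_smul ℝ] at h3
  exact (smul_eq_zero.1 h3).resolve_left two_ne_zero

/-- The derivative of `σ(E₁, …, Eₙ)`: only the normal parts of the `∇_u Eᵢ` contribute. -/
theorem fderiv_form_frame (h : IsRegularAt G Γ f Γ' e x) {σ : V → V [⋀^ι]→L[ℝ] ℝ}
    (hσ : DifferentiableAt ℝ σ (f x)) (u : X) :
    fderiv ℝ (fun x => σ (f x) fun i => fderiv ℝ f x (e i x)) x u
      = covForm Γ σ (f x) (fderiv ℝ f x u) (fun i => fderiv ℝ f x (e i x))
        + ∑ i, σ (f x) (Function.update (fun i => fderiv ℝ f x (e i x)) i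
            (sff Γ f Γ' x u (e i x))) := by
  have h1 : DifferentiableAt ℝ (fun x => σ (f x)) x := hσ.comp x h.diff_f
  have h2 : fderiv ℝ (fun x => σ (f x)) x u = fderiv ℝ σ (f x) (fderiv ℝ f x u) := by
    rw [show (fun x => σ (f x)) = σ ∘ f from rfl, fderiv_comp (g := σ) x hσ h.diff_f]; rfl
  rw [fderiv_form_apply (Y := fun i x => fderiv ℝ f x (e i x)) h1
    (fun i => h.diff_df.clm_apply (h.diff_e i)) u (Γ (f x) (fderiv ℝ f x u)), h2]
  simp only [h.cov_frame]
  rw [sum_map_update_add_frame (σ (f x)) (fun i => fderiv ℝ f x (e i x)) _ _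
    (fun i => h.connCoeff_self u i)]
  rfl

end IsRegularAt

/-- A frame vector placed in slot `j` while slot `i` holds `a i` contributes only through its
components along `v j` and `v i`. The first has coefficient `c j j = 0`, and the second moves `a i`
to slot `j` with a minus sign. In the second derivative this correction cancels the terms II(eₖ,
∇eⱼ). -/
theorem sum_sum_update_frame (τ : V [⋀^ι]→L[ℝ] ℝ) (v a : ι → V) (c : ι → ι → ℝ)
    (hc : ∀ i j, c i j = -c j i) :
    ∑ i, ∑ j, (if i = j then 0 else
        τ (Function.update (Function.update v i (a i)) j (a j + ∑ l, c j l • v l)))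
      = ∑ i, ∑ j, (if i = j then 0 else τ (Function.update (Function.update v i (a i)) j (a j)))
        - ∑ j, τ (Function.update v j (∑ i, c j i • a i)) := by
  have h0 : ∀ i, c i i = 0 := fun i => by have := hc i i; linarith
  have h1 : ∑ j, τ (Function.update v j (∑ i, c j i • a i))
      = ∑ i, ∑ j, c j i * τ (Function.update v j (a i)) := by
    rw [Finset.sum_comm]
    refine Finset.sum_congr rfl fun j _ => ?_
    rw [map_update_sum]
    simp
  rw [h1, ← Finset.sum_sub_distrib]
  refine Finset.sum_congr rfl fun i _ => ?_
  rw [← Finset.sum_sub_distrib]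
  refine Finset.sum_congr rfl fun j _ => ?_
  by_cases hij : i = j
  · subst hij; simp [h0]
  · simp only [hij, if_false]
    rw [ContinuousAlternatingMap.map_update_add, map_update_update_frame_sum τ v hij, h0]
    ring

/-- The second derivative of `σ(E₁, …, Eₙ)` along the frame. -/
theorem IsIsometricNear.second_derivative [FiniteDimensional ℝ V]
    (h : IsIsometricNear G Γ f Γ' x₀) (he : IsFrameNear G f e x₀)
    {σ : V → V [⋀^ι]→L[ℝ] ℝ} (hσ : ContDiffAt ℝ ∞ σ (f x₀)) (k : ι) (E : ι → V)
    (hE : E = fun i => fderiv ℝ f x₀ (e i x₀)) :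
    fderiv ℝ (fun x => fderiv ℝ (fun x => σ (f x) fun i => fderiv ℝ f x (e i x)) x (e k x)) x₀
        (e k x₀)
      = (fderiv ℝ (fun x => covForm Γ σ (f x) (fderiv ℝ f x (e k x))) x₀ (e k x₀)
          - derivAct (covForm Γ σ (f x₀) (E k)) (Γ (f x₀) (E k))) E
        + 2 * ∑ i, covForm Γ σ (f x₀) (E k)
            (Function.update E i (sff Γ f Γ' x₀ (e k x₀) (e i x₀)))
        + ∑ i, ∑ j, (if i = j then 0 else σ (f x₀) (Function.update (Function.update E i
            (sff Γ f Γ' x₀ (e k x₀) (e i x₀))) j (sff Γ f Γ' x₀ (e k x₀) (e j x₀))))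
        + ∑ i, σ (f x₀) (Function.update E i (covSff Γ f Γ' x₀ (e k x₀) (e k x₀) (e i x₀)
            + sff Γ f Γ' x₀ (covField Γ' (e k) x₀ (e k x₀)) (e i x₀))) := by
  have hreg := h.eventually_isRegularAt he
  have h0 := hreg.self_of_nhds
  have hdσ := ContDiffAt.differentiableAt_infty hσ
  have hσf : DifferentiableAt ℝ (fun x => σ (f x)) x₀ := hdσ.comp x₀ h0.diff_f
  have hd := h.differentiableAt_sff
  have hE' : ∀ i, DifferentiableAt ℝ (fun x => fderiv ℝ f x (e i x)) x₀ :=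
    fun i => h0.diff_df.clm_apply (h0.diff_e i)
  have hΓf : DifferentiableAt ℝ (fun x => Γ (f x)) x₀ :=
    (ContDiffAt.differentiableAt_infty h.contDiff_Γ).comp x₀ h0.diff_f
  have hθ : DifferentiableAt ℝ (fun x => covForm Γ σ (f x) (fderiv ℝ f x (e k x))) x₀ := by
    have a1 : DifferentiableAt ℝ (fun x => fderiv ℝ σ (f x)) x₀ :=
      (ContDiffAt.differentiableAt_infty (ContDiffAt.fderiv_infty hσ)).comp x₀ h0.diff_f
    exact (a1.clm_apply (hE' k)).sub (differentiableAt_derivAct hσf (hΓf.clm_apply (hE' k)))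
  have hA : ∀ i, DifferentiableAt ℝ (fun x => sff Γ f Γ' x (e k x) (e i x)) x₀ :=
    fun i => (hd.clm_apply (h0.diff_e k)).clm_apply (h0.diff_e i)
  have hY : ∀ i j, DifferentiableAt ℝ (fun x => Function.update (fun i => fderiv ℝ f x (e i x)) i
      (sff Γ f Γ' x (e k x) (e i x)) j) x₀ := by
    intro i j
    by_cases hij : j = i
    · subst hij; simpa using hA j
    · simpa [hij] using hE' j
  -- The first derivative is replaced near `x₀` by its covariant form, in which the connection
  -- coefficients are already gone. This is the expression to differentiate again.
  have hψ : (fun x => fderiv ℝ (fun x => σ (f x) fun i => fderiv ℝ f x (e i x)) x (e k x))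
      =ᶠ[𝓝 x₀] fun x => covForm Γ σ (f x) (fderiv ℝ f x (e k x)) (fun i => fderiv ℝ f x (e i x))
        + ∑ i, σ (f x) (Function.update (fun i => fderiv ℝ f x (e i x)) i
            (sff Γ f Γ' x (e k x) (e i x))) := by
    filter_upwards [hreg, h.contDiff_f.continuousAt.eventually
      (ContDiffAt.eventually_differentiableAt hσ)] with x hx hσx
    exact hx.fderiv_form_frame hσx (e k x)
  have d1 := hθ.continuousAlternatingMap_apply (g := fun i x => fderiv ℝ f x (e i x)) hE'
  have d2 : ∀ i, DifferentiableAt ℝ (fun x => σ (f x) (Function.update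
      (fun i => fderiv ℝ f x (e i x)) i (sff Γ f Γ' x (e k x) (e i x)))) x₀ := fun i =>
    hσf.continuousAlternatingMap_apply (hY i)
  have hσu : fderiv ℝ (fun x => σ (f x)) x₀ (e k x₀) - derivAct (σ (f x₀)) (Γ (f x₀) (E k))
      = covForm Γ σ (f x₀) (E k) := by
    rw [show (fun x => σ (f x)) = σ ∘ f from rfl, fderiv_comp (g := σ) x₀ hdσ h0.diff_f, hE]; rfl
  rw [hψ.fderiv_eq, fderiv_fun_add d1 (DifferentiableAt.fun_sum fun i _ => d2 i),
    fderiv_fun_sum fun i _ => d2 i, add_apply, sum_apply,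
    fderiv_form_apply (Y := fun i x => fderiv ℝ f x (e i x)) hθ hE' (e k x₀) (Γ (f x₀) (E k))]
  set c := connCoeff G f Γ' e x₀ (e k x₀) with hc
  set A : ι → V := fun i => sff Γ f Γ' x₀ (e k x₀) (e i x₀) with hAdef
  have hcov : ∀ i, fderiv ℝ (fun x => fderiv ℝ f x (e i x)) x₀ (e k x₀)
      + Γ (f x₀) (E k) (fderiv ℝ f x₀ (e i x₀)) = A i + ∑ j, c i j • E j := by
    intro i
    have := h0.cov_frame (e k x₀) i
    simpa [hE] using this
  -- The ∇Ω terms with one II arise twice: here, by differentiating the arguments of ∇Ω, and in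
  -- `t2`, by differentiating Ω itself. This is the factor 2.
  have t1 : ∑ i, covForm Γ σ (f x₀) (fderiv ℝ f x₀ (e k x₀)) (Function.update
      (fun i => fderiv ℝ f x₀ (e i x₀)) i (fderiv ℝ (fun x => fderiv ℝ f x (e i x)) x₀ (e k x₀)
      + Γ (f x₀) (E k) (fderiv ℝ f x₀ (e i x₀))))
      = ∑ i, covForm Γ σ (f x₀) (E k) (Function.update E i (A i)) := by
    simp only [hcov]
    rw [← sum_map_update_add_frame _ E A c (fun i => h0.connCoeff_self _ i), hE]
  have t2 : ∀ i, fderiv ℝ (fun x => σ (f x) (Function.update (fun i => fderiv ℝ f x (e i x)) i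
      (sff Γ f Γ' x (e k x) (e i x)))) x₀ (e k x₀)
      = covForm Γ σ (f x₀) (E k) (Function.update E i (A i))
        + (σ (f x₀) (Function.update E i (covSff Γ f Γ' x₀ (e k x₀) (e k x₀) (e i x₀)
            + sff Γ f Γ' x₀ (covField Γ' (e k) x₀ (e k x₀)) (e i x₀)))
          + σ (f x₀) (Function.update E i (sff Γ f Γ' x₀ (e k x₀) (covField Γ' (e i) x₀ (e k x₀)))))
        + ∑ j, (if i = j then 0 else
          σ (f x₀) (Function.update (Function.update E i (A i)) j (A j + ∑ l, c j l • E l))) := by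
    intro i
    have := fderiv_form_apply (Y := fun j x => Function.update (fun i => fderiv ℝ f x (e i x)) i
      (sff Γ f Γ' x (e k x) (e i x)) j) hσf (hY i) (e k x₀) (Γ (f x₀) (E k))
    rw [hσu] at this
    rw [this]
    have hEi : (fun j => Function.update (fun i => fderiv ℝ f x₀ (e i x₀)) i
      (sff Γ f Γ' x₀ (e k x₀) (e i x₀)) j) = Function.update E i (A i) := by rw [hE]
    rw [hEi, add_assoc]
    congr 1
    -- Slot `i` already holds II(eₖ, eᵢ), and its derivative gives ∇II and the derivatives of the
    -- frame inside II. The other slots hold frame vectors, and their derivatives give a second II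
    -- together with connection coefficients.
    rw [← Finset.sum_erase_add _ _ (Finset.mem_univ i),
      ← Finset.sum_erase_add _ (fun j => if i = j then _ else _) (Finset.mem_univ i),
      add_comm, if_pos rfl, add_zero]
    congr 1
    · have := cov_sff_apply hd (h0.diff_e k) (h0.diff_e i) (e k x₀)
      rw [← ContinuousAlternatingMap.map_update_add]
      simp only [Function.update_self, Function.update_idem]
      congr 2
      rw [hE]
      exact this
    · refine Finset.sum_congr rfl fun j hj => ?_
      have hji := Finset.ne_of_mem_erase hj
      simp only [Function.update_of_ne hji, if_neg (Ne.symm hji), hcov]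
  rw [t1]
  simp only [t2, Finset.sum_add_distrib]
  have t3 := sum_sum_update_frame (σ (f x₀)) E A c (fun i j => h0.connCoeff_antisymm _ i j)
  rw [t3]
  -- The correction terms of `t3` are thus exactly the terms II(eₖ, ∇_{eₖ}eⱼ) occurring in `t2`, and
  -- the two cancel.
  have t4 : ∀ j, ∑ i, c j i • A i = sff Γ f Γ' x₀ (e k x₀) (covField Γ' (e j) x₀ (e k x₀)) := by
    intro j
    rw [h0.covField_eq (e k x₀) j]
    simp [map_sum, A, hc]
  simp only [t4]
  rw [hE]
  ring

end Frame

/-! ### The evolution equation in coordinates -/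

section Evolution

theorem sum_rotate {A B C : Type*} {s : Finset A} {t : Finset B} {u : Finset C} (f : A → B → C → ℝ) :
    ∑ a ∈ s, ∑ b ∈ t, ∑ c ∈ u, f a b c = ∑ c ∈ u, ∑ a ∈ s, ∑ b ∈ t, f a b c := by
  rw [Finset.sum_comm (s := u)]
  exact Finset.sum_congr rfl fun a _ => Finset.sum_comm

theorem sum_sum_ne_eq_two_mul {n : ℕ} (T : Fin n → Fin n → ℝ) (hT : ∀ i j, T i j = T j i) :
    ∑ i, ∑ j, (if i = j then 0 else T i j) = 2 * ∑ i, ∑ j with i < j, T i j := by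
  have h1 : ∀ i j, (if i = j then 0 else T i j)
      = (if i < j then T i j else 0) + (if j < i then T j i else 0) := by
    intro i j
    rcases lt_trichotomy i j with h | h | h
    · simp [h, h.ne, h.not_gt]
    · simp [h]
    · simp [h, h.ne', h.not_gt, hT i j]
  simp only [h1, Finset.sum_add_distrib, Finset.sum_filter]
  rw [Finset.sum_comm (f := fun i j => if j < i then T j i else 0)]
  ring

theorem contDiffAt_form_apply {ι X V : Type*} [Fintype ι] [NormedAddCommGroup X] [NormedSpace ℝ X]
    [NormedAddCommGroup V] [NormedSpace ℝ V] {τ : X → V [⋀^ι]→L[ℝ] ℝ} {Y : ι → X → V} {x : X}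
    {n : ℕ∞ω} (hτ : ContDiffAt ℝ n τ x) (hY : ∀ i, ContDiffAt ℝ n (Y i) x) :
    ContDiffAt ℝ n (fun x => τ x (Y · x)) x := by
  -- Evaluation of a multilinear map on a vector tuple is itself multilinear, with the extra slot
  -- `none` for the map. Every slot is fed the same pair and uses only its own component.
  let F := ContinuousLinearMap.id ℝ (ContinuousMultilinearMap ℝ (fun _ : ι => V) ℝ)
    |>.continuousMultilinearMapOption
  have h1 : ContDiffAt ℝ n (fun x => (τ x).toContinuousMultilinearMap) x :=
    ((ContinuousAlternatingMap.toContinuousMultilinearMapCLM ℝ :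
      (V [⋀^ι]→L[ℝ] ℝ) →L[ℝ] _).contDiff (n := n)).contDiffAt.comp x hτ
  have h2 : ContDiffAt ℝ n (fun x => (fun _ : Option ι =>
      ((τ x).toContinuousMultilinearMap, fun i => Y i x))) x :=
    contDiffAt_pi.2 fun _ => h1.prodMk (contDiffAt_pi.2 hY)
  exact F.contDiff.contDiffAt.comp x h2

variable {n : ℕ} {κ X V : Type*} [Fintype κ] [NormedAddCommGroup X] [NormedSpace ℝ X]
  [NormedAddCommGroup V] [NormedSpace ℝ V]
  {G : V → V →L[ℝ] V →L[ℝ] ℝ} {Γ : V → V →L[ℝ] V →L[ℝ] V} {f : X → V}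
  {Γ' : X → X →L[ℝ] X →L[ℝ] X} {x₀ x : X} {e : Fin n → X → X}
  {σ : V → V [⋀^Fin n]→L[ℝ] ℝ}

/-- The components of `w` along the other `E j` repeat an argument and drop out. Used for both the
time derivative and the Laplacian. -/
theorem map_update_decomp (τ : V [⋀^Fin n]→L[ℝ] ℝ) (B : V → V → ℝ) (E : Fin n → V) (ν : κ → V)
    (w : V) (hw : w = ∑ j, B w (E j) • E j + ∑ α, B w (ν α) • ν α) (i : Fin n) :
    τ (Function.update E i w) = B w (E i) * τ E
      + ∑ α, τ (Function.update E i (ν α)) * B w (ν α) := by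
  conv_lhs => rw [hw]
  rw [ContinuousAlternatingMap.map_update_add, map_update_frame_sum τ E i (fun j => B w (E j)),
    map_update_sum]
  simp [mul_comm]

/-- The Hessian on (eₖ, eₖ) is the iterated derivative along eₖ minus the derivative along ∇_{eₖ}eₖ.
By the first-order formula, that subtraction turns the iterated derivative of Ω into ∇²Ω and removes
the terms II(∇_{eₖ}eₖ, eᵢ). -/
theorem fderiv_fderiv_form_frame (h : IsIsometricNear G Γ f Γ' x₀) (he : IsFrameNear G f e x₀)
    [FiniteDimensional ℝ V] (hσ : ContDiffAt ℝ ∞ σ (f x₀)) (k : Fin n) (E : Fin n → V)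
    (hE : E = fun i => fderiv ℝ f x₀ (e i x₀)) (φ : X → ℝ)
    (hφ : φ = fun x => σ (f x) fun i => fderiv ℝ f x (e i x)) :
    fderiv ℝ (fderiv ℝ φ) x₀ (e k x₀) (e k x₀) - fderiv ℝ φ x₀ (Γ' x₀ (e k x₀) (e k x₀))
      = ((fderiv ℝ (fun x => covForm Γ σ (f x) (fderiv ℝ f x (e k x))) x₀ (e k x₀)
          - derivAct (covForm Γ σ (f x₀) (E k)) (Γ (f x₀) (E k))) E
          - covForm Γ σ (f x₀) (fderiv ℝ f x₀ (covField Γ' (e k) x₀ (e k x₀))) E)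
        + 2 * ∑ i, covForm Γ σ (f x₀) (E k)
            (Function.update E i (sff Γ f Γ' x₀ (e k x₀) (e i x₀)))
        + ∑ i, ∑ j, (if i = j then 0 else σ (f x₀) (Function.update (Function.update E i
            (sff Γ f Γ' x₀ (e k x₀) (e i x₀))) j (sff Γ f Γ' x₀ (e k x₀) (e j x₀))))
        + ∑ i, σ (f x₀) (Function.update E i (covSff Γ f Γ' x₀ (e k x₀) (e k x₀) (e i x₀))) := by
  have h0 := (h.eventually_isRegularAt he).self_of_nhds
  have hφd : ContDiffAt ℝ ∞ φ x₀ := by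
    rw [hφ]
    exact contDiffAt_form_apply (hσ.comp x₀ h.contDiff_f)
      (fun i => (ContDiffAt.fderiv_infty h.contDiff_f).clm_apply (he.contDiff i))
  have h1 := h.second_derivative he hσ k E hE
  rw [← hφ, fderiv_clm_apply (ContDiffAt.differentiableAt_infty (ContDiffAt.fderiv_infty hφd))
    (h0.diff_e k)] at h1
  have h2 := h0.fderiv_form_frame (ContDiffAt.differentiableAt_infty hσ)
    (covField Γ' (e k) x₀ (e k x₀))
  rw [← hφ, ← hE] at h2
  simp only [ContinuousAlternatingMap.map_update_add, Finset.sum_add_distrib] at h1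
  simp only [covField, map_add, add_apply, ContinuousLinearMap.comp_apply,
    ContinuousLinearMap.flip_apply, Finset.sum_add_distrib,
    ContinuousAlternatingMap.map_update_add] at h1 h2 ⊢
  linarith

/-- The covariant derivative of the mean curvature vector. -/
theorem cov_meanCurvature (h : IsIsometricNear G Γ f Γ' x₀) (he : IsFrameNear G f e x₀)
    {H : X → V} (hH : ∀ᶠ x in 𝓝 x₀, H x = ∑ k, sff Γ f Γ' x (e k x) (e k x)) (w : X) :
    fderiv ℝ H x₀ w + Γ (f x₀) (fderiv ℝ f x₀ w) (H x₀)
      = ∑ k, covSff Γ f Γ' x₀ w (e k x₀) (e k x₀) := by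
  have h0 := (h.eventually_isRegularAt he).self_of_nhds
  have hd := h.differentiableAt_sff
  have hs := h.eventually_sff_symm.self_of_nhds
  have hH' : H =ᶠ[𝓝 x₀] fun x => ∑ k, sff Γ f Γ' x (e k x) (e k x) := hH
  rw [hH'.fderiv_eq, hH.self_of_nhds, fderiv_fun_sum fun k _ =>
    (hd.clm_apply (h0.diff_e k)).clm_apply (h0.diff_e k), sum_apply, map_sum,
    ← Finset.sum_add_distrib]
  simp only [cov_sff_apply hd (h0.diff_e _) (h0.diff_e _) w, Finset.sum_add_distrib]
  -- Rotating the orthonormal frame does not change the trace to first order.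
  have := h0.sum_sff_covField hs w
  simp only [covField] at this
  simp only [hs (e _ x₀) (fderiv ℝ (e _) x₀ w + Γ' x₀ w (e _ x₀)), this, add_zero]

/-- Time enters only through the curve `c` of base points and the vectors `Y i` along it, with `w i`
playing the role of ∂ₜeᵢ. Of orthonormality at other times only the unit length of the `Y i` is
needed; alternation handles the mixed components. -/
theorem evolution_form (h : IsIsometricNear G Γ f Γ' x₀) (he : IsFrameNear G f e x₀)
    [FiniteDimensional ℝ V] (hσ : ContDiffAt ℝ ∞ σ (f x₀)) (E : Fin n → V)
    (hE : E = fun i => fderiv ℝ f x₀ (e i x₀)) (φ : X → ℝ)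
    (hφ : φ = fun x => σ (f x) fun i => fderiv ℝ f x (e i x))
    (ν : κ → V) (hν : ∀ α y, G (f x₀) (fderiv ℝ f x₀ y) (ν α) = 0)
    (hspan : ∀ w, w = ∑ j, G (f x₀) w (E j) • E j + ∑ α, G (f x₀) w (ν α) • ν α)
    (H : X → V) (hH : ∀ᶠ x in 𝓝 x₀, H x = ∑ k, sff Γ f Γ' x (e k x) (e k x))
    (hh : κ → Fin n → Fin n → ℝ)
    (hhdef : ∀ α i k, hh α i k = G (f x₀) (sff Γ f Γ' x₀ (e i x₀) (e k x₀)) (ν α))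
    {c : ℝ → V} {Y : Fin n → ℝ → V} {J : Set ℝ} {t : ℝ} (hJ : UniqueDiffWithinAt ℝ J t)
    (hct : c t = f x₀) (hc : HasDerivWithinAt c (H x₀) J t) (hYt : ∀ i, Y i t = E i)
    (w : Fin n → X) (hY : ∀ i, HasDerivWithinAt (Y i)
      (fderiv ℝ H x₀ (e i x₀) + fderiv ℝ f x₀ (w i)) J t)
    (hunit : ∀ᶠ s in 𝓝[J] t, ∀ i, G (c s) (Y i s) (Y i s) = 1) :
    HasDerivWithinAt (fun s => σ (c s) fun i => Y i s)
      (∑ k, (fderiv ℝ (fderiv ℝ φ) x₀ (e k x₀) (e k x₀) - fderiv ℝ φ x₀ (Γ' x₀ (e k x₀) (e k x₀)))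
        + φ x₀ * (∑ α, ∑ i, ∑ k, hh α i k ^ 2)
        - 2 * ∑ α, ∑ β, ∑ k, ∑ i, ∑ j with i < j,
            σ (f x₀) (Function.update (Function.update E i (ν α)) j (ν β)) * hh α i k * hh β j k
        - ∑ α, ∑ k, ∑ i, σ (f x₀) (Function.update E i (ν α))
            * G (f x₀) (curv Γ (f x₀) (E k) (E i) (E k)) (ν α)
        + covForm Γ σ (f x₀) (H x₀) E
        - ∑ k, ((fderiv ℝ (fun x => covForm Γ σ (f x) (fderiv ℝ f x (e k x))) x₀ (e k x₀)
          - derivAct (covForm Γ σ (f x₀) (E k)) (Γ (f x₀) (E k))) E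
          - covForm Γ σ (f x₀) (fderiv ℝ f x₀ (covField Γ' (e k) x₀ (e k x₀))) E)
        - 2 * ∑ α, ∑ k, ∑ i, covForm Γ σ (f x₀) (E k) (Function.update E i (ν α)) * hh α i k)
      J t := by
  have h0 := (h.eventually_isRegularAt he).self_of_nhds
  have hs := h.eventually_sff_symm.self_of_nhds
  have hΓs := h.Γ_symm.self_of_nhds
  have hg := h.gauss.self_of_nhds
  have hEi : ∀ i, E i = fderiv ℝ f x₀ (e i x₀) := fun i => by rw [hE]
  -- normal components of the second fundamental form
  have hsff : ∀ i k, sff Γ f Γ' x₀ (e k x₀) (e i x₀) = ∑ α, hh α i k • ν α := by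
    intro i k
    rw [hs, hspan (sff Γ f Γ' x₀ (e i x₀) (e k x₀))]
    simp [hEi, hg, hhdef]
  -- the time derivative
  have hW : ∀ i, fderiv ℝ H x₀ (e i x₀) + fderiv ℝ f x₀ (w i) + Γ (f x₀) (H x₀) (E i)
      = ∑ k, covSff Γ f Γ' x₀ (e i x₀) (e k x₀) (e k x₀) + fderiv ℝ f x₀ (w i) := by
    intro i
    rw [← cov_meanCurvature h he hH, hΓs (H x₀), hEi]
    abel
  have hσc : HasDerivWithinAt (fun s => σ (c s)) (fderiv ℝ σ (f x₀) (H x₀)) J t := by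
    have := (ContDiffAt.differentiableAt_infty hσ).hasFDerivAt
    rw [← hct] at this ⊢
    exact this.comp_hasDerivWithinAt t hc
  have hGc : HasDerivWithinAt (fun s => G (c s)) (fderiv ℝ G (f x₀) (H x₀)) J t := by
    have := h0.diff_G.hasFDerivAt
    rw [← hct] at this ⊢
    exact this.comp_hasDerivWithinAt t hc
  -- Differentiating |Yᵢ|² = 1 in time shows that ∇_t Eᵢ has no component along Eᵢ. The tangential
  -- term with `w i` is thereby controlled without computing it.
  have hdiag : ∀ i, G (f x₀) (fderiv ℝ H x₀ (e i x₀) + fderiv ℝ f x₀ (w i)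
      + Γ (f x₀) (H x₀) (E i)) (E i) = 0 := by
    intro i
    have h1 := (hGc.clm_apply (hY i)).clm_apply (hY i)
    have h2 : HasDerivWithinAt (fun s => G (c s) (Y i s) (Y i s)) 0 J t := by
      refine (hasDerivWithinAt_const t J (1 : ℝ)).congr_of_eventuallyEq
        (hunit.mono fun s hs => hs i) ?_
      rw [hct, hYt, hEi]
      simpa using h0.orthonormal.self_of_nhds i i
    have h3 := hJ.eq_deriv _ h1 h2
    simp only [add_apply, hct, hYt, h0.compat] at h3
    rw [h0.G_symm (E i), h0.G_symm (E i)] at h3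
    simp only [map_add, add_apply] at h3 ⊢
    linarith
  have htime := hasDerivWithinAt_form_apply hσc hY (Γ (f x₀) (H x₀))
  simp only [hct, hYt] at htime
  convert htime using 1
  have hT : ∑ i, σ (f x₀) (Function.update E i (fderiv ℝ H x₀ (e i x₀) + fderiv ℝ f x₀ (w i)
      + Γ (f x₀) (H x₀) (E i))) = ∑ i, ∑ α, σ (f x₀) (Function.update E i (ν α))
        * ∑ k, G (f x₀) (covSff Γ f Γ' x₀ (e i x₀) (e k x₀) (e k x₀)) (ν α) := by
    refine Finset.sum_congr rfl fun i _ => ?_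
    rw [map_update_decomp (σ (f x₀)) (fun a b => G (f x₀) a b) E ν _ (hspan _) i, hdiag, zero_mul,
      zero_add]
    refine Finset.sum_congr rfl fun α _ => ?_
    rw [hW]
    simp [hν, map_sum]
  -- the Laplacian
  have hL : ∀ k, _ := fun k => fderiv_fderiv_form_frame h he hσ k E hE φ hφ
  simp only [hL, Finset.sum_add_distrib]
  -- The terms with ∇II in one slot split into a component along Eᵢ, giving -*Ω|h|², and normal
  -- components, which Codazzi matches with those of the time derivative up to curvature.
  have hQ : ∑ k, ∑ i, σ (f x₀) (Function.update E i (covSff Γ f Γ' x₀ (e k x₀) (e k x₀) (e i x₀)))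
      = -(φ x₀ * ∑ α, ∑ i, ∑ k, hh α i k ^ 2)
        + ∑ i, ∑ α, σ (f x₀) (Function.update E i (ν α))
          * ∑ k, G (f x₀) (covSff Γ f Γ' x₀ (e i x₀) (e k x₀) (e k x₀)) (ν α)
        + ∑ α, ∑ k, ∑ i, σ (f x₀) (Function.update E i (ν α))
            * G (f x₀) (curv Γ (f x₀) (E k) (E i) (E k)) (ν α) := by
    have hnorm : ∀ k i, G (f x₀) (covSff Γ f Γ' x₀ (e k x₀) (e k x₀) (e i x₀)) (E i)
        = -∑ α, hh α i k ^ 2 := by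
      intro k i
      rw [hEi, h.metric_covSff_tangent, neg_inj]
      conv_lhs => enter [2]; rw [hsff]
      simp only [map_sum, map_smul, smul_eq_mul]
      refine Finset.sum_congr rfl fun α _ => ?_
      rw [hs, ← hhdef]
      ring
    have hcod : ∀ k i α, G (f x₀) (covSff Γ f Γ' x₀ (e k x₀) (e k x₀) (e i x₀)) (ν α)
        = G (f x₀) (covSff Γ f Γ' x₀ (e i x₀) (e k x₀) (e k x₀)) (ν α)
          + G (f x₀) (curv Γ (f x₀) (E k) (E i) (E k)) (ν α) := by
      intro k i α
      -- Symmetry first brings eᵢ next to the differentiating eₖ. Codazzi then exchanges these two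
      -- and produces R(eₖ, eᵢ)eₖ.
      rw [h.covSff_symm, h.codazzi _ _ _ (hν α), hEi, hEi]
    have hφ0 : φ x₀ = σ (f x₀) E := by rw [hφ, hE]
    have hk : ∀ k i, σ (f x₀) (Function.update E i
        (covSff Γ f Γ' x₀ (e k x₀) (e k x₀) (e i x₀)))
        = -(φ x₀ * ∑ α, hh α i k ^ 2)
        + ∑ α, σ (f x₀) (Function.update E i (ν α))
          * G (f x₀) (covSff Γ f Γ' x₀ (e i x₀) (e k x₀) (e k x₀)) (ν α)
        + ∑ α, σ (f x₀) (Function.update E i (ν α))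
            * G (f x₀) (curv Γ (f x₀) (E k) (E i) (E k)) (ν α) := by
      intro k i
      rw [map_update_decomp (σ (f x₀)) (fun a b => G (f x₀) a b) E ν _ (hspan _) i, hnorm, hφ0]
      simp only [hcod, mul_add, Finset.sum_add_distrib]
      ring
    simp only [hk, Finset.sum_add_distrib, Finset.sum_neg_distrib, ← Finset.mul_sum]
    congr 1
    · congr 1
      · rw [neg_inj, sum_rotate (fun k i α => hh α i k ^ 2)]
        congr 1
        exact Finset.sum_congr rfl fun α _ => Finset.sum_comm
      · rw [Finset.sum_comm]
        refine Finset.sum_congr rfl fun i _ => ?_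
        rw [Finset.sum_comm]
        exact Finset.sum_congr rfl fun α _ => (Finset.mul_sum _ _ _).symm
    · rw [sum_rotate]
  have hP : ∑ k, 2 * ∑ i, covForm Γ σ (f x₀) (E k)
      (Function.update E i (sff Γ f Γ' x₀ (e k x₀) (e i x₀)))
      = 2 * ∑ α, ∑ k, ∑ i, covForm Γ σ (f x₀) (E k) (Function.update E i (ν α)) * hh α i k := by
    rw [← Finset.mul_sum, ← sum_rotate (s := Finset.univ) (t := Finset.univ) (u := Finset.univ)
      (fun k i α => covForm Γ σ (f x₀) (E k) (Function.update E i (ν α)) * hh α i k)]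
    simp only [hsff, map_update_sum, ContinuousAlternatingMap.map_update_smul, smul_eq_mul,
      mul_comm]
  -- The summand is symmetric in the two slots, so the ordered pairs i ≠ j give twice the sum over i
  -- < j.
  have hD : ∑ k, ∑ i, ∑ j, (if i = j then 0 else σ (f x₀) (Function.update (Function.update E i
      (sff Γ f Γ' x₀ (e k x₀) (e i x₀))) j (sff Γ f Γ' x₀ (e k x₀) (e j x₀))))
      = 2 * ∑ α, ∑ β, ∑ k, ∑ i, ∑ j with i < j,
          σ (f x₀) (Function.update (Function.update E i (ν α)) j (ν β)) * hh α i k * hh β j k := by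
    rw [sum_rotate (A := κ) (B := κ), Finset.mul_sum]
    refine Finset.sum_congr rfl fun k _ => ?_
    have hT : ∀ i j, i ≠ j → σ (f x₀) (Function.update (Function.update E i
        (sff Γ f Γ' x₀ (e k x₀) (e i x₀))) j (sff Γ f Γ' x₀ (e k x₀) (e j x₀)))
        = ∑ α, ∑ β, σ (f x₀) (Function.update (Function.update E i (ν α)) j (ν β))
          * hh α i k * hh β j k := by
      intro i j hij
      rw [hsff j, map_update_sum, Finset.sum_comm]
      refine Finset.sum_congr rfl fun β _ => ?_
      rw [Function.update_comm hij, hsff i, map_update_sum]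
      refine Finset.sum_congr rfl fun α _ => ?_
      rw [ContinuousAlternatingMap.map_update_smul, Function.update_comm hij.symm,
        ContinuousAlternatingMap.map_update_smul, smul_eq_mul, smul_eq_mul]
      ring
    have h1 := sum_sum_ne_eq_two_mul (fun i j => if i = j then 0 else
      σ (f x₀) (Function.update (Function.update E i
        (sff Γ f Γ' x₀ (e k x₀) (e i x₀))) j (sff Γ f Γ' x₀ (e k x₀) (e j x₀)))) (by
        intro i j
        by_cases hij : i = j
        · subst hij; rfl
        · simp only [hij, Ne.symm hij, if_false]
          rw [Function.update_comm hij])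
    have h2 : ∀ i j : Fin n, ∀ r : ℝ, (if i = j then 0 else if i = j then 0 else r)
        = if i = j then 0 else r := by
      intro i j r
      split_ifs <;> rfl
    simp only [h2] at h1
    rw [h1, sum_rotate (A := κ) (B := κ)]
    congr 1
    refine Finset.sum_congr rfl fun i _ => ?_
    rw [sum_rotate (A := κ) (B := κ)]
    refine Finset.sum_congr rfl fun j hj => ?_
    have hij := (Finset.mem_filter.1 hj).2.ne
    rw [if_neg hij, hT i j hij]
  rw [hT, hQ, hP, hD]
  simp only [covForm]
  ring

end Evolution

/-! ### Orthonormal systems of a bilinear form -/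

section Orthonormal

variable {ι V : Type*} [Fintype ι] [DecidableEq ι] [NormedAddCommGroup V] [NormedSpace ℝ V]

/-- Pairing with the `ε i` reads off coefficients, which gives linear independence; the cardinality
then gives a basis. Neither symmetry nor positivity of `b` enters. -/
theorem eq_sum_of_orthonormal [FiniteDimensional ℝ V] (b : V →L[ℝ] V →L[ℝ] ℝ) (ε : ι → V)
    (hε : ∀ i j, b (ε i) (ε j) = if i = j then 1 else 0)
    (hcard : Fintype.card ι = Module.finrank ℝ V) (w : V) : w = ∑ j, b w (ε j) • ε j := by
  have hcoef : ∀ (c : ι → ℝ) i, b (∑ j, c j • ε j) (ε i) = c i := by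
    intro c i
    simp [map_sum, sum_apply, hε]
  have hli : LinearIndependent ℝ ε := by
    rw [Fintype.linearIndependent_iff]
    intro c hc i
    rw [← hcoef c i, hc]
    simp
  have hspan := hli.span_eq_top_of_card_eq_finrank' hcard
  have hw : w ∈ Submodule.span ℝ (Set.range ε) := by rw [hspan]; trivial
  obtain ⟨c, rfl⟩ := (Submodule.mem_span_range_iff_exists_fun ℝ).1 hw
  simp only [hcoef]

variable {k : ℕ}

theorem eq_sum_basisVec (u : EuclideanSpace ℝ (Fin k)) : u = ∑ i, u i • basisVec i := by
  ext j
  simp [basisVec, Pi.single_apply]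

/-- With `P` the matrix whose columns are the `e j`, orthonormality reads Pᵀ B P = 1 for the Gram
matrix B, hence B⁻¹ = P Pᵀ. -/
theorem gram_inv_of_orthonormal
    (b : EuclideanSpace ℝ (Fin k) →L[ℝ] EuclideanSpace ℝ (Fin k) →L[ℝ] ℝ)
    (e : Fin k → EuclideanSpace ℝ (Fin k)) (he : ∀ i j, b (e i) (e j) = if i = j then 1 else 0) :
    (gram fun u v => b u v)⁻¹ = Matrix.of fun i j => ∑ l, e l i * e l j := by
  let P : Matrix (Fin k) (Fin k) ℝ := Matrix.of fun i j => e j i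
  have h1 : P.transpose * ((gram fun u v => b u v) * P) = 1 := by
    ext i j
    rw [Matrix.one_apply, ← he i j]
    conv_rhs => rw [eq_sum_basisVec (e i), eq_sum_basisVec (e j)]
    simp only [map_sum, map_smul, sum_apply, smul_apply, smul_eq_mul,
      Matrix.mul_apply, Matrix.transpose_apply, gram, Matrix.of_apply, P, Finset.mul_sum]
    rw [Finset.sum_comm]
    exact Finset.sum_congr rfl fun _ _ => Finset.sum_congr rfl fun _ _ => by ring
  rw [mul_eq_one_comm, Matrix.mul_assoc] at h1
  rw [Matrix.inv_eq_right_inv h1]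
  ext i j
  simp [Matrix.mul_apply, P]

theorem metricTrace_of_orthonormal {W : Type*} [AddCommGroup W] [Module ℝ W]
    (b : EuclideanSpace ℝ (Fin k) →L[ℝ] EuclideanSpace ℝ (Fin k) →L[ℝ] ℝ)
    (e : Fin k → EuclideanSpace ℝ (Fin k)) (he : ∀ i j, b (e i) (e j) = if i = j then 1 else 0)
    (B : EuclideanSpace ℝ (Fin k) →ₗ[ℝ] EuclideanSpace ℝ (Fin k) →ₗ[ℝ] W) :
    metricTrace (fun u v => b u v) (fun u v => B u v) = ∑ l, B (e l) (e l) := by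
  rw [metricTrace, gram_inv_of_orthonormal b e he]
  have : ∀ l, B (e l) (e l) = ∑ i, ∑ j, (e l i * e l j) • B (basisVec i) (basisVec j) := by
    intro l
    conv_lhs => rw [eq_sum_basisVec (e l)]
    simp only [map_sum, map_smul, LinearMap.sum_apply, LinearMap.smul_apply, Finset.smul_sum,
      smul_smul]
    rw [Finset.sum_comm]
    exact Finset.sum_congr rfl fun _ _ => Finset.sum_congr rfl fun _ _ => by rw [mul_comm]
  simp only [this, Matrix.of_apply, Finset.sum_smul]
  conv_rhs => rw [Finset.sum_comm]
  exact Finset.sum_congr rfl fun _ _ => Finset.sum_comm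

theorem metric_sharp (b : EuclideanSpace ℝ (Fin k) →L[ℝ] EuclideanSpace ℝ (Fin k) →L[ℝ] ℝ)
    (hs : ∀ u v, b u v = b v u) (hp : ∀ u, u ≠ 0 → 0 < b u u)
    (l : EuclideanSpace ℝ (Fin k) →L[ℝ] ℝ) (w : EuclideanSpace ℝ (Fin k)) :
    b (sharp (fun u v => b u v) fun u => l u) w = l w := by
  set A := gram fun u v => b u v with hA
  -- A null vector of the Gram matrix would be a nonzero `u` with b(u, u) = 0.
  have hdet : IsUnit A.det := by
    rw [isUnit_iff_ne_zero]
    intro h0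
    obtain ⟨v, hv, hv0⟩ := Matrix.exists_mulVec_eq_zero_iff.2 h0
    set u : EuclideanSpace ℝ (Fin k) := WithLp.toLp 2 v with hu
    have hu0 : u ≠ 0 := by
      intro h
      apply hv
      ext i
      have := congrArg (fun x : EuclideanSpace ℝ (Fin k) => x i) h
      simpa [hu] using this
    have h1 : b u u = 0 := by
      have h2 : ∀ i, b (basisVec i) u = 0 := by
        intro i
        have := congrFun hv0 i
        rw [eq_sum_basisVec u]
        simpa [Matrix.mulVec, dotProduct, hA, gram, mul_comm, hu] using this
      have h3 : b u = ∑ i, u i • b (basisVec i) := by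
        conv_lhs => rw [eq_sum_basisVec u]
        simp
      rw [h3]
      simp [sum_apply, h2]
    exact absurd h1 (hp u hu0).ne'
  have hAt : A.transpose = A := by
    ext i j
    simp [hA, gram, hs]
  have hmul : A⁻¹ * A = 1 := Matrix.nonsing_inv_mul A hdet
  have hinvt : (A⁻¹).transpose = A⁻¹ := by rw [Matrix.transpose_nonsing_inv, hAt]
  have hm : ∀ m, b (sharp (fun u v => b u v) fun u => l u) (basisVec m) = l (basisVec m) := by
    intro m
    rw [sharp, ← hA]
    simp only [map_sum, map_smul, sum_apply, smul_apply, smul_eq_mul]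
    rw [Finset.sum_comm]
    have h2 : ∀ j, ∑ i, A⁻¹ i j * A i m = if j = m then 1 else 0 := by
      intro j
      have := congrFun (congrFun hmul j) m
      rw [Matrix.mul_apply, Matrix.one_apply] at this
      rw [← this]
      refine Finset.sum_congr rfl fun i _ => ?_
      rw [← congrFun (congrFun hinvt i) j, Matrix.transpose_apply]
    have h3 : ∀ j, ∑ i, A⁻¹ i j * l (basisVec j) * b (basisVec i) (basisVec m)
        = l (basisVec j) * if j = m then 1 else 0 := by
      intro j
      rw [← h2 j, Finset.mul_sum]
      refine Finset.sum_congr rfl fun i _ => ?_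
      simp only [hA, gram, Matrix.of_apply]
      ring
    simp [h3]
  rw [eq_sum_basisVec w]
  simp only [map_sum, map_smul, hm]

end Orthonormal

/-! ### The Levi-Civita connection of a metric on a vector space -/

section LeviCivita

variable {V : Type*} [NormedAddCommGroup V] [NormedSpace ℝ V]

/-- The Koszul form `(1/2) (D_u G(v, w) + D_v G(u, w) - D_w G(u, v))`. -/
def koszul (G : V → V →L[ℝ] V →L[ℝ] ℝ) (z : V) : V →L[ℝ] V →L[ℝ] V →L[ℝ] ℝ :=
  (1 / 2 : ℝ) • (fderiv ℝ G z + (fderiv ℝ G z).flip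
    - ((ContinuousLinearMap.flipₗᵢ ℝ V V ℝ : (V →L[ℝ] V →L[ℝ] ℝ) →L[ℝ] V →L[ℝ] V →L[ℝ] ℝ)).comp
      (fderiv ℝ G z).flip)

theorem koszul_apply (G : V → V →L[ℝ] V →L[ℝ] ℝ) (z u v w : V) :
    koszul G z u v w
      = (1 / 2 : ℝ) * (fderiv ℝ G z u v w + fderiv ℝ G z v u w - fderiv ℝ G z w u v) := rfl

/-- The Christoffel symbols of the metric `G`. -/
def chr (G : V → V →L[ℝ] V →L[ℝ] ℝ) (z : V) : V →L[ℝ] V →L[ℝ] V :=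
  (ContinuousLinearMap.compL ℝ V (V →L[ℝ] ℝ) V (G z).inverse).comp (koszul G z)

theorem chr_apply (G : V → V →L[ℝ] V →L[ℝ] ℝ) (z u v : V) :
    chr G z u v = (G z).inverse (koszul G z u v) := rfl

/-- Positivity makes V → V* injective, and the two spaces have the same finite dimension. -/
theorem isInvertible_of_pos [FiniteDimensional ℝ V] (b : V →L[ℝ] V →L[ℝ] ℝ)
    (hp : ∀ u, u ≠ 0 → 0 < b u u) : b.IsInvertible := by
  have hinj : Function.Injective (b : V →ₗ[ℝ] V →L[ℝ] ℝ) := by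
    rw [← LinearMap.ker_eq_bot, LinearMap.ker_eq_bot']
    intro u hu
    by_contra h
    have h1 := hp u h
    have h2 : b u = 0 := hu
    rw [h2] at h1
    simp at h1
  have hdim : Module.finrank ℝ V = Module.finrank ℝ (V →L[ℝ] ℝ) := by
    rw [← LinearEquiv.finrank_eq (LinearMap.toContinuousLinearMap (𝕜 := ℝ) (E := V) (F' := ℝ))]
    exact (Subspace.dual_finrank_eq (K := ℝ) (V := V)).symm
  refine ⟨(LinearEquiv.ofInjectiveOfFinrankEq (b : V →ₗ[ℝ] V →L[ℝ] ℝ) hinj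
    hdim).toContinuousLinearEquiv, ?_⟩
  ext u v
  rfl

variable [FiniteDimensional ℝ V] {G : V → V →L[ℝ] V →L[ℝ] ℝ} {z : V}

theorem metric_chr (hp : ∀ u, u ≠ 0 → 0 < G z u u) (u v w : V) :
    G z (chr G z u v) w = koszul G z u v w := by
  rw [chr_apply]
  exact congrArg (fun l => l w) ((isInvertible_of_pos (G z) hp).self_apply_inverse _)

theorem contDiffAt_koszul (hG : ContDiffAt ℝ ∞ G z) : ContDiffAt ℝ ∞ (koszul G) z := by
  have h1 := ContDiffAt.fderiv_infty hG
  have h2 : ContDiffAt ℝ ∞ (fun z => (fderiv ℝ G z).flip) z :=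
    (ContinuousLinearMap.flipₗᵢ ℝ V V (V →L[ℝ] ℝ)).contDiff.contDiffAt.comp z h1
  exact ((h1.add h2).sub (contDiffAt_const.clm_comp h2)).const_smul (1 / 2 : ℝ)

theorem contDiffAt_chr (hG : ContDiffAt ℝ ∞ G z) (hp : ∀ u, u ≠ 0 → 0 < G z u u) :
    ContDiffAt ℝ ∞ (chr G) z := by
  have h1 : ContDiffAt ℝ ∞ (fun z => (G z).inverse) z :=
    (isInvertible_of_pos (G z) hp).contDiffAt_map_inverse.comp z hG
  exact ((ContinuousLinearMap.compL ℝ V (V →L[ℝ] ℝ) V).contDiff.contDiffAt.comp z h1).clm_comp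
    (contDiffAt_koszul hG)

theorem fderiv_metric_symm (hG : DifferentiableAt ℝ G z)
    (hs : ∀ᶠ y in 𝓝 z, ∀ u v, G y u v = G y v u) (u v w : V) :
    fderiv ℝ G z u v w = fderiv ℝ G z u w v := by
  have h1 : ∀ v w, fderiv ℝ (fun y => G y v w) z u = fderiv ℝ G z u v w := by
    intro v w
    rw [fderiv_clm_apply (hG.clm_apply (differentiableAt_const v)) (differentiableAt_const w),
      fderiv_clm_apply hG (differentiableAt_const v)]
    simp
  rw [← h1, ← h1]
  have : (fun y => G y v w) =ᶠ[𝓝 z] fun y => G y w v := hs.mono fun y hy => hy v w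
  rw [this.fderiv_eq]

theorem chr_symm (hG : DifferentiableAt ℝ G z) (hs : ∀ᶠ y in 𝓝 z, ∀ u v, G y u v = G y v u)
    (u v : V) : chr G z u v = chr G z v u := by
  rw [chr_apply, chr_apply]
  congr 1
  ext w
  rw [koszul_apply, koszul_apply, fderiv_metric_symm hG hs w u v]
  ring

/-- In the sum of the Koszul forms on (u, v, w) and (u, w, v) all terms cancel except the derivative
along `u`. -/
theorem fderiv_metric_eq_chr (hG : DifferentiableAt ℝ G z)
    (hs : ∀ᶠ y in 𝓝 z, ∀ u v, G y u v = G y v u) (hp : ∀ u, u ≠ 0 → 0 < G z u u) (u v w : V) :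
    fderiv ℝ G z u v w = G z (chr G z u v) w + G z v (chr G z u w) := by
  rw [hs.self_of_nhds v, metric_chr hp, metric_chr hp, koszul_apply, koszul_apply,
    fderiv_metric_symm hG hs w u v, fderiv_metric_symm hG hs u v w]
  ring

/-- The Gram-matrix definition and the one by operator inversion represent the same Koszul form, and
the metric is nondegenerate. The operator version is the one whose smoothness in the base point is
immediate. -/
theorem christoffel_eq_chr {k : ℕ} {G : EuclideanSpace ℝ (Fin k) → EuclideanSpace ℝ (Fin k) →L[ℝ]
    EuclideanSpace ℝ (Fin k) →L[ℝ] ℝ} {z : EuclideanSpace ℝ (Fin k)} (hG : DifferentiableAt ℝ G z)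
    (hs : ∀ u v, G z u v = G z v u) (hp : ∀ u, u ≠ 0 → 0 < G z u u)
    (u v : EuclideanSpace ℝ (Fin k)) :
    christoffel (fun z u v => G z u v) z u v = chr G z u v := by
  have h1 : ∀ u v w, fderiv ℝ (fun y => G y v w) z u = fderiv ℝ G z u v w := by
    intro u v w
    rw [fderiv_clm_apply (hG.clm_apply (differentiableAt_const v)) (differentiableAt_const w),
      fderiv_clm_apply hG (differentiableAt_const v)]
    simp
  have h2 : christoffel (fun z u v => G z u v) z u v
      = sharp (fun u v => G z u v) (fun w => koszul G z u v w) := by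
    rw [christoffel]
    simp only [h1, koszul_apply]
  obtain ⟨M, hM⟩ := isInvertible_of_pos (G z) hp
  apply M.injective
  rw [← ContinuousLinearEquiv.coe_coe, hM]
  ext w
  rw [metric_chr hp, h2, metric_sharp (G z) hs hp]

/-- The Gauss formula: for the Levi-Civita connections of a metric and of its pullback by `f`, the
second fundamental form of `f` takes normal values. -/
theorem metric_sff_chr {X : Type*} [NormedAddCommGroup X] [NormedSpace ℝ X] [FiniteDimensional ℝ X]
    {f : X → V} {G' : X → X →L[ℝ] X →L[ℝ] ℝ} {x : X} (hf : ContDiffAt ℝ 2 f x)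
    (hG : DifferentiableAt ℝ G (f x)) (hs : ∀ᶠ y in 𝓝 (f x), ∀ u v, G y u v = G y v u)
    (hp : ∀ u, u ≠ 0 → 0 < G (f x) u u)
    (hG' : ∀ᶠ y in 𝓝 x, G' y = pull (G (f y)) (fderiv ℝ f y))
    (hi : Function.Injective (fderiv ℝ f x)) (u v w : X) :
    G (f x) (sff (chr G) f (chr G') x u v) (fderiv ℝ f x w) = 0 := by
  have hfd : DifferentiableAt ℝ f x := hf.differentiableAt (by simp)
  have hfd1 : DifferentiableAt ℝ (fderiv ℝ f) x :=
    (hf.fderiv_right (m := 1) (by norm_num)).differentiableAt (by simp)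
  have hp' : ∀ u, u ≠ 0 → 0 < G' x u u := by
    intro u hu
    rw [hG'.self_of_nhds, pull_apply]
    exact hp _ fun h => hu (hi (by rw [h, map_zero]))
  have hd : DifferentiableAt ℝ (fun y => pull (G (f y)) (fderiv ℝ f y)) x := by
    have h1 := ContinuousLinearMap.differentiableAt (x := (G (f x)).comp (fderiv ℝ f x))
      ((ContinuousLinearMap.flipₗᵢ ℝ X V ℝ : (X →L[ℝ] V →L[ℝ] ℝ) →L[ℝ] V →L[ℝ] X →L[ℝ] ℝ))
    have hGf : DifferentiableAt ℝ (fun y => G (f y)) x := hG.comp x hfd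
    have a := h1.comp x (hGf.clm_comp hfd1)
    have h2 := ContinuousLinearMap.differentiableAt
      (x := ((G (f x)).comp (fderiv ℝ f x)).flip.comp (fderiv ℝ f x))
      ((ContinuousLinearMap.flipₗᵢ ℝ X X ℝ : (X →L[ℝ] X →L[ℝ] ℝ) →L[ℝ] X →L[ℝ] X →L[ℝ] ℝ))
    exact h2.comp x (a.clm_comp hfd1)
  have hG'd : ∀ u v w, fderiv ℝ G' x u v w
      = G (f x) (fderiv ℝ (fderiv ℝ f) x u v + chr G (f x) (fderiv ℝ f x u) (fderiv ℝ f x v))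
          (fderiv ℝ f x w)
        + G (f x) (fderiv ℝ f x v)
          (fderiv ℝ (fderiv ℝ f) x u w + chr G (f x) (fderiv ℝ f x u) (fderiv ℝ f x w)) := by
    intro u v w
    have hG'' : G' =ᶠ[𝓝 x] fun y => pull (G (f y)) (fderiv ℝ f y) := hG'
    have h1 := fderiv_metric_apply hfd hG (fderiv_metric_eq_chr hG hs hp)
      (hfd1.clm_apply (differentiableAt_const v)) (hfd1.clm_apply (differentiableAt_const w)) u
    rw [fderiv_clm_apply_const hfd1, fderiv_clm_apply_const hfd1] at h1
    rw [← h1, hG''.fderiv_eq]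
    have h3 := fderiv_clm_apply (hd.clm_apply (differentiableAt_const v)) (differentiableAt_const w)
    rw [fderiv_clm_apply hd (differentiableAt_const v)] at h3
    have h4 := congrArg (fun T => T u) h3
    simp at h4
    exact h4.symm
  have hsym : ∀ u v, fderiv ℝ (fderiv ℝ f) x u v + chr G (f x) (fderiv ℝ f x u) (fderiv ℝ f x v)
      = fderiv ℝ (fderiv ℝ f) x v u + chr G (f x) (fderiv ℝ f x v) (fderiv ℝ f x u) := by
    intro u v
    rw [fderiv_fderiv_symm hf, chr_symm hG hs]
  -- Put K(u, v) = D²f(u, v) + Γ(df u, df v), which is symmetric. In the Koszul form of the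
  -- pulled-back metric the six terms ⟨K, df⟩ reduce to ⟨K(u, v), df w⟩. The Levi-Civita connection
  -- of that metric represents the same form, so K(u, v) - df Γ'(u, v) is normal.
  have hK : koszul G' x u v w = G (f x) (fderiv ℝ (fderiv ℝ f) x u v
      + chr G (f x) (fderiv ℝ f x u) (fderiv ℝ f x v)) (fderiv ℝ f x w) := by
    rw [koszul_apply, hG'd, hG'd, hG'd, hsym v u, hsym w u, hsym w v,
      hs.self_of_nhds (fderiv ℝ f x v) (_ + _)]
    ring
  have h5 := metric_chr hp' u v w
  rw [hK, hG'.self_of_nhds, pull_apply] at h5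
  rw [sff_apply, map_sub, sub_apply, h5, sub_self]

theorem isIsometricNear_of_immersion {X : Type*} [NormedAddCommGroup X] [NormedSpace ℝ X]
    [FiniteDimensional ℝ X] {f : X → V} {G' : X → X →L[ℝ] X →L[ℝ] ℝ} {x : X}
    (hf : ContDiffAt ℝ ∞ f x) (hG : ContDiffAt ℝ ∞ G (f x))
    (hs : ∀ᶠ y in 𝓝 (f x), ∀ u v, G y u v = G y v u)
    (hp : ∀ᶠ y in 𝓝 (f x), ∀ u, u ≠ 0 → 0 < G y u u)
    (hG' : ∀ᶠ y in 𝓝 x, G' y = pull (G (f y)) (fderiv ℝ f y))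
    (hi : ∀ᶠ y in 𝓝 x, Function.Injective (fderiv ℝ f y)) :
    IsIsometricNear G (chr G) f (chr G') x := by
  have hc := hf.continuousAt
  have hG's : ContDiffAt ℝ ∞ G' x := by
    have : ContDiffAt ℝ ∞ (fun y => pull (G (f y)) (fderiv ℝ f y)) x :=
      contDiffAt_pull (hG.comp x hf) (ContDiffAt.fderiv_infty hf)
    exact this.congr_of_eventuallyEq hG'
  have hp' : ∀ᶠ y in 𝓝 x, ∀ u, u ≠ 0 → 0 < G' y u u := by
    filter_upwards [hG', hi, hc.eventually hp] with y h1 h2 h3 u hu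
    rw [h1, pull_apply]
    exact h3 _ fun h => hu (h2 (by rw [h, map_zero]))
  have hs' : ∀ᶠ y in 𝓝 x, ∀ u v, G' y u v = G' y v u := by
    filter_upwards [hG', hc.eventually hs] with y h1 h2 u v
    rw [h1, pull_apply, pull_apply, h2]
  refine ⟨hf, hG, contDiffAt_chr hG hp.self_of_nhds, contDiffAt_chr hG's hp'.self_of_nhds, hs,
    ?_, ?_, ?_, ?_⟩
  · filter_upwards [hs.eventually_nhds, ContDiffAt.eventually_differentiableAt hG] with z h1 h2
    exact chr_symm h2 h1
  · filter_upwards [hs'.eventually_nhds, ContDiffAt.eventually_differentiableAt hG's] with z h1 h2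
    exact chr_symm h2 h1
  · filter_upwards [hs.eventually_nhds, ContDiffAt.eventually_differentiableAt hG, hp]
      with z h1 h2 h3
    exact fderiv_metric_eq_chr h2 h1 h3
  · filter_upwards [hc.eventually hs.eventually_nhds,
      hc.eventually (ContDiffAt.eventually_differentiableAt hG), hc.eventually hp,
      ContDiffAt.eventually_contDiffAt hf 2, hG'.eventually_nhds, hi] with z h1 h2 h3 h4 h5 h6
    exact metric_sff_chr h4 h2 h1 h3 h5 h6

end LeviCivita

/-! ### Changes of charts -/

section Charts

variable {k : ℕ} {M : Type*} [TopologicalSpace M] [ChartedSpace (EuclideanSpace ℝ (Fin k)) M]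
  [IsManifold (𝓡 k) ∞ M]

/-- The change of coordinates from the chart at `q` to the chart at `q'`. -/
def transition (q q' : M) : EuclideanSpace ℝ (Fin k) → EuclideanSpace ℝ (Fin k) :=
  extChartAt (𝓡 k) q' ∘ (extChartAt (𝓡 k) q).symm

variable {q q' q'' x : M}

theorem contDiffAt_transition (hq : x ∈ (extChartAt (𝓡 k) q).source)
    (hq' : x ∈ (extChartAt (𝓡 k) q').source) :
    ContDiffAt ℝ ∞ (transition q q') (extChartAt (𝓡 k) q x) := by
  have h : extChartAt (𝓡 k) q x ∈ ((extChartAt (𝓡 k) q).symm ≫ extChartAt (𝓡 k) q').source := by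
    rw [PartialEquiv.trans_source'', PartialEquiv.symm_symm, PartialEquiv.symm_target]
    exact mem_image_of_mem _ ⟨hq, hq'⟩
  have := contDiffWithinAt_ext_coord_change (I := 𝓡 k) (n := ∞) q' q h
  rw [ModelWithCorners.Boundaryless.range_eq_univ, contDiffWithinAt_univ] at this
  exact this

theorem hasFDerivAt_transition (hq : x ∈ (extChartAt (𝓡 k) q).source)
    (hq' : x ∈ (extChartAt (𝓡 k) q').source) :
    HasFDerivAt (transition q q') (tangentCoordChange (𝓡 k) q q' x) (extChartAt (𝓡 k) q x) := by
  have := hasFDerivWithinAt_tangentCoordChange (I := 𝓡 k) (x := q) (y := q') (z := x) ⟨hq, hq'⟩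
  simpa [transition] using this

theorem fderiv_transition (hq : x ∈ (extChartAt (𝓡 k) q).source)
    (hq' : x ∈ (extChartAt (𝓡 k) q').source) :
    fderiv ℝ (transition q q') (extChartAt (𝓡 k) q x) = tangentCoordChange (𝓡 k) q q' x :=
  (hasFDerivAt_transition hq hq').fderiv

theorem transition_apply (hq : x ∈ (extChartAt (𝓡 k) q).source) :
    transition q q' (extChartAt (𝓡 k) q x) = extChartAt (𝓡 k) q' x := by
  rw [transition, Function.comp_apply, (extChartAt (𝓡 k) q).left_inv hq]

theorem tcc_self (hq : x ∈ (extChartAt (𝓡 k) q).source) (v : EuclideanSpace ℝ (Fin k)) :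
    tangentCoordChange (𝓡 k) q q x v = v :=
  tangentCoordChange_self hq

theorem tcc_comp (h1 : x ∈ (extChartAt (𝓡 k) q).source) (h2 : x ∈ (extChartAt (𝓡 k) q').source)
    (h3 : x ∈ (extChartAt (𝓡 k) q'').source) (v : EuclideanSpace ℝ (Fin k)) :
    tangentCoordChange (𝓡 k) q' q'' x (tangentCoordChange (𝓡 k) q q' x v)
      = tangentCoordChange (𝓡 k) q q'' x v :=
  tangentCoordChange_comp ⟨⟨h1, h2⟩, h3⟩

theorem tcc_cancel (h1 : x ∈ (extChartAt (𝓡 k) q).source) (h2 : x ∈ (extChartAt (𝓡 k) q').source)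
    (v : EuclideanSpace ℝ (Fin k)) :
    tangentCoordChange (𝓡 k) q' q x (tangentCoordChange (𝓡 k) q q' x v) = v := by
  rw [tcc_comp h1 h2 h1, tcc_self h1]

theorem eventually_symm_mem_source (hq : x ∈ (extChartAt (𝓡 k) q).source) {O : Set M}
    (hO : O ∈ 𝓝 x) : ∀ᶠ z in 𝓝 (extChartAt (𝓡 k) q x),
      z ∈ (extChartAt (𝓡 k) q).target ∧ (extChartAt (𝓡 k) q).symm z ∈ O := by
  have h1 : (extChartAt (𝓡 k) q).target ∈ 𝓝 (extChartAt (𝓡 k) q x) :=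
    extChartAt_target_mem_nhds' ((extChartAt (𝓡 k) q).map_source hq)
  have h2 := (continuousAt_extChartAt_symm' (I := 𝓡 k) hq)
  have h3 : (extChartAt (𝓡 k) q).symm ⁻¹' O ∈ 𝓝 (extChartAt (𝓡 k) q x) := by
    apply h2
    rwa [(extChartAt (𝓡 k) q).left_inv hq]
  filter_upwards [h1, h3] with z a b using ⟨a, b⟩

theorem source_mem_nhds (hq : x ∈ (extChartAt (𝓡 k) q).source) :
    (extChartAt (𝓡 k) q).source ∈ 𝓝 x :=
  (isOpen_extChartAt_source q).mem_nhds hq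

/-! ### The metric in a chart -/

variable (g : ContMDiffRiemannianMetric (𝓡 k) ∞ (EuclideanSpace ℝ (Fin k))
      (fun x : M => TangentSpace (𝓡 k) x))

/-- The metric at `x`, as a bilinear form on the model space. -/
def innerModel (x : M) : EuclideanSpace ℝ (Fin k) →L[ℝ] EuclideanSpace ℝ (Fin k) →L[ℝ] ℝ :=
  g.inner x

/-- The metric in the chart at `q`. -/
def chartMetric (q : M) (z : EuclideanSpace ℝ (Fin k)) :
    EuclideanSpace ℝ (Fin k) →L[ℝ] EuclideanSpace ℝ (Fin k) →L[ℝ] ℝ :=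
  pull (innerModel g ((extChartAt (𝓡 k) q).symm z))
    (tangentCoordChange (𝓡 k) q ((extChartAt (𝓡 k) q).symm z) ((extChartAt (𝓡 k) q).symm z))

theorem metricInChart_eq (q : M) :
    metricInChart (metricFun g) q = fun z u v => chartMetric g q z u v := rfl

theorem innerModel_symm (x : M) (u v : EuclideanSpace ℝ (Fin k)) :
    innerModel g x u v = innerModel g x v u :=
  g.symm x u v

theorem innerModel_pos (x : M) (u : EuclideanSpace ℝ (Fin k)) (hu : u ≠ 0) :
    0 < innerModel g x u u :=
  g.pos x u hu

theorem chartMetric_symm (q : M) (z u v : EuclideanSpace ℝ (Fin k)) :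
    chartMetric g q z u v = chartMetric g q z v u :=
  innerModel_symm g _ _ _

theorem chartMetric_apply (hq : x ∈ (extChartAt (𝓡 k) q).source) (u v : EuclideanSpace ℝ (Fin k)) :
    chartMetric g q (extChartAt (𝓡 k) q x) u v
      = innerModel g x (tangentCoordChange (𝓡 k) q x x u) (tangentCoordChange (𝓡 k) q x x v) := by
  simp only [chartMetric, pull_apply, (extChartAt (𝓡 k) q).left_inv hq]

theorem mem_source_self (x : M) : x ∈ (extChartAt (𝓡 k) x).source := mem_extChartAt_source x

theorem innerModel_eq (hq : x ∈ (extChartAt (𝓡 k) q).source) (u v : EuclideanSpace ℝ (Fin k)) :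
    innerModel g x u v = chartMetric g q (extChartAt (𝓡 k) q x) (tangentCoordChange (𝓡 k) x q x u)
      (tangentCoordChange (𝓡 k) x q x v) := by
  rw [chartMetric_apply g hq, tcc_cancel (mem_source_self x) hq, tcc_cancel (mem_source_self x) hq]

theorem chartMetric_pos (hq : x ∈ (extChartAt (𝓡 k) q).source) (u : EuclideanSpace ℝ (Fin k))
    (hu : u ≠ 0) : 0 < chartMetric g q (extChartAt (𝓡 k) q x) u u := by
  rw [chartMetric_apply g hq]
  refine innerModel_pos g x _ fun h => hu ?_
  rw [← tcc_cancel hq (mem_source_self x) u, h, map_zero]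

theorem eventually_chartMetric_pos (hq : x ∈ (extChartAt (𝓡 k) q).source) :
    ∀ᶠ z in 𝓝 (extChartAt (𝓡 k) q x), ∀ u, u ≠ 0 → 0 < chartMetric g q z u u := by
  filter_upwards [eventually_symm_mem_source hq Filter.univ_mem] with z hz u hu
  have := chartMetric_pos g ((extChartAt (𝓡 k) q).map_target hz.1) u hu
  rwa [(extChartAt (𝓡 k) q).right_inv hz.1] at this

/-- In the trivialization at a point `x₀`, a field with constant components in the chart at `q` is
the derivative of the transition map applied to `v`. -/
theorem contMDiffOn_ofCoord (q : M) (v : EuclideanSpace ℝ (Fin k)) :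
    ContMDiffOn (𝓡 k) ((𝓡 k).prod 𝓘(ℝ, EuclideanSpace ℝ (Fin k))) ∞
      (fun x : M => TotalSpace.mk' (EuclideanSpace ℝ (Fin k))
        (E := fun x : M => TangentSpace (𝓡 k) x) x (ofCoord q x v))
      (extChartAt (𝓡 k) q).source := by
  intro x₀ hx₀
  have h0 := mem_source_self (k := k) x₀
  refine ContMDiffAt.contMDiffWithinAt (Bundle.contMDiffAt_totalSpace.2 ⟨contMDiffAt_id, ?_⟩)
  have h1 : ContMDiffAt (𝓡 k) 𝓘(ℝ, EuclideanSpace ℝ (Fin k)) ∞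
      (fun x => fderiv ℝ (transition q x₀) (extChartAt (𝓡 k) q x) v) x₀ := by
    have a := (ContDiffAt.fderiv_infty (contDiffAt_transition hx₀ h0)).clm_apply
      (contDiffAt_const (c := v))
    exact a.contMDiffAt.comp x₀ (contMDiffAt_extChartAt' (by simpa using hx₀))
  refine h1.congr_of_eventuallyEq ?_
  filter_upwards [source_mem_nhds hx₀, source_mem_nhds h0] with x hx hx'
  rw [TangentBundle.trivializationAt_apply, fderiv_transition hx hx']
  exact tcc_comp hx (mem_source_self x) hx' v

theorem contDiffOn_chartMetric (q : M) :
    ContDiffOn ℝ ∞ (chartMetric g q) (extChartAt (𝓡 k) q).target := by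
  refine contDiffOn_clm_apply.2 fun u => contDiffOn_clm_apply.2 fun v => ?_
  have h1 : ContMDiffOn (𝓡 k) 𝓘(ℝ, ℝ) ∞
      (fun x : M => g.inner x (ofCoord q x u) (ofCoord q x v)) (extChartAt (𝓡 k) q).source := by
    intro x hx
    have := ContMDiffWithinAt.clm_bundle_apply₂ (F₁ := EuclideanSpace ℝ (Fin k))
      (F₂ := EuclideanSpace ℝ (Fin k)) (F₃ := ℝ) (E₃ := Bundle.Trivial M ℝ)
      (g.contMDiff.contMDiffAt.contMDiffWithinAt (s := (extChartAt (𝓡 k) q).source))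
      (contMDiffOn_ofCoord q u x hx) (contMDiffOn_ofCoord q v x hx)
    rw [Bundle.contMDiffWithinAt_totalSpace] at this
    exact this.2
  have h2 := h1.comp (contMDiffOn_extChartAt_symm (I := 𝓡 k) (n := ∞) q)
    fun z hz => (extChartAt (𝓡 k) q).map_target hz
  exact h2.contDiffOn

theorem contDiffAt_chartMetric (hq : x ∈ (extChartAt (𝓡 k) q).source) :
    ContDiffAt ℝ ∞ (chartMetric g q) (extChartAt (𝓡 k) q x) :=
  (contDiffOn_chartMetric g q).contDiffAt
    (extChartAt_target_mem_nhds' ((extChartAt (𝓡 k) q).map_source hq))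

/-- The transformation law of the Christoffel symbols under a change of charts. -/
theorem chr_transition (hq : x ∈ (extChartAt (𝓡 k) q).source)
    (hq' : x ∈ (extChartAt (𝓡 k) q').source) (u v : EuclideanSpace ℝ (Fin k)) :
    fderiv ℝ (fderiv ℝ (transition q q')) (extChartAt (𝓡 k) q x) u v
        + chr (chartMetric g q') (extChartAt (𝓡 k) q' x) (tangentCoordChange (𝓡 k) q q' x u)
          (tangentCoordChange (𝓡 k) q q' x v)
      = tangentCoordChange (𝓡 k) q q' x (chr (chartMetric g q) (extChartAt (𝓡 k) q x) u v) := by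
  have hT := transition_apply (q' := q') hq
  -- A transition map is an isometry between the two expressions of the metric, so the Gauss formula
  -- applies to it.
  have h1 := metric_sff_chr (f := transition q q') (G := chartMetric g q')
    (G' := chartMetric g q) (x := extChartAt (𝓡 k) q x)
    (ContDiffAt.two_of_infty (contDiffAt_transition hq hq'))
    (by rw [hT]; exact ContDiffAt.differentiableAt_infty (contDiffAt_chartMetric g hq'))
    (Filter.Eventually.of_forall fun y => chartMetric_symm g q' y)
    (by rw [hT]; exact chartMetric_pos g hq')
    (by
      filter_upwards [eventually_symm_mem_source hq (source_mem_nhds hq')] with z hz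
      set y := (extChartAt (𝓡 k) q).symm z with hy
      have hyq := (extChartAt (𝓡 k) q).map_target hz.1
      have hzy : z = extChartAt (𝓡 k) q y := ((extChartAt (𝓡 k) q).right_inv hz.1).symm
      rw [hzy, fderiv_transition hyq hz.2, transition_apply hyq]
      ext a b
      rw [pull_apply, chartMetric_apply g hyq, chartMetric_apply g hz.2,
        tcc_comp hyq hz.2 (mem_source_self y), tcc_comp hyq hz.2 (mem_source_self y)])
    (by
      rw [fderiv_transition hq hq']
      exact Function.LeftInverse.injective (g := fun v => tangentCoordChange (𝓡 k) q' q x v)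
        (tcc_cancel hq hq')) u v
  rw [fderiv_transition hq hq', hT] at h1
  -- The differential of a transition map is onto. Its second fundamental form, being normal to the
  -- whole space, is orthogonal to itself and vanishes; this is the transformation law.
  have h2 : sff (chr (chartMetric g q')) (transition q q') (chr (chartMetric g q))
      (extChartAt (𝓡 k) q x) u v = 0 := by
    by_contra h
    have h3 := chartMetric_pos g hq' _ h
    have h4 := h1 (tangentCoordChange (𝓡 k) q' q x (sff (chr (chartMetric g q')) (transition q q')
      (chr (chartMetric g q)) (extChartAt (𝓡 k) q x) u v))
    rw [tcc_cancel hq' hq] at h4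
    exact h3.ne' h4
  rw [sff_apply, fderiv_transition hq hq', hT, sub_eq_zero] at h2
  exact h2

theorem christoffel_metricFun (hq : x ∈ (extChartAt (𝓡 k) q).source)
    (u v : EuclideanSpace ℝ (Fin k)) :
    christoffel (metricInChart (metricFun g) q) (extChartAt (𝓡 k) q x) u v
      = chr (chartMetric g q) (extChartAt (𝓡 k) q x) u v := by
  rw [metricInChart_eq]
  exact christoffel_eq_chr (ContDiffAt.differentiableAt_infty (contDiffAt_chartMetric g hq))
    (chartMetric_symm g q _) (chartMetric_pos g hq) u v

/-- The two kinds of Christoffel symbols agree on a neighbourhood of the base point, so their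
derivatives agree as well. -/
theorem curvature_eq_curv (q : M) (u v w : EuclideanSpace ℝ (Fin k)) :
    curvature (metricFun g) q u v w
      = curv (chr (chartMetric g q)) (extChartAt (𝓡 k) q q) u v w := by
  have hq := mem_source_self (k := k) q
  have hΓ := ContDiffAt.differentiableAt_infty
    (contDiffAt_chr (contDiffAt_chartMetric g hq) (chartMetric_pos g hq))
  have h1 : ∀ v w, (fun z => christoffel (metricInChart (metricFun g) q) z v w)
      =ᶠ[𝓝 (extChartAt (𝓡 k) q q)] fun z => chr (chartMetric g q) z v w := by
    intro v w
    filter_upwards [eventually_symm_mem_source hq Filter.univ_mem] with z hz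
    have := christoffel_metricFun g ((extChartAt (𝓡 k) q).map_target hz.1) v w
    rwa [(extChartAt (𝓡 k) q).right_inv hz.1] at this
  have h2 : ∀ u v w, fderiv ℝ (fun z => chr (chartMetric g q) z v w) (extChartAt (𝓡 k) q q) u
      = fderiv ℝ (chr (chartMetric g q)) (extChartAt (𝓡 k) q q) u v w := by
    intro u v w
    rw [fderiv_clm_apply (hΓ.clm_apply (differentiableAt_const v)) (differentiableAt_const w),
      fderiv_clm_apply hΓ (differentiableAt_const v)]
    simp
  rw [curv, ← h2, ← h2, ← (h1 v w).fderiv_eq, ← (h1 u w).fderiv_eq]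
  simp only [← christoffel_metricFun g hq]
  rfl

end Charts

/-! ### Maps between manifolds in charts -/

section Maps

variable {k n : ℕ} {M : Type*} [TopologicalSpace M] [ChartedSpace (EuclideanSpace ℝ (Fin k)) M]
  [IsManifold (𝓡 k) ∞ M]
  {S : Type*} [TopologicalSpace S] [ChartedSpace (EuclideanSpace ℝ (Fin n)) S]
  [IsManifold (𝓡 n) ∞ S]

variable (k n) in
/-- The map `f` in the charts at `p` and `q`. -/
def inCharts (p : S) (q : M) (f : S → M) : EuclideanSpace ℝ (Fin n) → EuclideanSpace ℝ (Fin k) :=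
  extChartAt (𝓡 k) q ∘ f ∘ (extChartAt (𝓡 n) p).symm

variable (k n) in
/-- The derivative of `f`, as a linear map between the model spaces. -/
def mfderivModel (f : S → M) (x : S) : EuclideanSpace ℝ (Fin n) →L[ℝ] EuclideanSpace ℝ (Fin k) :=
  mfderiv (𝓡 n) (𝓡 k) f x

variable {p x : S} {q : M} {f : S → M}

theorem inCharts_apply (f : S → M) (q : M) (hp : x ∈ (extChartAt (𝓡 n) p).source) :
    inCharts k n p q f (extChartAt (𝓡 n) p x) = extChartAt (𝓡 k) q (f x) := by
  simp only [inCharts, Function.comp_apply, (extChartAt (𝓡 n) p).left_inv hp]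

/-- The manifold derivative is by definition the derivative in the preferred charts at `x` and `f
x`. Composition with the two transition maps moves it to the charts at `p` and `q`. -/
theorem hasFDerivAt_inCharts (hf : MDifferentiableAt (𝓡 n) (𝓡 k) f x)
    (hp : x ∈ (extChartAt (𝓡 n) p).source) (hq : f x ∈ (extChartAt (𝓡 k) q).source) :
    HasFDerivAt (inCharts k n p q f) ((tangentCoordChange (𝓡 k) (f x) q (f x)).comp
      ((mfderivModel k n f x).comp (tangentCoordChange (𝓡 n) p x x))) (extChartAt (𝓡 n) p x) := by
  have hx := mem_source_self (k := n) x
  have hy := mem_source_self (k := k) (f x)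
  have h1 : HasFDerivAt (inCharts k n x (f x) f) (mfderivModel k n f x) (extChartAt (𝓡 n) x x) := by
    have : HasFDerivWithinAt (inCharts k n x (f x) f) (mfderivModel k n f x) (range (𝓡 n))
      (extChartAt (𝓡 n) x x) := hf.hasMFDerivAt.2
    rw [ModelWithCorners.Boundaryless.range_eq_univ, hasFDerivWithinAt_univ] at this
    exact this
  have h2 := hasFDerivAt_transition (k := n) hp hx
  have h3 := hasFDerivAt_transition (k := k) hy hq
  rw [← transition_apply hp] at h1
  have h4 := h1.comp _ h2
  have h5 : (inCharts k n x (f x) f ∘ transition p x) (extChartAt (𝓡 n) p x)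
      = extChartAt (𝓡 k) (f x) (f x) := by
    rw [Function.comp_apply, transition_apply hp, inCharts_apply (k := k) f _ hx]
  rw [← h5] at h3
  refine (h3.comp _ h4).congr_of_eventuallyEq ?_
  filter_upwards [eventually_symm_mem_source hp (Filter.inter_mem (source_mem_nhds hx)
    (hf.continuousAt (source_mem_nhds (k := k) hy)))] with z hz
  simp only [inCharts, transition, Function.comp_apply]
  rw [(extChartAt (𝓡 n) x).left_inv hz.2.1, (extChartAt (𝓡 k) (f x)).left_inv hz.2.2]

theorem fderiv_inCharts (hf : MDifferentiableAt (𝓡 n) (𝓡 k) f x)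
    (hp : x ∈ (extChartAt (𝓡 n) p).source) (hq : f x ∈ (extChartAt (𝓡 k) q).source)
    (u : EuclideanSpace ℝ (Fin n)) :
    fderiv ℝ (inCharts k n p q f) (extChartAt (𝓡 n) p x) u
      = tangentCoordChange (𝓡 k) (f x) q (f x)
          (mfderivModel k n f x (tangentCoordChange (𝓡 n) p x x u)) := by
  rw [(hasFDerivAt_inCharts hf hp hq).fderiv]
  rfl

theorem mfderivModel_eq (hf : MDifferentiableAt (𝓡 n) (𝓡 k) f x)
    (hp : x ∈ (extChartAt (𝓡 n) p).source) (hq : f x ∈ (extChartAt (𝓡 k) q).source)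
    (u : EuclideanSpace ℝ (Fin n)) :
    mfderivModel k n f x u = tangentCoordChange (𝓡 k) q (f x) (f x)
      (fderiv ℝ (inCharts k n p q f) (extChartAt (𝓡 n) p x) (tangentCoordChange (𝓡 n) x p x u)) := by
  rw [fderiv_inCharts hf hp hq, tcc_cancel (mem_source_self x) hp,
    tcc_cancel (k := k) (mem_source_self (f x)) hq]

theorem contDiffAt_inCharts (hf : ContMDiffAt (𝓡 n) (𝓡 k) ∞ f x)
    (hp : x ∈ (extChartAt (𝓡 n) p).source) (hq : f x ∈ (extChartAt (𝓡 k) q).source) :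
    ContDiffAt ℝ ∞ (inCharts k n p q f) (extChartAt (𝓡 n) p x) := by
  have := (contMDiffAt_iff_of_mem_source (I := 𝓡 n) (I' := 𝓡 k) (x := p) (y := q) (by simpa using hp)
    (by simpa using hq)).1 hf
  have h2 := this.2
  rw [ModelWithCorners.Boundaryless.range_eq_univ, contDiffWithinAt_univ] at h2
  exact h2

/-- A directional derivative in a chart. -/
theorem dirDeriv_eq {V : Type*} [NormedAddCommGroup V] [NormedSpace ℝ V] {φ : S → V}
    (hp : x ∈ (extChartAt (𝓡 n) p).source)
    (hφ : DifferentiableAt ℝ (φ ∘ (extChartAt (𝓡 n) p).symm) (extChartAt (𝓡 n) p x))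
    (u : EuclideanSpace ℝ (Fin n)) :
    dirDeriv φ x u = fderiv ℝ (φ ∘ (extChartAt (𝓡 n) p).symm) (extChartAt (𝓡 n) p x)
      (tangentCoordChange (𝓡 n) x p x u) := by
  have hx := mem_source_self (k := n) x
  have h2 := hasFDerivAt_transition (k := n) hx hp
  have h1 := hφ.hasFDerivAt
  rw [← transition_apply (q' := p) hx] at h1
  have h3 : HasFDerivAt (φ ∘ (extChartAt (𝓡 n) x).symm)
      ((fderiv ℝ (φ ∘ (extChartAt (𝓡 n) p).symm) (transition x p (extChartAt (𝓡 n) x x))).comp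
        (tangentCoordChange (𝓡 n) x p x)) (extChartAt (𝓡 n) x x) := by
    refine (h1.comp _ h2).congr_of_eventuallyEq ?_
    filter_upwards [eventually_symm_mem_source hx (source_mem_nhds hp)] with z hz
    simp only [transition, Function.comp_apply]
    rw [(extChartAt (𝓡 n) p).left_inv hz.2]
  have hc : ContinuousAt φ x := by
    have a : ContinuousAt ((φ ∘ (extChartAt (𝓡 n) p).symm) ∘ extChartAt (𝓡 n) p) x :=
      ContinuousAt.comp (hφ.continuousAt) (continuousAt_extChartAt' hp)
    refine a.congr ?_
    filter_upwards [source_mem_nhds hp] with y hy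
    simp only [Function.comp_apply]
    rw [(extChartAt (𝓡 n) p).left_inv hy]
  have h4 : HasMFDerivAt (𝓡 n) 𝓘(ℝ, V) φ x
      ((fderiv ℝ (φ ∘ (extChartAt (𝓡 n) p).symm) (transition x p (extChartAt (𝓡 n) x x))).comp
        (tangentCoordChange (𝓡 n) x p x)) := by
    refine ⟨hc, ?_⟩
    exact h3.hasFDerivWithinAt
  change mfderiv (𝓡 n) 𝓘(ℝ, V) φ x u = _
  rw [h4.mfderiv, transition_apply hx]
  rfl

end Maps

/-! ### Covariant derivatives along maps in arbitrary charts -/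

section Along

variable {k n : ℕ} {M : Type*} [TopologicalSpace M] [ChartedSpace (EuclideanSpace ℝ (Fin k)) M]
  [IsManifold (𝓡 k) ∞ M]
  {S : Type*} [TopologicalSpace S] [ChartedSpace (EuclideanSpace ℝ (Fin n)) S]
  [IsManifold (𝓡 n) ∞ S]
  (g : ContMDiffRiemannianMetric (𝓡 k) ∞ (EuclideanSpace ℝ (Fin k))
      (fun x : M => TangentSpace (𝓡 k) x))
  {p x : S} {q : M} {f : S → M}

theorem mdifferentiable_of_contMDiff (hf : ContMDiff (𝓡 n) (𝓡 k) ∞ f) (x : S) :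
    MDifferentiableAt (𝓡 n) (𝓡 k) f x :=
  (hf x).mdifferentiableAt (by simp)

/-- The covariant derivative of `df(v)` in arbitrary charts. -/
theorem covAlong_mfderiv (hf : ContMDiff (𝓡 n) (𝓡 k) ∞ f) (hp : x ∈ (extChartAt (𝓡 n) p).source)
    (hq : f x ∈ (extChartAt (𝓡 k) q).source)
    (Γ' : EuclideanSpace ℝ (Fin n) → EuclideanSpace ℝ (Fin n) →L[ℝ] EuclideanSpace ℝ (Fin n) →L[ℝ]
      EuclideanSpace ℝ (Fin n)) (u v : EuclideanSpace ℝ (Fin n)) :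
    ∃ a : EuclideanSpace ℝ (Fin n),
      covAlong (n := n) (metricFun g) f (fun x' => mfderiv (𝓡 n) (𝓡 k) f x' (ofCoord x x' v)) x u
        = tangentCoordChange (𝓡 k) q (f x) (f x) (sff (chr (chartMetric g q)) (inCharts k n p q f) Γ'
            (extChartAt (𝓡 n) p x) (tangentCoordChange (𝓡 n) x p x u)
            (tangentCoordChange (𝓡 n) x p x v)) + mfderivModel k n f x a := by
  have hx := mem_source_self (k := n) x
  have hy := mem_source_self (k := k) (f x)
  have hd := mdifferentiable_of_contMDiff hf
  set F := inCharts k n p q f with hF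
  set z := extChartAt (𝓡 n) p x with hz
  set û := tangentCoordChange (𝓡 n) x p x u with hû
  set v' := tangentCoordChange (𝓡 n) x p x v with hv'
  have hFz : F z = extChartAt (𝓡 k) q (f x) := inCharts_apply (k := k) f q hp
  have hFs : ContDiffAt ℝ ∞ F z := contDiffAt_inCharts (hf x) hp hq
  set ψ := transition (k := k) q (f x) with hψ
  have hψs : ContDiffAt ℝ ∞ ψ (F z) := by rw [hFz]; exact contDiffAt_transition hq hy
  -- This is the field with constant components `v` in the chart at `x`, rewritten in the chart at
  -- `p`.
  set a : EuclideanSpace ℝ (Fin n) → EuclideanSpace ℝ (Fin n) :=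
    fun z' => fderiv ℝ (transition x p) (transition p x z') v with ha
  have hzx : transition p x z = extChartAt (𝓡 n) x x := transition_apply hp
  have has : DifferentiableAt ℝ a z := by
    have h1 : ContDiffAt ℝ ∞ (transition x p) (transition p x z) := by
      rw [hzx]; exact contDiffAt_transition hx hp
    exact (((ContDiffAt.differentiableAt_infty (ContDiffAt.fderiv_infty h1)).comp z
      (ContDiffAt.differentiableAt_infty (contDiffAt_transition hp hx))).clm_apply
      (differentiableAt_const v))
  have haz : a z = v' := by rw [ha, hv']; simp only [hzx, fderiv_transition hx hp]
  have hev : (fun x' => toCoord (f x) (f x') (mfderiv (𝓡 n) (𝓡 k) f x' (ofCoord x x' v)))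
      ∘ (extChartAt (𝓡 n) p).symm =ᶠ[𝓝 z] fun z' => fderiv ℝ ψ (F z') (fderiv ℝ F z' (a z')) := by
    filter_upwards [eventually_symm_mem_source hp (Filter.inter_mem (source_mem_nhds hx)
      (Filter.inter_mem (hf.continuous.continuousAt (source_mem_nhds (k := k) hy))
        (hf.continuous.continuousAt (source_mem_nhds (k := k) hq))))] with z' hz'
    obtain ⟨h0, h1, h2, h3⟩ := hz'
    set x' := (extChartAt (𝓡 n) p).symm z' with hx'
    have h4 : x' ∈ (extChartAt (𝓡 n) p).source := (extChartAt (𝓡 n) p).map_target h0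
    have h5 : z' = extChartAt (𝓡 n) p x' := ((extChartAt (𝓡 n) p).right_inv h0).symm
    have h6 : a z' = tangentCoordChange (𝓡 n) x p x' v := by
      simp only [ha, h5, transition_apply h4, fderiv_transition h1 h4]
    have h7 : F z' = extChartAt (𝓡 k) q (f x') := by rw [h5, hF, inCharts_apply f q h4]
    have h8 := mfderivModel_eq (hd x') h4 h3 (tangentCoordChange (𝓡 n) x x' x' v)
    rw [tcc_comp h1 (mem_source_self x') h4, ← h6, ← h5] at h8
    rw [h7, fderiv_transition h3 h2]
    change tangentCoordChange (𝓡 k) (f x') (f x) (f x')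
      (mfderivModel k n f x' (tangentCoordChange (𝓡 n) x x' x' v)) = _
    rw [h8, tcc_comp h3 (mem_source_self (k := k) (f x')) h2]
  have hdF := ContDiffAt.differentiableAt_infty (ContDiffAt.fderiv_infty hFs)
  have hdψ : DifferentiableAt ℝ (fun z' => fderiv ℝ ψ (F z')) z :=
    (ContDiffAt.differentiableAt_infty (ContDiffAt.fderiv_infty hψs)).comp z
      (ContDiffAt.differentiableAt_infty hFs)
  have hY := hdF.clm_apply has
  have hdir : dirDeriv (fun x' => toCoord (f x) (f x')
      (mfderiv (𝓡 n) (𝓡 k) f x' (ofCoord x x' v))) x u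
      = fderiv ℝ (fderiv ℝ ψ) (F z) (fderiv ℝ F z û) (fderiv ℝ F z v')
        + fderiv ℝ ψ (F z) (fderiv ℝ (fderiv ℝ F) z û v' + fderiv ℝ F z (fderiv ℝ a z û)) := by
    rw [dirDeriv_eq hp (hev.differentiableAt_iff.2 (hdψ.clm_apply hY)), hev.fderiv_eq,
      fderiv_clm_apply hdψ hY, fderiv_clm_apply hdF has,
      show (fun z' => fderiv ℝ ψ (F z')) = fderiv ℝ ψ ∘ F from rfl,
      fderiv_comp (g := fderiv ℝ ψ) z (ContDiffAt.differentiableAt_infty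
        (ContDiffAt.fderiv_infty hψs)) (ContDiffAt.differentiableAt_infty hFs)]
    simp only [add_apply, ContinuousLinearMap.comp_apply, ContinuousLinearMap.flip_apply, haz,
      ← hû]
    abel_nf
  have hdf : ∀ w, mfderivModel k n f x w = tangentCoordChange (𝓡 k) q (f x) (f x)
      (fderiv ℝ F z (tangentCoordChange (𝓡 n) x p x w)) := fun w => mfderivModel_eq (hd x) hp hq w
  -- The tangential error collects the derivative of the field `a` and the term with `Γ'`; it is
  -- tangential for any `Γ'`, which may thus stay arbitrary.
  refine ⟨tangentCoordChange (𝓡 n) p x x (fderiv ℝ a z û + Γ' z û v'), ?_⟩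
  have hcov : covAlong (n := n) (metricFun g) f
      (fun x' => mfderiv (𝓡 n) (𝓡 k) f x' (ofCoord x x' v)) x u
      = dirDeriv (fun x' => toCoord (f x) (f x') (mfderiv (𝓡 n) (𝓡 k) f x' (ofCoord x x' v))) x u
        + christoffel (metricInChart (metricFun g) (f x)) (extChartAt (𝓡 k) (f x) (f x))
          (mfderivModel k n f x u) (mfderivModel k n f x (tangentCoordChange (𝓡 n) x x x v)) := rfl
  rw [hcov, hdir, christoffel_metricFun g hy, tcc_self hx, hdf, hdf, hdf, ← hû, ← hv',
    tcc_cancel hp hx, hFz]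
  -- The second derivative of the chart change `ψ` on the target is absorbed by the transformation
  -- law of the Christoffel symbols.
  have htr := chr_transition g hq hy (fderiv ℝ F z û) (fderiv ℝ F z v')
  rw [fderiv_transition hq hy]
  rw [← hψ] at htr
  rw [add_right_comm, htr, sff_apply, hFz]
  simp only [map_add, map_sub]
  abel

/-- The induced metric as a bilinear form on the model space. -/
def inducedModel (f : S → M) (x : S) :
    EuclideanSpace ℝ (Fin n) →L[ℝ] EuclideanSpace ℝ (Fin n) →L[ℝ] ℝ :=
  pull (innerModel g (f x)) (mfderivModel k n f x)

theorem inducedModel_symm (f : S → M) (x : S) (u v : EuclideanSpace ℝ (Fin n)) :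
    inducedModel g f x u v = inducedModel g f x v u :=
  innerModel_symm g _ _ _

theorem inducedModel_pos (hi : Function.Injective (mfderivModel k n f x))
    (u : EuclideanSpace ℝ (Fin n)) (hu : u ≠ 0) : 0 < inducedModel g f x u u :=
  innerModel_pos g _ _ fun h => hu (hi (Eq.trans h (map_zero (mfderivModel k n f x)).symm))

/-- The linear form ⟨w + df a, df ·⟩ is the one represented by `a`, since `w` is normal. The induced
metric is nondegenerate, so `sharp` returns `a` itself. -/
theorem normalPart_add (hi : Function.Injective (mfderivModel k n f x))
    (w : EuclideanSpace ℝ (Fin k)) (hw : ∀ u, innerModel g (f x) w (mfderivModel k n f x u) = 0)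
    (a : EuclideanSpace ℝ (Fin n)) :
    normalPart (n := n) (metricFun g) f x (w + mfderivModel k n f x a : EuclideanSpace ℝ (Fin k))
      = w := by
  set l : EuclideanSpace ℝ (Fin n) →L[ℝ] ℝ := inducedModel g f x a with hl
  have h1 : ∀ u, innerModel g (f x) (w + mfderivModel k n f x a) (mfderivModel k n f x u) = l u := by
    intro u
    rw [map_add, add_apply, hw, zero_add]
    rfl
  have h2 : sharp (fun u v => inducedModel g f x u v) (fun u => l u) = a := by
    have h3 := metric_sharp (inducedModel g f x) (inducedModel_symm g f x)
      (inducedModel_pos g hi) l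
    rw [← sub_eq_zero]
    by_contra h
    have h4 := inducedModel_pos g hi _ h
    have h6 : ∀ w, inducedModel g f x (sharp (fun u v => inducedModel g f x u v) (fun u => l u) - a) w
        = 0 := fun w => by
      rw [map_sub (inducedModel g f x), sub_apply, h3, hl, sub_self]
    rw [h6] at h4
    exact lt_irrefl _ h4
  have h5 : normalPart (n := n) (metricFun g) f x
      (w + mfderivModel k n f x a : EuclideanSpace ℝ (Fin k))
      = (w + mfderivModel k n f x a) - mfderivModel k n f x (sharp (fun u v => inducedModel g f x u v)
        fun u => innerModel g (f x) (w + mfderivModel k n f x a) (mfderivModel k n f x u)) := rfl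
  rw [h5]
  simp only [h1, h2]
  exact add_sub_cancel_right _ _

/-- The covariant derivative of df(v) is `sff` plus a tangential vector. `hgauss` says that `sff` is
normal, hence it is exactly what the normal projection keeps. -/
theorem secondFundamentalForm_eq (hf : ContMDiff (𝓡 n) (𝓡 k) ∞ f)
    (hp : x ∈ (extChartAt (𝓡 n) p).source) (hq : f x ∈ (extChartAt (𝓡 k) q).source)
    (hi : Function.Injective (mfderivModel k n f x))
    (Γ' : EuclideanSpace ℝ (Fin n) → EuclideanSpace ℝ (Fin n) →L[ℝ] EuclideanSpace ℝ (Fin n) →L[ℝ]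
      EuclideanSpace ℝ (Fin n))
    (hgauss : ∀ u v w, chartMetric g q (inCharts k n p q f (extChartAt (𝓡 n) p x))
      (sff (chr (chartMetric g q)) (inCharts k n p q f) Γ' (extChartAt (𝓡 n) p x) u v)
      (fderiv ℝ (inCharts k n p q f) (extChartAt (𝓡 n) p x) w) = 0)
    (u v : EuclideanSpace ℝ (Fin n)) :
    secondFundamentalForm (n := n) (metricFun g) f x u v
      = tangentCoordChange (𝓡 k) q (f x) (f x) (sff (chr (chartMetric g q)) (inCharts k n p q f) Γ'
            (extChartAt (𝓡 n) p x) (tangentCoordChange (𝓡 n) x p x u)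
            (tangentCoordChange (𝓡 n) x p x v)) := by
  obtain ⟨a, ha⟩ := covAlong_mfderiv g hf hp hq Γ' u v
  have h1 : secondFundamentalForm (n := n) (metricFun g) f x u v
      = normalPart (n := n) (metricFun g) f x (covAlong (n := n) (metricFun g) f
        (fun x' => mfderiv (𝓡 n) (𝓡 k) f x' (ofCoord x x' v)) x u) := rfl
  rw [h1, ha]
  refine normalPart_add g hi _ (fun w => ?_) a
  have hy := mem_source_self (k := k) (f x)
  rw [innerModel_eq g hq, tcc_cancel hq hy,
    mfderivModel_eq (mdifferentiable_of_contMDiff hf x) hp hq, tcc_cancel hq hy,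
    ← inCharts_apply (k := k) f q hp]
  exact hgauss _ _ _

theorem meanCurvature_eq (hf : ContMDiff (𝓡 n) (𝓡 k) ∞ f)
    (hp : x ∈ (extChartAt (𝓡 n) p).source) (hq : f x ∈ (extChartAt (𝓡 k) q).source)
    (hi : Function.Injective (mfderivModel k n f x))
    (Γ' : EuclideanSpace ℝ (Fin n) → EuclideanSpace ℝ (Fin n) →L[ℝ] EuclideanSpace ℝ (Fin n) →L[ℝ]
      EuclideanSpace ℝ (Fin n))
    (hgauss : ∀ u v w, chartMetric g q (inCharts k n p q f (extChartAt (𝓡 n) p x))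
      (sff (chr (chartMetric g q)) (inCharts k n p q f) Γ' (extChartAt (𝓡 n) p x) u v)
      (fderiv ℝ (inCharts k n p q f) (extChartAt (𝓡 n) p x) w) = 0)
    (ε : Fin n → EuclideanSpace ℝ (Fin n))
    (hε : ∀ i j, inducedModel g f x (ε i) (ε j) = if i = j then 1 else 0) :
    meanCurvature (n := n) (metricFun g) f x
      = tangentCoordChange (𝓡 k) q (f x) (f x) (∑ i, sff (chr (chartMetric g q))
          (inCharts k n p q f) Γ' (extChartAt (𝓡 n) p x) (tangentCoordChange (𝓡 n) x p x (ε i))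
            (tangentCoordChange (𝓡 n) x p x (ε i))) := by
  let A := tangentCoordChange (𝓡 n) x p x
  let σ := sff (chr (chartMetric g q)) (inCharts k n p q f) Γ' (extChartAt (𝓡 n) p x)
  let B : EuclideanSpace ℝ (Fin n) →ₗ[ℝ] EuclideanSpace ℝ (Fin n) →ₗ[ℝ] EuclideanSpace ℝ (Fin k) :=
    LinearMap.mk₂ ℝ (fun u v => tangentCoordChange (𝓡 k) q (f x) (f x) (σ (A u) (A v)))
      (by intros; simp) (by intros; simp) (by intros; simp) (by intros; simp)
  have h1 : meanCurvature (n := n) (metricFun g) f x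
      = metricTrace (k := n) (V := EuclideanSpace ℝ (Fin k)) (fun u v => inducedModel g f x u v)
        (fun u v => secondFundamentalForm (n := n) (metricFun g) f x u v) := rfl
  have h2 : (fun u v => secondFundamentalForm (n := n) (metricFun g) f x u v)
      = fun u v => B u v := by
    ext1 u; ext1 v
    exact secondFundamentalForm_eq g hf hp hq hi Γ' hgauss u v
  refine h1.trans ((congrArg (metricTrace (k := n) (V := EuclideanSpace ℝ (Fin k))
    (fun u v => inducedModel g f x u v)) h2).trans ?_)
  rw [metricTrace_of_orthonormal _ ε hε B, map_sum]
  rfl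

/-! ### Alternating forms -/

variable {l : ℕ}

/-- The form `Ω` at `y`, as a form on the model space. -/
def formModel (Ω : ∀ q : M, TangentSpace (𝓡 k) q [⋀^Fin l]→L[ℝ] ℝ) (y : M) :
    EuclideanSpace ℝ (Fin k) [⋀^Fin l]→L[ℝ] ℝ := Ω y

/-- The form `Ω` in the chart at `q`. -/
def formInChart (Ω : ∀ q : M, TangentSpace (𝓡 k) q [⋀^Fin l]→L[ℝ] ℝ) (q : M)
    (z : EuclideanSpace ℝ (Fin k)) : EuclideanSpace ℝ (Fin k) [⋀^Fin l]→L[ℝ] ℝ :=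
  (formModel Ω ((extChartAt (𝓡 k) q).symm z)).compContinuousLinearMap
    (tangentCoordChange (𝓡 k) q ((extChartAt (𝓡 k) q).symm z) ((extChartAt (𝓡 k) q).symm z))

variable {Ω : ∀ q : M, TangentSpace (𝓡 k) q [⋀^Fin l]→L[ℝ] ℝ} {y : M}

theorem formInChart_apply (hq : y ∈ (extChartAt (𝓡 k) q).source)
    (w : Fin l → EuclideanSpace ℝ (Fin k)) :
    formInChart Ω q (extChartAt (𝓡 k) q y) w
      = formModel Ω y (fun i => tangentCoordChange (𝓡 k) q y y (w i)) := by
  rw [formInChart, (extChartAt (𝓡 k) q).left_inv hq]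
  rfl

theorem formModel_eq (hq : y ∈ (extChartAt (𝓡 k) q).source)
    (w : Fin l → EuclideanSpace ℝ (Fin k)) :
    formModel Ω y w
      = formInChart Ω q (extChartAt (𝓡 k) q y) (fun i => tangentCoordChange (𝓡 k) y q y (w i)) := by
  rw [formInChart_apply hq]
  congr 1
  ext1 i
  rw [tcc_cancel (mem_source_self y) hq]

theorem contDiffAt_formInChart (hΩ : IsSmoothForm Ω) (hq : y ∈ (extChartAt (𝓡 k) q).source) :
    ContDiffAt ℝ ∞ (formInChart Ω q) (extChartAt (𝓡 k) q y) := by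
  have h : ContDiffOn ℝ ∞ (formInChart Ω q) (extChartAt (𝓡 k) q).target :=
    contDiffOn_form fun v => hΩ q v
  exact h.contDiffAt (extChartAt_target_mem_nhds' ((extChartAt (𝓡 k) q).map_source hq))

/-- The covariant derivative of a form along a map, in arbitrary charts. -/
theorem covTensorAlong_form (hΩ : IsSmoothForm Ω) (hf : ContMDiff (𝓡 n) (𝓡 k) ∞ f)
    (hp : x ∈ (extChartAt (𝓡 n) p).source) (hq : f x ∈ (extChartAt (𝓡 k) q).source)
    (u : EuclideanSpace ℝ (Fin n)) (w : Fin l → EuclideanSpace ℝ (Fin k)) :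
    covTensorAlong (n := n) (metricFun g) f (fun x v => Ω (f x) v) x u w
      = covForm (chr (chartMetric g q)) (formInChart Ω q)
          (inCharts k n p q f (extChartAt (𝓡 n) p x))
          (fderiv ℝ (inCharts k n p q f) (extChartAt (𝓡 n) p x) (tangentCoordChange (𝓡 n) x p x u))
          (fun i => tangentCoordChange (𝓡 k) (f x) q (f x) (w i)) := by
  have hx := mem_source_self (k := n) x
  have hy := mem_source_self (k := k) (f x)
  have hd := mdifferentiable_of_contMDiff hf
  set F := inCharts k n p q f with hF
  set z := extChartAt (𝓡 n) p x with hz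
  set û := tangentCoordChange (𝓡 n) x p x u with hû
  have hFz : F z = extChartAt (𝓡 k) q (f x) := inCharts_apply (k := k) f q hp
  have hFs : ContDiffAt ℝ ∞ F z := contDiffAt_inCharts (hf x) hp hq
  have hFd := ContDiffAt.differentiableAt_infty hFs
  set χ := transition (k := k) (f x) q with hχ
  set ψ := transition (k := k) q (f x) with hψ
  have hψz : ψ (F z) = extChartAt (𝓡 k) (f x) (f x) := by rw [hFz]; exact transition_apply hq
  have hχs : ContDiffAt ℝ ∞ χ (ψ (F z)) := by rw [hψz]; exact contDiffAt_transition hy hq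
  have hψs : ContDiffAt ℝ ∞ ψ (F z) := by rw [hFz]; exact contDiffAt_transition hq hy
  have hχd := ContDiffAt.differentiableAt_infty (ContDiffAt.fderiv_infty hχs)
  have hψd := ContDiffAt.differentiableAt_infty hψs
  have hΩs : ContDiffAt ℝ ∞ (formInChart Ω q) (F z) := by
    rw [hFz]; exact contDiffAt_formInChart hΩ hq
  have hΩd := ContDiffAt.differentiableAt_infty hΩs
  -- These are the fields with constant components `w i` in the chart at `f x`, which the definition
  -- of the covariant derivative uses, rewritten in the chart at `q`.
  set Y : Fin l → EuclideanSpace ℝ (Fin n) → EuclideanSpace ℝ (Fin k) :=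
    fun i z' => fderiv ℝ χ (ψ (F z')) (w i) with hY
  have hev : (fun x' => Ω (f x') fun i => ofCoord (f x) (f x') (w i)) ∘ (extChartAt (𝓡 n) p).symm
      =ᶠ[𝓝 z] fun z' => formInChart Ω q (F z') (fun i => Y i z') := by
    filter_upwards [eventually_symm_mem_source hp
      (Filter.inter_mem (hf.continuous.continuousAt (source_mem_nhds (k := k) hy))
        (hf.continuous.continuousAt (source_mem_nhds (k := k) hq)))] with z' hz'
    obtain ⟨h0, h2, h3⟩ := hz'
    set x' := (extChartAt (𝓡 n) p).symm z' with hx'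
    have h4 : x' ∈ (extChartAt (𝓡 n) p).source := (extChartAt (𝓡 n) p).map_target h0
    have h5 : z' = extChartAt (𝓡 n) p x' := ((extChartAt (𝓡 n) p).right_inv h0).symm
    have h7 : F z' = extChartAt (𝓡 k) q (f x') := by rw [h5, hF, inCharts_apply f q h4]
    have h8 : ∀ i, Y i z' = tangentCoordChange (𝓡 k) (f x) q (f x') (w i) := by
      intro i
      simp only [hY, h7]
      rw [hψ, transition_apply h3, hχ, fderiv_transition h2 h3]
    simp only [h8]
    rw [h7, formInChart_apply h3]
    simp only [tcc_comp h2 h3 (mem_source_self (k := k) (f x'))]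
    rfl
  have hΩF : DifferentiableAt ℝ (fun z' => formInChart Ω q (F z')) z := hΩd.comp z hFd
  have hψF : DifferentiableAt ℝ (fun z' => ψ (F z')) z := hψd.comp z hFd
  have hχF : DifferentiableAt ℝ (fun z' => fderiv ℝ χ (ψ (F z'))) z := hχd.comp z hψF
  have hYd : ∀ i, DifferentiableAt ℝ (Y i) z := fun i => hχF.clm_apply (differentiableAt_const _)
  have hYz : ∀ i, Y i z = tangentCoordChange (𝓡 k) (f x) q (f x) (w i) := by
    intro i
    simp only [hY, hψz]
    rw [hχ, fderiv_transition hy hq]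
  have hdf : mfderivModel k n f x u = tangentCoordChange (𝓡 k) q (f x) (f x) (fderiv ℝ F z û) :=
    mfderivModel_eq (hd x) hp hq u
  have hYu : ∀ i, fderiv ℝ (Y i) z û
      = fderiv ℝ (fderiv ℝ χ) (extChartAt (𝓡 k) (f x) (f x)) (mfderivModel k n f x u) (w i) := by
    intro i
    have h1 : fderiv ℝ (fun z' => fderiv ℝ χ (ψ (F z'))) z û
        = fderiv ℝ (fderiv ℝ χ) (ψ (F z)) (fderiv ℝ ψ (F z) (fderiv ℝ F z û)) := by
      rw [show (fun z' => fderiv ℝ χ (ψ (F z'))) = fderiv ℝ χ ∘ (fun z' => ψ (F z')) from rfl,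
        fderiv_comp (g := fderiv ℝ χ) z hχd hψF,
        show (fun z' => ψ (F z')) = ψ ∘ F from rfl, fderiv_comp (g := ψ) z hψd hFd]
      rfl
    rw [hY, fderiv_clm_apply hχF (differentiableAt_const _)]
    simp only [fderiv_fun_const, add_apply, ContinuousLinearMap.comp_apply,
      ContinuousLinearMap.flip_apply, h1, Pi.zero_apply, zero_apply, map_zero, zero_add]
    rw [hdf, hψz, hFz, hψ, fderiv_transition hq hy]
  have hcov : covTensorAlong (n := n) (metricFun g) f (fun x v => Ω (f x) v) x u w
      = dirDeriv (fun x' => Ω (f x') fun i => ofCoord (f x) (f x') (w i)) x u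
        - ∑ i, formModel Ω (f x) (Function.update w i
          (christoffel (metricInChart (metricFun g) (f x)) (extChartAt (𝓡 k) (f x) (f x))
            (mfderivModel k n f x u) (w i))) := rfl
  rw [hcov, dirDeriv_eq hp (hev.differentiableAt_iff.2
    (hΩF.continuousAlternatingMap_apply hYd)), hev.fderiv_eq, ← hû,
    fderiv_form_apply hΩF hYd û (chr (chartMetric g q) (F z) (fderiv ℝ F z û)),
    show (fun z' => formInChart Ω q (F z')) = formInChart Ω q ∘ F from rfl,
    fderiv_comp (g := formInChart Ω q) z hΩd hFd]
  -- By the transformation law, the covariant derivative of such a field is the Christoffel symbol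
  -- of the chart at `f x`. The sum over slots therefore cancels the correction in the definition of
  -- `covTensorAlong`.
  have hterm : ∀ i, fderiv ℝ (Y i) z û + chr (chartMetric g q) (F z) (fderiv ℝ F z û) (Y i z)
      = tangentCoordChange (𝓡 k) (f x) q (f x) (chr (chartMetric g (f x))
        (extChartAt (𝓡 k) (f x) (f x)) (mfderivModel k n f x u) (w i)) := by
    intro i
    have h1 := chr_transition g hy hq (mfderivModel k n f x u) (w i)
    rw [← h1, hYu, hYz, hFz, hdf, tcc_cancel hq hy]
  simp only [hterm]
  simp only [hYz, christoffel_metricFun g hy]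
  rw [add_sub_assoc, ← Finset.sum_sub_distrib, Finset.sum_eq_zero, add_zero]
  · rfl
  · intro i _
    rw [sub_eq_zero, formModel_eq hq, ← hFz]
    change formInChart Ω q (F z) _ = _
    congr 1
    ext1 j
    by_cases hj : j = i
    · rw [hj, Function.update_self, Function.update_self]
    · rw [Function.update_of_ne hj, Function.update_of_ne hj]

end Along

/-! ### Immersions, frames and their invariants in the preferred charts -/

section Immersion

variable {k n : ℕ} {M : Type*} [TopologicalSpace M] [ChartedSpace (EuclideanSpace ℝ (Fin k)) M]
  [IsManifold (𝓡 k) ∞ M]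
  {S : Type*} [TopologicalSpace S] [ChartedSpace (EuclideanSpace ℝ (Fin n)) S]
  [IsManifold (𝓡 n) ∞ S]
  (g : ContMDiffRiemannianMetric (𝓡 k) ∞ (EuclideanSpace ℝ (Fin k))
      (fun x : M => TangentSpace (𝓡 k) x))
  {p x : S} {q : M} {f : S → M}

theorem eventually_chart (hp : x ∈ (extChartAt (𝓡 n) p).source) {P : S → Prop}
    (h : ∀ᶠ x' in 𝓝 x, P x') : ∀ᶠ z in 𝓝 (extChartAt (𝓡 n) p x),
      ∃ x' ∈ (extChartAt (𝓡 n) p).source, P x' ∧ extChartAt (𝓡 n) p x' = z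
        ∧ (extChartAt (𝓡 n) p).symm z = x' := by
  filter_upwards [eventually_symm_mem_source hp h] with z hz
  exact ⟨_, (extChartAt (𝓡 n) p).map_target hz.1, hz.2, (extChartAt (𝓡 n) p).right_inv hz.1, rfl⟩

/-- The induced metric in the chart at `p`. -/
def inducedChart (f : S → M) (p : S) (z : EuclideanSpace ℝ (Fin n)) :
    EuclideanSpace ℝ (Fin n) →L[ℝ] EuclideanSpace ℝ (Fin n) →L[ℝ] ℝ :=
  pull (inducedModel g f ((extChartAt (𝓡 n) p).symm z))
    (tangentCoordChange (𝓡 n) p ((extChartAt (𝓡 n) p).symm z) ((extChartAt (𝓡 n) p).symm z))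

theorem metricInChart_inducedMetric (f : S → M) (p : S) :
    metricInChart (inducedMetric (n := n) (metricFun g) f) p
      = fun z u v => inducedChart g f p z u v := rfl

theorem inducedChart_apply (hf : ContMDiff (𝓡 n) (𝓡 k) ∞ f)
    (hp : x ∈ (extChartAt (𝓡 n) p).source) (hq : f x ∈ (extChartAt (𝓡 k) q).source) :
    inducedChart g f p (extChartAt (𝓡 n) p x)
      = pull (chartMetric g q (inCharts k n p q f (extChartAt (𝓡 n) p x)))
        (fderiv ℝ (inCharts k n p q f) (extChartAt (𝓡 n) p x)) := by
  have hd := mdifferentiable_of_contMDiff hf x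
  refine ContinuousLinearMap.ext fun u => ContinuousLinearMap.ext fun v => ?_
  rw [inducedChart, (extChartAt (𝓡 n) p).left_inv hp, pull_apply, pull_apply, inducedModel,
    pull_apply, innerModel_eq g hq, fderiv_inCharts hd hp hq, fderiv_inCharts hd hp hq,
    inCharts_apply f q hp]

theorem fderiv_inCharts_injective (hf : ContMDiff (𝓡 n) (𝓡 k) ∞ f)
    (hi : Function.Injective (mfderivModel k n f x))
    (hp : x ∈ (extChartAt (𝓡 n) p).source) (hq : f x ∈ (extChartAt (𝓡 k) q).source) :
    Function.Injective (fderiv ℝ (inCharts k n p q f) (extChartAt (𝓡 n) p x)) := by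
  have hd := mdifferentiable_of_contMDiff hf x
  intro u v huv
  rw [fderiv_inCharts hd hp hq, fderiv_inCharts hd hp hq] at huv
  have h1 := congrArg (tangentCoordChange (𝓡 k) q (f x) (f x)) huv
  rw [tcc_cancel (k := k) (mem_source_self (f x)) hq,
    tcc_cancel (k := k) (mem_source_self (f x)) hq] at h1
  have h2 := congrArg (tangentCoordChange (𝓡 n) x p x) (hi h1)
  rwa [tcc_cancel hp (mem_source_self x), tcc_cancel hp (mem_source_self x)] at h2

/-- This places the immersion within the reach of the computation in normed spaces, with the
Levi-Civita connections of the ambient and induced metrics. -/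
theorem isIsometricNear_inCharts (hf : ContMDiff (𝓡 n) (𝓡 k) ∞ f)
    (hi : ∀ x, Function.Injective (mfderivModel k n f x))
    (hp : x ∈ (extChartAt (𝓡 n) p).source) (hq : f x ∈ (extChartAt (𝓡 k) q).source) :
    IsIsometricNear (chartMetric g q) (chr (chartMetric g q)) (inCharts k n p q f)
      (chr (inducedChart g f p)) (extChartAt (𝓡 n) p x) := by
  have hev := eventually_chart hp (hf.continuous.continuousAt (source_mem_nhds (k := k) hq))
  have hz := inCharts_apply (k := k) f q hp
  refine isIsometricNear_of_immersion (contDiffAt_inCharts (hf x) hp hq) ?_ ?_ ?_ ?_ ?_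
  · rw [hz]; exact contDiffAt_chartMetric g hq
  · exact Filter.Eventually.of_forall fun y => chartMetric_symm g q y
  · rw [hz]; exact eventually_chartMetric_pos g hq
  · filter_upwards [hev] with z hz
    obtain ⟨x', h1, h2, rfl, -⟩ := hz
    exact inducedChart_apply g hf h1 h2
  · filter_upwards [hev] with z hz
    obtain ⟨x', h1, h2, rfl, -⟩ := hz
    exact fderiv_inCharts_injective hf (hi x') h1 h2

/-- The vector field `a` in the chart at `p`. -/
def fieldInChart (p : S) (a : S → EuclideanSpace ℝ (Fin n)) (z : EuclideanSpace ℝ (Fin n)) :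
    EuclideanSpace ℝ (Fin n) :=
  tangentCoordChange (𝓡 n) ((extChartAt (𝓡 n) p).symm z) p ((extChartAt (𝓡 n) p).symm z)
    (a ((extChartAt (𝓡 n) p).symm z))

theorem fieldInChart_apply (a : S → EuclideanSpace ℝ (Fin n))
    (hp : x ∈ (extChartAt (𝓡 n) p).source) :
    fieldInChart p a (extChartAt (𝓡 n) p x) = tangentCoordChange (𝓡 n) x p x (a x) := by
  rw [fieldInChart, (extChartAt (𝓡 n) p).left_inv hp]

theorem fieldInChart_self (a : S → EuclideanSpace ℝ (Fin n)) (p : S) :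
    fieldInChart p a (extChartAt (𝓡 n) p p) = a p := by
  rw [fieldInChart_apply a (mem_source_self p), tcc_self (mem_source_self p)]

theorem inducedChart_fieldInChart (a b : S → EuclideanSpace ℝ (Fin n))
    (hp : x ∈ (extChartAt (𝓡 n) p).source) :
    inducedChart g f p (extChartAt (𝓡 n) p x) (fieldInChart p a (extChartAt (𝓡 n) p x))
      (fieldInChart p b (extChartAt (𝓡 n) p x)) = inducedModel g f x (a x) (b x) := by
  rw [fieldInChart_apply a hp, fieldInChart_apply b hp, inducedChart,
    (extChartAt (𝓡 n) p).left_inv hp, pull_apply, tcc_cancel (mem_source_self x) hp,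
    tcc_cancel (mem_source_self x) hp]

theorem isFrameNear_inCharts (hf : ContMDiff (𝓡 n) (𝓡 k) ∞ f)
    (hp : x ∈ (extChartAt (𝓡 n) p).source) (hq : f x ∈ (extChartAt (𝓡 k) q).source)
    (e : Fin n → S → EuclideanSpace ℝ (Fin n))
    (hes : ∀ i, ContDiffAt ℝ ∞ (fieldInChart p (e i)) (extChartAt (𝓡 n) p x))
    (heo : ∀ᶠ x' in 𝓝 x, ∀ i j, inducedModel g f x' (e i x') (e j x') = if i = j then 1 else 0) :
    IsFrameNear (chartMetric g q) (inCharts k n p q f) (fun i => fieldInChart p (e i))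
      (extChartAt (𝓡 n) p x) := by
  have hev := eventually_chart hp (heo.and
    (hf.continuous.continuousAt (source_mem_nhds (k := k) hq)))
  have hon : ∀ᶠ z in 𝓝 (extChartAt (𝓡 n) p x), ∀ i j,
      pull (chartMetric g q (inCharts k n p q f z)) (fderiv ℝ (inCharts k n p q f) z)
        (fieldInChart p (e i) z) (fieldInChart p (e j) z) = if i = j then 1 else 0 := by
    filter_upwards [hev] with z hz
    obtain ⟨x', h1, ⟨h2, h3⟩, rfl, -⟩ := hz
    intro i j
    rw [← inducedChart_apply g hf h1 h3, inducedChart_fieldInChart g _ _ h1, h2]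
  refine ⟨hes, hon, ?_⟩
  filter_upwards [hon] with z hz u
  exact eq_sum_of_orthonormal _ (fun i => fieldInChart p (e i) z) hz (by simp) u

theorem inducedChart_pos (hi : Function.Injective (mfderivModel k n f p)) (u : EuclideanSpace ℝ (Fin n)) (hu : u ≠ 0) :
    0 < inducedChart g f p (extChartAt (𝓡 n) p p) u u := by
  rw [inducedChart, (extChartAt (𝓡 n) p).left_inv (mem_source_self p), pull_apply,
    tcc_self (mem_source_self p)]
  exact inducedModel_pos g hi u hu

theorem differentiableAt_inducedChart (hf : ContMDiff (𝓡 n) (𝓡 k) ∞ f) (p : S) :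
    DifferentiableAt ℝ (inducedChart g f p) (extChartAt (𝓡 n) p p) := by
  have hp := mem_source_self (k := n) p
  have hq := mem_source_self (k := k) (f p)
  have hs := contDiffAt_inCharts (hf p) hp hq
  have hG : ContDiffAt ℝ ∞ (chartMetric g (f p))
      (inCharts k n p (f p) f (extChartAt (𝓡 n) p p)) := by
    rw [inCharts_apply f _ hp]; exact contDiffAt_chartMetric g hq
  have h1 : ContDiffAt ℝ ∞ (fun y => pull (chartMetric g (f p) (inCharts k n p (f p) f y))
      (fderiv ℝ (inCharts k n p (f p) f) y)) (extChartAt (𝓡 n) p p) :=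
    contDiffAt_pull (hG.comp _ hs) (ContDiffAt.fderiv_infty hs)
  refine ContDiffAt.differentiableAt_infty (h1.congr_of_eventuallyEq ?_)
  filter_upwards [eventually_chart hp
    (hf.continuous.continuousAt (source_mem_nhds (k := k) hq))] with z hz
  obtain ⟨x', h1, h2, rfl, -⟩ := hz
  exact inducedChart_apply g hf h1 h2

theorem christoffel_inducedMetric (hf : ContMDiff (𝓡 n) (𝓡 k) ∞ f)
    (hi : Function.Injective (mfderivModel k n f p)) (u v : EuclideanSpace ℝ (Fin n)) :
    christoffel (metricInChart (inducedMetric (n := n) (metricFun g) f) p) (extChartAt (𝓡 n) p p) u v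
      = chr (inducedChart g f p) (extChartAt (𝓡 n) p p) u v := by
  rw [metricInChart_inducedMetric]
  refine christoffel_eq_chr (differentiableAt_inducedChart g hf p) (fun u v => ?_)
    (inducedChart_pos g hi) u v
  rw [inducedChart, pull_apply, pull_apply]
  exact inducedModel_symm g f _ _ _

/-- Only the germ of the function in the chart matters, so `φ` can be replaced by a local
expression. The coordinate trace of the Hessian becomes a sum over an orthonormal basis. -/
theorem laplacian_eq (hf : ContMDiff (𝓡 n) (𝓡 k) ∞ f)
    (hi : Function.Injective (mfderivModel k n f p)) (ε : Fin n → EuclideanSpace ℝ (Fin n))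
    (hε : ∀ i j, inducedModel g f p (ε i) (ε j) = if i = j then 1 else 0) {φ : S → ℝ}
    {φ' : EuclideanSpace ℝ (Fin n) → ℝ}
    (hφ : φ ∘ (extChartAt (𝓡 n) p).symm =ᶠ[𝓝 (extChartAt (𝓡 n) p p)] φ')
    (hφ' : ContDiffAt ℝ ∞ φ' (extChartAt (𝓡 n) p p)) :
    laplacian (inducedMetric (n := n) (metricFun g) f) φ p
      = ∑ l, (fderiv ℝ (fderiv ℝ φ') (extChartAt (𝓡 n) p p) (ε l) (ε l)
        - fderiv ℝ φ' (extChartAt (𝓡 n) p p)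
          (chr (inducedChart g f p) (extChartAt (𝓡 n) p p) (ε l) (ε l))) := by
  set z := extChartAt (𝓡 n) p p with hz
  let B : EuclideanSpace ℝ (Fin n) →ₗ[ℝ] EuclideanSpace ℝ (Fin n) →ₗ[ℝ] ℝ :=
    LinearMap.mk₂ ℝ (fun u v => fderiv ℝ (fderiv ℝ φ') z u v
      - fderiv ℝ φ' z (chr (inducedChart g f p) z u v))
      (by intros; simp; ring) (by intros; simp; ring) (by intros; simp; ring)
      (by intros; simp; ring)
  have h2 : (fun u v : EuclideanSpace ℝ (Fin n) =>
      fderiv ℝ (fun z => fderiv ℝ (φ ∘ (extChartAt (𝓡 n) p).symm) z v) z u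
      - fderiv ℝ (φ ∘ (extChartAt (𝓡 n) p).symm) z (christoffel (metricInChart
        (inducedMetric (n := n) (metricFun g) f) p) (extChartAt (𝓡 n) p p) u v))
      = fun u v => B u v := by
    ext u v
    have h3 : (fun z => fderiv ℝ (φ ∘ (extChartAt (𝓡 n) p).symm) z v)
        =ᶠ[𝓝 z] fun z => fderiv ℝ φ' z v := by
      filter_upwards [hφ.eventuallyEq_nhds] with y hy
      rw [hy.fderiv_eq]
    rw [h3.fderiv_eq, hφ.fderiv_eq, christoffel_inducedMetric g hf hi, fderiv_clm_apply
      (ContDiffAt.differentiableAt_infty (ContDiffAt.fderiv_infty hφ')) (differentiableAt_const v)]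
    simp [B, hz]
  have h1 : laplacian (inducedMetric (n := n) (metricFun g) f) φ p
      = metricTrace (fun u v => inducedModel g f p u v) (fun u v : EuclideanSpace ℝ (Fin n) =>
      fderiv ℝ (fun z => fderiv ℝ (φ ∘ (extChartAt (𝓡 n) p).symm) z v) z u
      - fderiv ℝ (φ ∘ (extChartAt (𝓡 n) p).symm) z (christoffel (metricInChart
        (inducedMetric (n := n) (metricFun g) f) p) (extChartAt (𝓡 n) p p) u v)) := rfl
  rw [h1, h2, metricTrace_of_orthonormal _ ε hε B]
  rfl

/-- The intrinsic connection ∇^Σ is the covariant derivative along the identity map for the induced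
metric. -/
theorem covAlong_id_inducedMetric (hf : ContMDiff (𝓡 n) (𝓡 k) ∞ f)
    (hi : Function.Injective (mfderivModel k n f p)) (a : S → EuclideanSpace ℝ (Fin n))
    (ha : DifferentiableAt ℝ (fieldInChart p a) (extChartAt (𝓡 n) p p))
    (u : EuclideanSpace ℝ (Fin n)) :
    covAlong (inducedMetric (n := n) (metricFun g) f) (id : S → S) a p u
      = covField (chr (inducedChart g f p)) (fieldInChart p a) (extChartAt (𝓡 n) p p) u := by
  have hp := mem_source_self (k := n) p
  have h1 : covAlong (inducedMetric (n := n) (metricFun g) f) (id : S → S) a p u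
      = dirDeriv (fun x' => tangentCoordChange (𝓡 n) x' p x' (a x')) p u
        + christoffel (metricInChart (inducedMetric (n := n) (metricFun g) f) p)
          (extChartAt (𝓡 n) p p) (mfderivModel n n (id : S → S) p u) (a p) := rfl
  have h2 : mfderivModel n n (id : S → S) p u = u := by
    rw [mfderivModel, mfderiv_id]; rfl
  have h3 := dirDeriv_eq (φ := fun x' => tangentCoordChange (𝓡 n) x' p x' (a x')) hp ha u
  rw [tcc_self hp] at h3
  rw [h1, h2, christoffel_inducedMetric g hf hi, h3, covField, fieldInChart_self]
  rfl

theorem covTensorAlong_id {l : ℕ} {Ω : ∀ q : M, TangentSpace (𝓡 k) q [⋀^Fin l]→L[ℝ] ℝ}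
    (hΩ : IsSmoothForm Ω) (q : M) (u : EuclideanSpace ℝ (Fin k))
    (w : Fin l → EuclideanSpace ℝ (Fin k)) :
    covTensorAlong (n := k) (metricFun g) (id : M → M) (fun x v => Ω x v) q u w
      = covForm (chr (chartMetric g q)) (formInChart Ω q) (extChartAt (𝓡 k) q q) u w := by
  have hq := mem_source_self (k := k) q
  have h := covTensorAlong_form (n := k) (f := (id : M → M)) (x := q) (p := q) (q := q) g hΩ
    contMDiff_id hq hq u w
  have h1 : inCharts k k q q (id : M → M) =ᶠ[𝓝 (extChartAt (𝓡 k) q q)] id := by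
    filter_upwards [eventually_chart hq Filter.univ_mem] with z hz
    obtain ⟨x', h1, -, rfl, -⟩ := hz
    rw [inCharts_apply _ _ h1]; rfl
  refine h.trans ?_
  rw [h1.fderiv_eq, inCharts_apply _ _ hq, fderiv_id]
  simp only [id_eq, tcc_self hq, ContinuousLinearMap.id_apply]

theorem differentiableAt_covForm {X V ι : Type*} [Fintype ι] [DecidableEq ι]
    [NormedAddCommGroup X] [NormedSpace ℝ X] [NormedAddCommGroup V] [NormedSpace ℝ V]
    [FiniteDimensional ℝ V] {Γ : V → V →L[ℝ] V →L[ℝ] V} {σ : V → V [⋀^ι]→L[ℝ] ℝ} {c Y : X → V}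
    {x : X} (hΓ : ContDiffAt ℝ ∞ Γ (c x)) (hσ : ContDiffAt ℝ ∞ σ (c x)) (hc : DifferentiableAt ℝ c x)
    (hY : DifferentiableAt ℝ Y x) : DifferentiableAt ℝ (fun x => covForm Γ σ (c x) (Y x)) x := by
  have a1 : DifferentiableAt ℝ (fun x => fderiv ℝ σ (c x)) x :=
    (ContDiffAt.differentiableAt_infty (ContDiffAt.fderiv_infty hσ)).comp x hc
  have a2 : DifferentiableAt ℝ (fun x => Γ (c x)) x :=
    (ContDiffAt.differentiableAt_infty hΓ).comp x hc
  have a3 : DifferentiableAt ℝ (fun x => σ (c x)) x :=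
    (ContDiffAt.differentiableAt_infty hσ).comp x hc
  exact (a1.clm_apply hY).sub (differentiableAt_derivAct a3 (a2.clm_apply hY))

/-- The second covariant derivative of a form along `f`. -/
theorem covTensorAlong_covTensorAlong {l : ℕ}
    {Ω : ∀ q : M, TangentSpace (𝓡 k) q [⋀^Fin l]→L[ℝ] ℝ}
    (hΩ : IsSmoothForm Ω) (hf : ContMDiff (𝓡 n) (𝓡 k) ∞ f) (a : S → EuclideanSpace ℝ (Fin n))
    (ha : DifferentiableAt ℝ (fieldInChart p a) (extChartAt (𝓡 n) p p))
    (u : EuclideanSpace ℝ (Fin n)) (w : Fin l → EuclideanSpace ℝ (Fin k)) :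
    covTensorAlong (n := n) (metricFun g) f (fun x => covTensorAlong (n := n) (metricFun g) f
        (fun x v => Ω (f x) v) x (a x)) p u w
      = (fderiv ℝ (fun z => covForm (chr (chartMetric g (f p))) (formInChart Ω (f p))
            (inCharts k n p (f p) f z)
            (fderiv ℝ (inCharts k n p (f p) f) z (fieldInChart p a z))) (extChartAt (𝓡 n) p p) u
          - derivAct (covForm (chr (chartMetric g (f p))) (formInChart Ω (f p))
              (inCharts k n p (f p) f (extChartAt (𝓡 n) p p))
              (fderiv ℝ (inCharts k n p (f p) f) (extChartAt (𝓡 n) p p) (a p)))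
            (chr (chartMetric g (f p)) (inCharts k n p (f p) f (extChartAt (𝓡 n) p p))
              (fderiv ℝ (inCharts k n p (f p) f) (extChartAt (𝓡 n) p p) u))) w := by
  have hp := mem_source_self (k := n) p
  have hq := mem_source_self (k := k) (f p)
  have hd := mdifferentiable_of_contMDiff hf
  set fh := inCharts k n p (f p) f with hfh
  set z := extChartAt (𝓡 n) p p with hz
  set Γ := chr (chartMetric g (f p)) with hΓ
  set σ := formInChart Ω (f p) with hσ
  set θ := fun z => covForm Γ σ (fh z) (fderiv ℝ fh z (fieldInChart p a z)) with hθ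
  have hfz : fh z = extChartAt (𝓡 k) (f p) (f p) := inCharts_apply (k := k) f _ hp
  have hfs : ContDiffAt ℝ ∞ fh z := contDiffAt_inCharts (hf p) hp hq
  have hθd : DifferentiableAt ℝ θ z := by
    refine differentiableAt_covForm ?_ ?_ (ContDiffAt.differentiableAt_infty hfs)
      ((ContDiffAt.differentiableAt_infty (ContDiffAt.fderiv_infty hfs)).clm_apply ha)
    · rw [hfz]; exact contDiffAt_chr (contDiffAt_chartMetric g hq) (chartMetric_pos g hq)
    · rw [hfz]; exact contDiffAt_formInChart hΩ hq
  -- At nearby points the inner derivative is defined through preferred charts that vary with the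
  -- point. It has to be rewritten in the fixed charts at `p` and `f p` before it can be
  -- differentiated.
  have hinner : ∀ x ∈ (extChartAt (𝓡 n) p).source, f x ∈ (extChartAt (𝓡 k) (f p)).source →
      ∀ w : Fin l → EuclideanSpace ℝ (Fin k), covTensorAlong (n := n) (metricFun g) f
        (fun x v => Ω (f x) v) x (a x) w = θ (extChartAt (𝓡 n) p x)
          (fun i => tangentCoordChange (𝓡 k) (f x) (f p) (f x) (w i)) := by
    intro x hx hfx w
    rw [covTensorAlong_form g hΩ hf hx hfx, hθ]
    simp only [fieldInChart_apply a hx]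
    rfl
  have hev : (fun x' => covTensorAlong (n := n) (metricFun g) f (fun x v => Ω (f x) v) x' (a x')
      fun i => ofCoord (f p) (f x') (w i)) ∘ (extChartAt (𝓡 n) p).symm =ᶠ[𝓝 z] fun z => θ z w := by
    filter_upwards [eventually_chart hp (hf.continuous.continuousAt (source_mem_nhds (k := k) hq))]
      with z' hz'
    obtain ⟨x', h1, h2, rfl, h3⟩ := hz'
    rw [Function.comp_apply, h3]
    refine (hinner x' h1 h2 _).trans (congrArg _ ?_)
    ext1 i
    exact tcc_cancel (k := k) h2 (mem_source_self (f x')) _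
  have hcov : covTensorAlong (n := n) (metricFun g) f (fun x => covTensorAlong (n := n)
      (metricFun g) f (fun x v => Ω (f x) v) x (a x)) p u w
      = dirDeriv (fun x' => covTensorAlong (n := n) (metricFun g) f (fun x v => Ω (f x) v) x' (a x')
        fun i => ofCoord (f p) (f x') (w i)) p u
        - ∑ i, covTensorAlong (n := n) (metricFun g) f (fun x v => Ω (f x) v) p (a p)
          (Function.update w i
          (christoffel (metricInChart (metricFun g) (f p)) (extChartAt (𝓡 k) (f p) (f p))
            (mfderivModel k n f p u) (w i))) := rfl
  have hθw : DifferentiableAt ℝ (fun z => θ z w) z :=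
    hθd.continuousAlternatingMap_apply (g := fun i _ => w i) fun _ => differentiableAt_const _
  have hθf : fderiv ℝ (fun z => θ z w) z u = fderiv ℝ θ z u w := by
    have := fderiv_form_apply (Y := fun i _ => w i) hθd (fun _ => differentiableAt_const _) u 0
    simpa [derivAct_apply, ContinuousAlternatingMap.sub_apply, ContinuousAlternatingMap.map_update_zero] using this
  have hm : mfderivModel k n f p u = fderiv ℝ fh z u := by
    rw [mfderivModel_eq (hd p) hp hq, tcc_self hq, tcc_self hp]
  rw [hcov, dirDeriv_eq hp (hev.differentiableAt_iff.2 hθw), hev.fderiv_eq, tcc_self hp, hθf, hm,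
    ContinuousAlternatingMap.sub_apply, derivAct_apply]
  congr 1
  refine Finset.sum_congr rfl fun i _ => ?_
  refine (hinner p hp hq _).trans ?_
  simp only [hθ, ← hz, hz ▸ fieldInChart_self a p, christoffel_metricFun g hq, ← hΓ, hfz]
  exact congrArg _ (funext fun j => tcc_self (k := k) hq _)

end Immersion

/-! ### Time-dependent families of maps -/

section TimeDependent

variable {E V : Type*} [NormedAddCommGroup E] [NormedSpace ℝ E] [NormedAddCommGroup V]
  [NormedSpace ℝ V]

/-- The mixed second derivative of a family of maps that is smooth up to the boundary in time. -/
theorem hasDerivWithinAt_fderiv_slice {J : Set ℝ} {t : ℝ} (hJ : UniqueDiffOn ℝ J) (ht : t ∈ J)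
    (hcl : t ∈ closure (interior J)) {Φ : ℝ × E → V} {z₀ : E}
    (hΦ : ContDiffWithinAt ℝ ∞ Φ (J ×ˢ univ) (t, z₀)) {H : E → V}
    (hH : ∀ᶠ z in 𝓝 z₀, HasDerivWithinAt (fun s => Φ (s, z)) (H z) J t) {a : ℝ → E} {w : E}
    (ha : HasDerivWithinAt a w J t) :
    HasDerivWithinAt (fun s => fderiv ℝ (fun z => Φ (s, z)) z₀ (a s))
      (fderiv ℝ H z₀ (a t) + fderiv ℝ (fun z => Φ (t, z)) z₀ w) J t := by
  set A : Set (ℝ × E) := J ×ˢ univ with hA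
  have hAu : UniqueDiffOn ℝ A := hJ.prod uniqueDiffOn_univ
  have hmem : ((t, z₀) : ℝ × E) ∈ A := ⟨ht, mem_univ _⟩
  set D := fderivWithin ℝ Φ A with hD
  have hDd : DifferentiableWithinAt ℝ D A (t, z₀) :=
    (hΦ.fderivWithin_right hAu (m := 1) (by norm_cast) hmem).differentiableWithinAt one_ne_zero
  set D2 := fderivWithin ℝ D A (t, z₀) with hD2
  -- The time slab need not be open: at an endpoint the second derivative within it is still
  -- symmetric, because the point lies in the closure of the interior.
  have hsymm : IsSymmSndFDerivWithinAt ℝ Φ A (t, z₀) := by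
    refine ContDiffWithinAt.isSymmSndFDerivWithinAt (n := 2) (hΦ.of_le (by norm_cast)) (by simp) hAu
      ?_ hmem
    rw [hA, interior_prod_eq, interior_univ, closure_prod_eq, closure_univ]
    exact ⟨hcl, mem_univ _⟩
  have hev : ∀ᶠ y in 𝓝[A] (t, z₀), DifferentiableWithinAt ℝ Φ A y := by
    have h1 := (hΦ.of_le (m := 1) (by norm_cast)).eventually (by simp)
    rw [insert_eq_of_mem hmem] at h1
    exact h1.mono fun y hy => hy.differentiableWithinAt one_ne_zero
  have hspace : ∀ s z, s ∈ J → DifferentiableWithinAt ℝ Φ A (s, z) →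
      HasFDerivAt (fun z => Φ (s, z)) ((D (s, z)).comp (ContinuousLinearMap.inr ℝ ℝ E)) z := by
    intro s z hs hd
    rw [← hasFDerivWithinAt_univ]
    exact hd.hasFDerivWithinAt.comp z (hasFDerivAt_prodMk_right s z).hasFDerivWithinAt
      fun y _ => ⟨hs, mem_univ _⟩
  have hline : ∀ s z, HasDerivWithinAt (fun s => ((s, z) : ℝ × E)) (1, 0) J s := fun s z =>
    (hasDerivWithinAt_id s J).prodMk (hasDerivWithinAt_const s J z)
  have hmaps : ∀ z, MapsTo (fun s => ((s, z) : ℝ × E)) J A := fun z s hs => ⟨hs, mem_univ _⟩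
  have htendsto : Filter.Tendsto (fun s => ((s, z₀) : ℝ × E)) (𝓝[J] t) (𝓝[A] (t, z₀)) :=
    (hline t z₀).continuousWithinAt.tendsto_nhdsWithin (hmaps z₀)
  have hztendsto : Filter.Tendsto (fun z => ((t, z) : ℝ × E)) (𝓝 z₀) (𝓝[A] (t, z₀)) :=
    tendsto_nhdsWithin_iff.2 ⟨(Continuous.prodMk_right t).continuousAt,
      Filter.Eventually.of_forall fun z => ⟨ht, mem_univ _⟩⟩
  -- By uniqueness of derivatives within `J`, the velocity `H` is the time component of the full
  -- derivative. Its spatial derivative is then a mixed second derivative of `Φ`.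
  have hHD : H =ᶠ[𝓝 z₀] fun z => D (t, z) (1, 0) := by
    filter_upwards [hH, hztendsto.eventually hev] with z h1 h2
    exact (hJ t ht).eq_deriv _ h1 (h2.hasFDerivWithinAt.comp_hasDerivWithinAt t (hline t z) (hmaps z))
  have hDz : HasFDerivAt (fun z => D (t, z)) (D2.comp (ContinuousLinearMap.inr ℝ ℝ E)) z₀ := by
    rw [← hasFDerivWithinAt_univ]
    exact hDd.hasFDerivWithinAt.comp z₀ (hasFDerivAt_prodMk_right t z₀).hasFDerivWithinAt
      fun y _ => ⟨ht, mem_univ _⟩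
  have hfH : ∀ u, fderiv ℝ H z₀ u = D2 (0, u) (1, 0) := by
    intro u
    rw [hHD.fderiv_eq, fderiv_clm_apply hDz.differentiableAt (differentiableAt_const _), hDz.fderiv]
    simp
  have hDt : HasDerivWithinAt (fun s => D (s, z₀)) (D2 (1, 0)) J t :=
    hDd.hasFDerivWithinAt.comp_hasDerivWithinAt t (hline t z₀) (hmaps z₀)
  have h0 : HasDerivWithinAt (fun s => ((0, a s) : ℝ × E)) (0, w) J t :=
    (hasDerivWithinAt_const t J 0).prodMk ha
  have h1 := hDt.clm_apply h0
  have h2 : ∀ s ∈ J, DifferentiableWithinAt ℝ Φ A (s, z₀) → ∀ v,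
      fderiv ℝ (fun z => Φ (s, z)) z₀ v = D (s, z₀) (0, v) := by
    intro s hs hd v
    rw [(hspace s z₀ hs hd).fderiv]
    rfl
  have hdt : DifferentiableWithinAt ℝ Φ A (t, z₀) := hΦ.differentiableWithinAt (by simp)
  refine (h1.congr_of_eventuallyEq ?_ (h2 t ht hdt _)).congr_deriv ?_
  · filter_upwards [htendsto.eventually hev, self_mem_nhdsWithin] with s hs hsJ
    exact h2 s hsJ hs _
  · rw [hfH, h2 t ht hdt, hsymm (0, a t) (1, 0)]

end TimeDependent

/-! ### Flows and moving frames in charts -/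

section Flow

variable {k n : ℕ} {M : Type*} [TopologicalSpace M] [ChartedSpace (EuclideanSpace ℝ (Fin k)) M]
  [IsManifold (𝓡 k) ∞ M]
  {S : Type*} [TopologicalSpace S] [ChartedSpace (EuclideanSpace ℝ (Fin n)) S]
  [IsManifold (𝓡 n) ∞ S] {F : ℝ → S → M} {J : Set ℝ} {t : ℝ} {p x : S} {q : M}

theorem contMDiff_slice
    (hF : ContMDiffOn (𝓘(ℝ, ℝ).prod (𝓡 n)) (𝓡 k) ∞ (fun z : ℝ × S => F z.1 z.2) (J ×ˢ univ))
    (ht : t ∈ J) : ContMDiff (𝓡 n) (𝓡 k) ∞ (F t) := by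
  have h : ContMDiff (𝓡 n) (𝓘(ℝ, ℝ).prod (𝓡 n)) ∞ (fun x : S => (t, x)) :=
    contMDiff_const.prodMk contMDiff_id
  have h2 := hF.comp h.contMDiffOn (s := univ) fun x _ => ⟨ht, mem_univ _⟩
  exact contMDiffOn_univ.1 h2

/-- The second factor in the chart at `p`. -/
theorem contMDiffAt_prod_symm (t : ℝ) (hp : x ∈ (extChartAt (𝓡 n) p).source) :
    ContMDiffAt 𝓘(ℝ, ℝ × EuclideanSpace ℝ (Fin n)) (𝓘(ℝ, ℝ).prod (𝓡 n)) ∞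
      (fun y : ℝ × EuclideanSpace ℝ (Fin n) => (y.1, (extChartAt (𝓡 n) p).symm y.2))
      (t, extChartAt (𝓡 n) p x) := by
  have h1 : ContMDiffAt 𝓘(ℝ, ℝ × EuclideanSpace ℝ (Fin n)) 𝓘(ℝ, EuclideanSpace ℝ (Fin n)) ∞
      (fun y : ℝ × EuclideanSpace ℝ (Fin n) => y.2) (t, extChartAt (𝓡 n) p x) :=
    contDiff_snd.contMDiff.contMDiffAt
  have h2 : ContMDiffAt 𝓘(ℝ, EuclideanSpace ℝ (Fin n)) (𝓡 n) ∞ (extChartAt (𝓡 n) p).symm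
      (extChartAt (𝓡 n) p x) :=
    (contMDiffOn_extChartAt_symm p).contMDiffAt
      (extChartAt_target_mem_nhds' ((extChartAt (𝓡 n) p).map_source hp))
  exact (contDiff_fst.contMDiff.contMDiffAt).prodMk (h2.comp (t, extChartAt (𝓡 n) p x) h1)

/-- A function on `ℝ × S` in the chart at `p`. -/
theorem contDiffWithinAt_prod_chart {W : Type*} [NormedAddCommGroup W] [NormedSpace ℝ W]
    {φ : ℝ × S → W} (hp : x ∈ (extChartAt (𝓡 n) p).source)
    (hφ : ContMDiffWithinAt (𝓘(ℝ, ℝ).prod (𝓡 n)) 𝓘(ℝ, W) ∞ φ (J ×ˢ univ) (t, x)) :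
    ContDiffWithinAt ℝ ∞ (fun y : ℝ × EuclideanSpace ℝ (Fin n) =>
      φ (y.1, (extChartAt (𝓡 n) p).symm y.2)) (J ×ˢ univ) (t, extChartAt (𝓡 n) p x) := by
  rw [← contMDiffWithinAt_iff_contDiffWithinAt]
  have h1 := (contMDiffAt_prod_symm t hp).contMDiffWithinAt (s := J ×ˢ univ)
  rw [← (extChartAt (𝓡 n) p).left_inv hp] at hφ
  exact ContMDiffWithinAt.comp (t, extChartAt (𝓡 n) p x) (g := φ) hφ h1
    fun y hy => ⟨hy.1, mem_univ _⟩

theorem contDiffWithinAt_flow_chart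
    (hF : ContMDiffOn (𝓘(ℝ, ℝ).prod (𝓡 n)) (𝓡 k) ∞ (fun z : ℝ × S => F z.1 z.2) (J ×ˢ univ))
    (ht : t ∈ J) (hp : x ∈ (extChartAt (𝓡 n) p).source)
    (hq : F t x ∈ (extChartAt (𝓡 k) q).source) :
    ContDiffWithinAt ℝ ∞ (fun y : ℝ × EuclideanSpace ℝ (Fin n) => inCharts k n p q (F y.1) y.2)
      (J ×ˢ univ) (t, extChartAt (𝓡 n) p x) := by
  have h1 : ContMDiffAt (𝓡 k) 𝓘(ℝ, EuclideanSpace ℝ (Fin k)) ∞ (extChartAt (𝓡 k) q) (F t x) :=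
    contMDiffAt_extChartAt' (by simpa using hq)
  exact contDiffWithinAt_prod_chart (φ := fun z => extChartAt (𝓡 k) q (F z.1 z.2)) hp
    (h1.comp_contMDiffWithinAt (t, x) (hF (t, x) ⟨ht, mem_univ _⟩))

/-- The velocity of a curve in a chart. -/
theorem hasDerivWithinAt_chart {γ : ℝ → M}
    (hγ : MDifferentiableWithinAt 𝓘(ℝ, ℝ) (𝓡 k) γ J t) (hq : γ t ∈ (extChartAt (𝓡 k) q).source)
    {v : EuclideanSpace ℝ (Fin k)} (hv : mfderivWithin 𝓘(ℝ, ℝ) (𝓡 k) γ J t (1 : ℝ) = v) :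
    HasDerivWithinAt (fun s => extChartAt (𝓡 k) q (γ s))
      (tangentCoordChange (𝓡 k) (γ t) q (γ t) v) J t := by
  have hy := mem_source_self (k := k) (γ t)
  let L : ℝ →L[ℝ] EuclideanSpace ℝ (Fin k) := mfderivWithin 𝓘(ℝ, ℝ) (𝓡 k) γ J t
  have h1 : HasFDerivWithinAt (fun s => extChartAt (𝓡 k) (γ t) (γ s)) L J t := by
    have h0 : HasFDerivWithinAt (fun s => extChartAt (𝓡 k) (γ t) (γ s)) L
      (J ∩ range (id : ℝ → ℝ)) t := hγ.hasMFDerivWithinAt.2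
    simpa using h0
  have hL : L 1 = v := hv
  have h2 : HasDerivWithinAt (fun s => extChartAt (𝓡 k) (γ t) (γ s)) v J t :=
    hL ▸ h1.hasDerivWithinAt
  have h3 := hasFDerivAt_transition (k := k) hy hq
  have h4 := h3.comp_hasDerivWithinAt t h2
  refine h4.congr_of_eventuallyEq ?_ (transition_apply hy).symm
  filter_upwards [hγ.continuousWithinAt (source_mem_nhds (k := k) hy)] with s hs
  exact (transition_apply hs).symm

/-- A time-dependent vector field in a chart. -/
theorem contDiffWithinAt_fieldInChart {e : ℝ → ∀ x : S, TangentSpace (𝓡 n) x} {W : Set (ℝ × S)}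
    (hW : IsOpen W) (hmem : (t, p) ∈ W) (ht : t ∈ J)
    (he : ContMDiffOn (𝓘(ℝ, ℝ).prod (𝓡 n)) ((𝓡 n).prod 𝓘(ℝ, EuclideanSpace ℝ (Fin n))) ∞
      (fun z : ℝ × S => TotalSpace.mk' (EuclideanSpace ℝ (Fin n))
        (E := fun x : S => TangentSpace (𝓡 n) x) z.2 (e z.1 z.2)) (W ∩ J ×ˢ univ)) :
    ContDiffWithinAt ℝ ∞ (fun y : ℝ × EuclideanSpace ℝ (Fin n) => fieldInChart p (e y.1) y.2)
      (J ×ˢ univ) (t, extChartAt (𝓡 n) p p) := by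
  have h1 := he (t, p) ⟨hmem, ht, mem_univ _⟩
  rw [contMDiffWithinAt_totalSpace] at h1
  have h2 : ContMDiffWithinAt (𝓘(ℝ, ℝ).prod (𝓡 n)) 𝓘(ℝ, EuclideanSpace ℝ (Fin n)) ∞
      (fun z : ℝ × S => (trivializationAt (EuclideanSpace ℝ (Fin n))
        (fun x : S => TangentSpace (𝓡 n) x) p (TotalSpace.mk' (EuclideanSpace ℝ (Fin n))
        (E := fun x : S => TangentSpace (𝓡 n) x) z.2 (e z.1 z.2))).2) (J ×ˢ univ) (t, p) :=
    h1.2.mono_of_mem_nhdsWithin (Filter.inter_mem (mem_nhdsWithin_of_mem_nhds (hW.mem_nhds hmem))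
      self_mem_nhdsWithin)
  have h3 := contDiffWithinAt_prod_chart (mem_source_self (k := n) p) h2
  refine h3.congr_of_mem ?_ ⟨ht, mem_univ _⟩
  intro y _
  rw [TangentBundle.trivializationAt_apply]
  rfl

end Flow

/-! ### The evolution equation along the mean curvature flow -/

section Evolution

variable {k n : ℕ} {M : Type*} [TopologicalSpace M] [ChartedSpace (EuclideanSpace ℝ (Fin k)) M]
  [IsManifold (𝓡 k) ∞ M]
  {S : Type*} [TopologicalSpace S] [ChartedSpace (EuclideanSpace ℝ (Fin n)) S]
  [IsManifold (𝓡 n) ∞ S]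
  (g : ContMDiffRiemannianMetric (𝓡 k) ∞ (EuclideanSpace ℝ (Fin k))
      (fun x : M => TangentSpace (𝓡 k) x))
  {F : ℝ → S → M} {T t : ℝ} {p : S} {f : S → M}

/-- The mean curvature vector in charts. -/
def meanCurvatureInCharts (f : S → M) (p : S) (q : M) (z : EuclideanSpace ℝ (Fin n)) :
    EuclideanSpace ℝ (Fin k) :=
  tangentCoordChange (𝓡 k) (f ((extChartAt (𝓡 n) p).symm z)) q (f ((extChartAt (𝓡 n) p).symm z))
    (meanCurvature (n := n) (metricFun g) f ((extChartAt (𝓡 n) p).symm z))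

/-- The mean curvature vector gets differentiated in space, so its expression as a trace is needed
near `p` and not only at `p`. -/
theorem eventually_meanCurvatureInCharts_eq (hf : ContMDiff (𝓡 n) (𝓡 k) ∞ f)
    (hi : ∀ x, Function.Injective (mfderivModel k n f x))
    (e : Fin n → S → EuclideanSpace ℝ (Fin n))
    (heo : ∀ᶠ x in 𝓝 p, ∀ i j, inducedModel g f x (e i x) (e j x) = if i = j then 1 else 0) :
    ∀ᶠ z in 𝓝 (extChartAt (𝓡 n) p p), meanCurvatureInCharts g f p (f p) z
      = ∑ l, sff (chr (chartMetric g (f p))) (inCharts k n p (f p) f) (chr (inducedChart g f p)) z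
          (fieldInChart p (e l) z) (fieldInChart p (e l) z) := by
  have hp := mem_source_self (k := n) p
  have hq := mem_source_self (k := k) (f p)
  have hiso := isIsometricNear_inCharts g hf hi hp hq
  filter_upwards [hiso.gauss, eventually_chart hp (heo.and
    (hf.continuous.continuousAt (source_mem_nhds (k := k) hq)))] with z h1 hz
  obtain ⟨x, h2, ⟨h3, h4⟩, rfl, h5⟩ := hz
  rw [meanCurvatureInCharts, h5, meanCurvature_eq g hf h2 h4 (hi x) (chr (inducedChart g f p)) h1
    (fun i => e i x) h3, tcc_cancel (k := k) h4 (mem_source_self (f x))]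
  simp only [fieldInChart_apply _ h2]

theorem IsMeanCurvatureFlow.mdifferentiableWithinAt_curve
    (hF : IsMeanCurvatureFlow (n := n) (metricFun g) T F) (ht : t ∈ Ico 0 T) (x : S) :
    MDifferentiableWithinAt 𝓘(ℝ, ℝ) (𝓡 k) (fun s => F s x) (Ico 0 T) t := by
  have h1 : ContMDiffOn 𝓘(ℝ, ℝ) (𝓘(ℝ, ℝ).prod (𝓡 n)) ∞ (fun s : ℝ => (s, x)) (Ico 0 T) :=
    (contMDiff_id.prodMk contMDiff_const).contMDiffOn
  exact ((hF.smooth.comp h1 fun s hs => ⟨hs, mem_univ _⟩) t ht).mdifferentiableWithinAt (by simp)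

theorem starForm_eq {q : M} {x : S} {Ω : ∀ q : M, TangentSpace (𝓡 k) q [⋀^Fin n]→L[ℝ] ℝ}
    (hf : ContMDiff (𝓡 n) (𝓡 k) ∞ f) (hp : x ∈ (extChartAt (𝓡 n) p).source)
    (hq : f x ∈ (extChartAt (𝓡 k) q).source) (e : S → Fin n → EuclideanSpace ℝ (Fin n)) :
    starForm (n := n) Ω f e x = formInChart Ω q (inCharts k n p q f (extChartAt (𝓡 n) p x)) fun i =>
      fderiv ℝ (inCharts k n p q f) (extChartAt (𝓡 n) p x)
        (fieldInChart p (fun x => e x i) (extChartAt (𝓡 n) p x)) := by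
  have h1 : starForm (n := n) Ω f e x = formModel Ω (f x) fun i => mfderivModel k n f x (e x i) := rfl
  rw [h1, formModel_eq hq, inCharts_apply f q hp]
  congr 1
  ext1 i
  rw [fderiv_inCharts (mdifferentiable_of_contMDiff hf x) hp hq]
  refine congrArg _ (congrArg _ ((congrArg _ (fieldInChart_apply (fun x => e x i) hp)).trans ?_).symm)
  exact tcc_cancel (mem_source_self x) hp _

/-- The flow equation in the fixed charts, at all points near `p`, as the interchange of time and
space derivatives requires. -/
theorem IsMeanCurvatureFlow.eventually_hasDerivWithinAt
    (hF : IsMeanCurvatureFlow (n := n) (metricFun g) T F) (ht : t ∈ Ico 0 T) :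
    ∀ᶠ z in 𝓝 (extChartAt (𝓡 n) p p), HasDerivWithinAt
      (fun s => inCharts k n p (F t p) (F s) z) (meanCurvatureInCharts g (F t) p (F t p) z)
      (Ico 0 T) t := by
  have hp := mem_source_self (k := n) p
  have hq := mem_source_self (k := k) (F t p)
  have hf := contMDiff_slice (k := k) (n := n) hF.smooth ht
  filter_upwards [eventually_chart hp (hf.continuous.continuousAt (source_mem_nhds (k := k) hq))]
    with z hz
  obtain ⟨x, h2, h4, rfl, h5⟩ := hz
  have h8 := hasDerivWithinAt_chart (hF.mdifferentiableWithinAt_curve g ht x) h4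
    (hF.evolution t ht x)
  rw [meanCurvatureInCharts, h5]
  simp only [inCharts_apply (k := k) _ _ h2]
  exact h8

/-- `evolution_form` is applied in the charts at `p` and `F t p`. At the base points the coordinate
changes are the identity, so metric, form, II and curvature there agree with their coordinate
expressions without any conversion factor. -/
theorem evolution_starForm (hF : IsMeanCurvatureFlow (n := n) (metricFun g) T F)
    {Ω : ∀ q : M, TangentSpace (𝓡 k) q [⋀^Fin n]→L[ℝ] ℝ} (hΩ : IsSmoothForm Ω)
    (ht : t ∈ Ico 0 T) {e : ℝ → S → Fin n → EuclideanSpace ℝ (Fin n)}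
    (he : IsOrthonormalTangentFrameNear (metricFun g) T F t p e)
    {κ : Type*} [Fintype κ] (ν : κ → EuclideanSpace ℝ (Fin k))
    (hν : ∀ α u, innerModel g (F t p) (mfderivModel k n (F t) p u) (ν α) = 0)
    (hspan : ∀ w, w = ∑ j, innerModel g (F t p) w (mfderivModel k n (F t) p (e t p j))
        • mfderivModel k n (F t) p (e t p j) + ∑ α, innerModel g (F t p) w (ν α) • ν α)
    (E : Fin n → EuclideanSpace ℝ (Fin k)) (hE : E = fun i => mfderivModel k n (F t) p (e t p i))
    (h : κ → Fin n → Fin n → ℝ) (hh : h = fun α i l => innerModel g (F t p)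
      (secondFundamentalForm (n := n) (metricFun g) (F t) p (e t p i) (e t p l)) (ν α))
    (DΩ : EuclideanSpace ℝ (Fin k) → (Fin n → EuclideanSpace ℝ (Fin k)) → ℝ)
    (hDΩ : DΩ = covTensorAlong (n := k) (k := k) (metricFun g) (id : M → M) (fun q v => Ω q v)
      (F t p)) :
    HasDerivWithinAt (fun s => starForm Ω (F s) (e s) p)
      (laplacian (inducedMetric (n := n) (metricFun g) (F t)) (starForm Ω (F t) (e t)) p
        + starForm Ω (F t) (e t) p * (∑ α, ∑ i, ∑ l, h α i l ^ 2)
        - 2 * ∑ α, ∑ β, ∑ l, ∑ i, ∑ j with i < j,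
            formModel Ω (F t p) (Function.update (Function.update E i (ν α)) j (ν β))
              * h α i l * h β j l
        - ∑ α, ∑ l, ∑ i, formModel Ω (F t p) (Function.update E i (ν α))
            * innerModel g (F t p) (curvature (metricFun g) (F t p) (E l) (E i) (E l)) (ν α)
        + DΩ (meanCurvature (n := n) (metricFun g) (F t) p) E
        - ∑ l, (covTensorAlong (n := n) (metricFun g) (F t)
              (fun x => covTensorAlong (n := n) (metricFun g) (F t) (fun x' v => Ω (F t x') v) x
                (e t x l)) p (e t p l) E
            - DΩ (mfderivModel k n (F t) p
                (covAlong (inducedMetric (n := n) (metricFun g) (F t)) (id : S → S)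
                  (fun x => e t x l) p (e t p l))) E)
        - 2 * ∑ α, ∑ l, ∑ i, DΩ (E l) (Function.update E i (ν α)) * h α i l)
      (Ico 0 T) t := by
  have hp := mem_source_self (k := n) p
  have hq := mem_source_self (k := k) (F t p)
  have hf := contMDiff_slice (k := k) (n := n) hF.smooth ht
  have hi : ∀ x : S, Function.Injective (mfderivModel k n (F t) x) := hF.immersion t ht
  have hJ := uniqueDiffOn_Ico (0 : ℝ) T
  -- This covers t = 0: the interval is nondegenerate because it contains `t`, so each of its points
  -- is a limit of interior points.
  have hcl : t ∈ closure (interior (Ico 0 T)) := by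
    rw [interior_Ico, closure_Ioo (ht.1.trans_lt ht.2).ne]
    exact Ico_subset_Icc_self ht
  obtain ⟨W, hWo, hWm, hes, heo⟩ := he
  set z₀ := extChartAt (𝓡 n) p p with hz₀
  set f := F t with hfdef
  set fh := inCharts k n p (f p) f with hfh
  set Γ := chr (chartMetric (k := k) g (f p)) with hΓ
  set Γ' := chr (inducedChart (n := n) g f p) with hΓ'
  set σ := formInChart (k := k) Ω (f p) with hσdef
  let a : Fin n → S → EuclideanSpace ℝ (Fin n) := fun i x => e t x i
  let ê : Fin n → EuclideanSpace ℝ (Fin n) → EuclideanSpace ℝ (Fin n) := fun i => fieldInChart p (a i)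
  have hê : ∀ i, ê i z₀ = a i p := fun i => fieldInChart_self (a i) p
  have hfz : fh z₀ = extChartAt (𝓡 k) (f p) (f p) := inCharts_apply (k := k) f _ hp
  -- smoothness of the frame
  have hesm : ∀ i, ContDiffWithinAt ℝ ∞ (fun y : ℝ × EuclideanSpace ℝ (Fin n) =>
      fieldInChart p (fun x => e y.1 x i) y.2) (Ico 0 T ×ˢ univ) (t, z₀) := fun i =>
    contDiffWithinAt_fieldInChart (e := fun s x => e s x i) hWo hWm ht (hes i)
  have hês : ∀ i, ContDiffAt ℝ ∞ (ê i) z₀ := by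
    intro i
    rw [← contDiffWithinAt_univ]
    exact (hesm i).comp z₀ (contDiff_const.prodMk contDiff_id).contDiffWithinAt
      fun z _ => ⟨ht, mem_univ _⟩
  have het : ∀ i, DifferentiableWithinAt ℝ (fun s => (e s p i : EuclideanSpace ℝ (Fin n)))
      (Ico 0 T) t := by
    intro i
    have h1 : DifferentiableWithinAt ℝ (fun s => fieldInChart p (fun x => e s x i) z₀)
        (Ico 0 T) t :=
      ((hesm i).differentiableWithinAt (by simp)).comp t
        (f := fun s => ((s, z₀) : ℝ × EuclideanSpace ℝ (Fin n)))
        (differentiableWithinAt_id.prodMk (differentiableWithinAt_const _))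
        fun s hs => ⟨hs, mem_univ _⟩
    exact h1.congr (fun s _ => (fieldInChart_self (fun x => e s x i) p).symm)
      (fieldInChart_self (fun x => e t x i) p).symm
  -- orthonormality of the frame
  have heo_x : ∀ᶠ x in 𝓝 p, ∀ i j, inducedModel g f x (a i x) (a j x) = if i = j then 1 else 0 := by
    have h1 : ∀ᶠ x in 𝓝 p, (t, x) ∈ W :=
      (Continuous.prodMk_right t).continuousAt (hWo.mem_nhds hWm)
    exact h1.mono fun x hx => heo (t, x) ⟨hx, ht, mem_univ _⟩
  have heo_s : ∀ᶠ s in 𝓝[Ico 0 T] t, ∀ i j, inducedModel g (F s) p (e s p i) (e s p j)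
      = if i = j then 1 else 0 := by
    have h1 : ∀ᶠ s in 𝓝 t, (s, p) ∈ W :=
      (Continuous.prodMk_left p).continuousAt (hWo.mem_nhds hWm)
    filter_upwards [mem_nhdsWithin_of_mem_nhds h1, self_mem_nhdsWithin] with s hs hsJ
    exact heo (s, p) ⟨hs, hsJ, mem_univ _⟩
  have hiso : IsIsometricNear (chartMetric g (f p)) Γ fh Γ' z₀ :=
    isIsometricNear_inCharts g hf hi hp hq
  have hfr : IsFrameNear (chartMetric g (f p)) fh ê z₀ := isFrameNear_inCharts g hf hp hq a hês heo_x
  have hσ : ContDiffAt ℝ ∞ σ (fh z₀) := by rw [hfz]; exact contDiffAt_formInChart hΩ hq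
  -- values at the base point
  have hDf : ∀ u, mfderivModel k n f p u = fderiv ℝ fh z₀ u := fun u => by
    rw [mfderivModel_eq (mdifferentiable_of_contMDiff hf p) hp hq, tcc_self hq, tcc_self hp]
  have hG : ∀ u v, innerModel g (f p) u v = chartMetric g (f p) (fh z₀) u v := fun u v => by
    rw [innerModel_eq g hq, tcc_self hq, tcc_self hq, hfz]
  have hΩp : ∀ w, formModel Ω (f p) w = σ (fh z₀) w := fun w => by
    rw [formModel_eq hq, hfz]
    simp only [tcc_self hq, hσdef]
  have hE' : E = fun i => fderiv ℝ fh z₀ (ê i z₀) := by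
    rw [hE]; ext1 i; rw [hDf, hê]
  have hH := eventually_meanCurvatureInCharts_eq g hf hi a heo_x
  have hHp : meanCurvatureInCharts g f p (f p) z₀ = meanCurvature (n := n) (metricFun g) f p := by
    rw [meanCurvatureInCharts, (extChartAt (𝓡 n) p).left_inv hp]
    exact tcc_self (k := k) hq _
  have hHt := hF.eventually_hasDerivWithinAt g (p := p) ht
  have hflow : ContDiffWithinAt ℝ ∞ (fun y : ℝ × EuclideanSpace ℝ (Fin n) =>
      inCharts k n p (f p) (F y.1) y.2) (Ico 0 T ×ˢ univ) (t, z₀) :=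
    contDiffWithinAt_flow_chart hF.smooth ht hp hq
  have hY : ∀ i, HasDerivWithinAt (fun s => fderiv ℝ (inCharts k n p (f p) (F s)) z₀ (e s p i))
      (fderiv ℝ (meanCurvatureInCharts g f p (f p)) z₀ (ê i z₀)
        + fderiv ℝ fh z₀ (derivWithin (fun s => (e s p i : EuclideanSpace ℝ (Fin n))) (Ico 0 T) t))
      (Ico 0 T) t := by
    intro i
    rw [hê]
    exact hasDerivWithinAt_fderiv_slice hJ ht hcl hflow hHt (het i).hasDerivWithinAt
  -- For times near `t` the moving point stays in the chart at `F t p`, so that one chart serves for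
  -- the whole time derivative.
  have hq_s : ∀ᶠ s in 𝓝[Ico 0 T] t, F s p ∈ (extChartAt (𝓡 k) (f p)).source :=
    (hF.mdifferentiableWithinAt_curve g ht p).continuousWithinAt (source_mem_nhds (k := k) hq)
  have hunit : ∀ᶠ s in 𝓝[Ico 0 T] t, ∀ i, chartMetric g (f p) (inCharts k n p (f p) (F s) z₀)
      (fderiv ℝ (inCharts k n p (f p) (F s)) z₀ (e s p i))
      (fderiv ℝ (inCharts k n p (f p) (F s)) z₀ (e s p i)) = 1 := by
    filter_upwards [hq_s, heo_s, self_mem_nhdsWithin] with s h1 h2 hs i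
    have h3 := inducedChart_apply g (contMDiff_slice (k := k) (n := n) hF.smooth hs) hp h1
    have h4 := inducedChart_fieldInChart g (f := F s) (fun x => e s x i) (fun x => e s x i) hp
    rw [h3, fieldInChart_self, h2, if_pos rfl] at h4
    exact h4
  have hν' : ∀ α y, chartMetric g (f p) (fh z₀) (fderiv ℝ fh z₀ y) (ν α) = 0 := fun α y => by
    rw [← hDf, ← hG, hν]
  have hspan' : ∀ w, w = ∑ j, chartMetric g (f p) (fh z₀) w (E j) • E j
      + ∑ α, chartMetric g (f p) (fh z₀) w (ν α) • ν α := fun w => by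
    simp only [← hG, hE]
    exact hspan w
  have hsff : ∀ u v : EuclideanSpace ℝ (Fin n), secondFundamentalForm (n := n) (metricFun g) f p u v = sff Γ fh Γ' z₀ u v := by
    intro u v
    have h1 := secondFundamentalForm_eq g hf hp hq (hi p) Γ' hiso.gauss.self_of_nhds u v
    rw [tcc_self (k := k) hq, tcc_self hp, tcc_self hp] at h1
    exact h1
  have hh' : ∀ α i l, h α i l
      = chartMetric g (f p) (fh z₀) (sff Γ fh Γ' z₀ (ê i z₀) (ê l z₀)) (ν α) := by
    intro α i l
    rw [hh, hê, hê, ← hG]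
    exact congrArg (fun v => innerModel g (f p) v (ν α)) (hsff _ _)
  have hφ : ∀ x ∈ (extChartAt (𝓡 n) p).source, f x ∈ (extChartAt (𝓡 k) (f p)).source →
      starForm Ω f (e t) x = σ (fh (extChartAt (𝓡 n) p x)) fun i =>
        fderiv ℝ fh (extChartAt (𝓡 n) p x) (ê i (extChartAt (𝓡 n) p x)) :=
    fun x hx hfx => starForm_eq hf hx hfx (e t)
  have hφev : starForm Ω f (e t) ∘ (extChartAt (𝓡 n) p).symm =ᶠ[𝓝 z₀]
      fun z => σ (fh z) fun i => fderiv ℝ fh z (ê i z) := by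
    filter_upwards [eventually_chart hp (hf.continuous.continuousAt (source_mem_nhds (k := k) hq))]
      with z hz
    obtain ⟨x, h1, h2, rfl, h3⟩ := hz
    rw [Function.comp_apply, h3, hφ x h1 h2]
  have hmain := evolution_form hiso hfr hσ E hE' _ rfl ν hν' hspan' (meanCurvatureInCharts g f p (f p))
    hH h hh' (hJ t ht) rfl hHt.self_of_nhds (fun i => by rw [hE']; exact congrArg _ (hê i).symm)
    _ hY hunit
  have hstar : ∀ᶠ s in 𝓝[Ico 0 T] t, starForm Ω (F s) (e s) p
      = σ (inCharts k n p (f p) (F s) z₀) fun i =>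
        fderiv ℝ (inCharts k n p (f p) (F s)) z₀ (e s p i) := by
    filter_upwards [hq_s, self_mem_nhdsWithin] with s h1 hs
    rw [starForm_eq (contMDiff_slice (k := k) (n := n) hF.smooth hs) hp h1 (e s)]
    simp only [← hz₀, hσdef]
    congr 1
    ext1 i
    exact congrArg _ (fieldInChart_self (fun x => e s x i) p)
  refine (hmain.congr_of_eventuallyEq hstar (hstar.self_of_nhdsWithin ht)).congr_deriv ?_
  have hcurv : ∀ u v w : EuclideanSpace ℝ (Fin k),
      curvature (metricFun g) (f p) u v w = curv Γ (fh z₀) u v w := fun u v w =>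
    (curvature_eq_curv g (f p) u v w).trans (by rw [hfz])
  have hDΩ' : ∀ u w, DΩ u w = covForm Γ σ (fh z₀) u w := by
    intro u w
    rw [hDΩ, hfz]
    exact covTensorAlong_id g hΩ (f p) u w
  have hlap := laplacian_eq g hf (hi p) (fun i => a i p) (heo_x.self_of_nhds) hφev
    (contDiffAt_form_apply (hσ.comp z₀ hiso.contDiff_f) fun i =>
      (ContDiffAt.fderiv_infty hiso.contDiff_f).clm_apply (hês i))
  refine congrArg₂ HSub.hSub (congrArg₂ HSub.hSub (congrArg₂ HAdd.hAdd (congrArg₂ HSub.hSub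
    (congrArg₂ HSub.hSub (congrArg₂ HAdd.hAdd ?_ ?_) ?_) ?_) ?_) ?_) ?_
  · rw [hlap]
    exact Finset.sum_congr rfl fun l _ => by rw [hê]
  · exact congrArg (· * _) (hφ p hp hq).symm
  · simp only [hΩp]
  · refine Finset.sum_congr rfl fun α _ => Finset.sum_congr rfl fun l _ =>
      Finset.sum_congr rfl fun i _ => ?_
    rw [hΩp, ← hG]
    exact congrArg (fun v => _ * innerModel g (f p) v (ν α)) (hcurv _ _ _).symm
  · rw [← hDΩ', hHp]
  · refine Finset.sum_congr rfl fun l _ => congrArg₂ HSub.hSub ?_ ?_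
    · refine ((covTensorAlong_covTensorAlong g hΩ hf (a l)
        (ContDiffAt.differentiableAt_infty (hês l)) (a l p) E).trans ?_).symm
      rw [← hê, hE']
    · rw [← hDΩ', ← hDf]
      refine congrArg (fun v => DΩ (mfderivModel k n f p v) E) ?_
      rw [hê]
      exact (covAlong_id_inducedMetric g hf (hi p) (a l)
        (ContDiffAt.differentiableAt_infty (hês l)) (a l p)).symm
  · simp only [hDΩ']

end Evolution

end MCF

end

theorem proposition3p1 {n m : ℕ}
    {M : Type*} [TopologicalSpace M] [ChartedSpace (EuclideanSpace ℝ (Fin (n + m))) M]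
    [IsManifold (𝓡 (n + m)) ∞ M]
    {S : Type*} [TopologicalSpace S] [ChartedSpace (EuclideanSpace ℝ (Fin n)) S]
    [IsManifold (𝓡 n) ∞ S]
    (g : ContMDiffRiemannianMetric (𝓡 (n + m)) ∞ (EuclideanSpace ℝ (Fin (n + m)))
      (fun x : M => TangentSpace (𝓡 (n + m)) x))
    (T : ℝ) (F : ℝ → S → M) (hF : MCF.IsMeanCurvatureFlow (n := n) (MCF.metricFun g) T F)
    (Ω : ∀ q : M, TangentSpace (𝓡 (n + m)) q [⋀^Fin n]→L[ℝ] ℝ) (hΩ : MCF.IsSmoothForm Ω)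
    (t : ℝ) (ht : t ∈ Ico 0 T) (p : S)
    (e : ℝ → ∀ x : S, Fin n → TangentSpace (𝓡 n) x)
    (he : MCF.IsOrthonormalTangentFrameNear (MCF.metricFun g) T F t p e)
    (ν : Fin m → TangentSpace (𝓡 (n + m)) (F t p))
    (hν : MCF.IsOrthonormalNormalFrame (n := n) (MCF.metricFun g) (F t) p ν) :
    -- `E i` is the vector `eᵢ` at `(p, t)`, as a vector of `T_{F(p, t)} M`
    let E : Fin n → TangentSpace (𝓡 (n + m)) (F t p) := fun i =>
      mfderiv (𝓡 n) (𝓡 (n + m)) (F t) p (e t p i)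
    -- the components `h_{α i k}` of the second fundamental form at `(p, t)`
    let h : Fin m → Fin n → Fin n → ℝ := fun α i k =>
      MCF.metricFun g (F t p)
        (MCF.secondFundamentalForm (n := n) (MCF.metricFun g) (F t) p (e t p i) (e t p k)) (ν α)
    -- `DΩ V = ∇^M_V Ω` for `V ∈ T_{F(p, t)} M`
    let DΩ : TangentSpace (𝓡 (n + m)) (F t p) →
        (Fin n → TangentSpace (𝓡 (n + m)) (F t p)) → ℝ :=
      MCF.covTensorAlong (n := n + m) (k := n + m) (MCF.metricFun g) (id : M → M) (fun q v => Ω q v) (F t p)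
    HasDerivWithinAt (fun s => MCF.starForm Ω (F s) (e s) p)
      (MCF.laplacian (MCF.inducedMetric (n := n) (MCF.metricFun g) (F t))
          (MCF.starForm Ω (F t) (e t)) p
        + MCF.starForm Ω (F t) (e t) p * (∑ α, ∑ i, ∑ k, h α i k ^ 2)
        - 2 * ∑ α, ∑ β, ∑ k, ∑ i, ∑ j with i < j,
            Ω (F t p) (Function.update (Function.update E i (ν α)) j (ν β)) * h α i k * h β j k
        - ∑ α, ∑ k, ∑ i, Ω (F t p) (Function.update E i (ν α))
            * MCF.curvature4 (MCF.metricFun g) (F t p) (ν α) (E k) (E k) (E i)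
        + DΩ (MCF.meanCurvature (n := n) (MCF.metricFun g) (F t) p) E
        -- `∇_{e_k} (∇_{e_k} Ω) - ∇_{∇^S_{e_k} e_k} Ω`
        - ∑ k, (MCF.covTensorAlong (n := n) (MCF.metricFun g) (F t)
              (fun x => MCF.covTensorAlong (n := n) (MCF.metricFun g) (F t) (fun x' v => Ω (F t x') v) x
                (e t x k)) p (e t p k) E
            - DΩ (mfderiv (𝓡 n) (𝓡 (n + m)) (F t) p
                (MCF.covAlong (MCF.inducedMetric (n := n) (MCF.metricFun g) (F t)) (id : S → S)
                  (fun x => e t x k) p (e t p k))) E)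
        - 2 * ∑ α, ∑ k, ∑ i, DΩ (E k) (Function.update E i (ν α)) * h α i k)
      (Ico 0 T) t := by
  intro E h DΩ
  let b : EuclideanSpace ℝ (Fin (n + m)) →L[ℝ] EuclideanSpace ℝ (Fin (n + m)) →L[ℝ] ℝ :=
    MCF.innerModel g (F t p)
  let N : Fin m → EuclideanSpace ℝ (Fin (n + m)) := ν
  let E' : Fin n → EuclideanSpace ℝ (Fin (n + m)) := fun i =>
    MCF.mfderivModel (n + m) n (F t) p (e t p i)
  have hb : ∀ u v, b u v = b v u := MCF.innerModel_symm g (F t p)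
  have hNN : ∀ α β, b (N α) (N β) = if α = β then 1 else 0 := hν.1
  have hNE : ∀ α (u : EuclideanSpace ℝ (Fin n)),
      b (N α) (MCF.mfderivModel (n + m) n (F t) p u) = 0 := hν.2
  have hEE : ∀ i j, b (E' i) (E' j) = if i = j then 1 else 0 := by
    obtain ⟨W, -, hW, -, hon⟩ := he
    exact hon (t, p) ⟨hW, ht, mem_univ _⟩
  -- The `n` tangent and `m` normal vectors together form an orthonormal system of the right
  -- cardinality in a space of dimension n + m, hence a basis.
  have hspan : ∀ w, w = ∑ j, b w (E' j) • E' j + ∑ α, b w (N α) • N α := by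
    intro w
    have := MCF.eq_sum_of_orthonormal b (Sum.elim E' N) (by
      rintro (i | α) (j | β)
      · simpa using hEE i j
      · simpa [hb (E' i)] using hNE β (e t p i)
      · simpa using hNE α (e t p j)
      · simpa using hNN α β) (by simp) w
    simpa only [Fintype.sum_sum_type, Sum.elim_inl, Sum.elim_inr] using this
  -- With the index convention of `curvature4`, the curvature term unfolds to ⟨R(eₖ, eᵢ)eₖ, e_α⟩,
  -- the form in which Codazzi delivered it.
  exact MCF.evolution_starForm g hF hΩ ht he N (fun α u => (hb _ _).trans (hNE α u)) hspan
    E rfl h rfl DΩ rfl
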